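/- Let $n\in\{2,3\}$, $L,T,\sigma>0$, $Q=(0,L]^n$. All functions are $L$-periodic in each space coordinate. For a force $f=f(t,x)\in\mathbf R^n$ ($C^2$ in $x$) and a terminal field $\varphi$, a *classical solution on $[0,T']$* of the Navier–Stokes problem with negative direction of time is a pair $(u,p)$ with $$\frac{\partial u}{\partial t}+\frac{\sigma^2}{2}\Delta u-(u,\nabla)u-\nabla p+f=0\ (0\le t<T'),\qquad \operatorname{div}u=0,\qquad u(T',\cdot)=\varphi,$$ with $\int_Q u(t,x)\,dx=0$ for all $t$, $u\in C^3([0,T']\times\mathbf R^n)$ and $p(t,\cdot)\in C^2$. For a vorticity $\omega$ with Fourier coefficients $\omega_{\mathbf m}=L^{-n}\int_Q\omega(x)e^{-i(2\pi/L)(\mathbf m,x)}dx$ let $U\omega$ be the periodic Biot–Savart velocity $$U\omega(x)=\frac{iL}{2\pi}\sum_{\mathbf m\in\mathbf Z^n,\ \mathbf m\ne0}\frac{e^{i(2\pi/L)(\mathbf m,x)}}{|\mathbf m|^2}\,\mathbf m\times\omega_{\mathbf m},\qquad \mathbf m\times\omega_{\mathbf m}:=\omega_{\mathbf m}(m_2,-m_1)^\top\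 \text{ if } n=2 ,$$ where for $n=2$ the vorticity $\omega$ is a scalar and $\operatorname{curl}u=\partial_1u^2-\partial_2u^1$. Let $N\ge1$, $h=T/N$, $t_k=kh$. An approximation with frozen velocity consists of $\tilde\omega_k\in C^3([t_k,t_{k+1}]\times\mathbf R^n)$, $k=N-1,\dots,0$, such that, with $\hat u_k:=U\tilde\omega_k(t_{k+1},\cdot)$, $$\frac{\partial\tilde\omega_k}{\partial t}+\frac{\sigma^2}{2}\Delta\tilde\omega_k-(\hat u_k,\nabla)\tilde\omega_k+(\tilde\omega_k,\nabla)\hat u_k+\operatorname{curl}f=0,\qquad t_k\le t<t_{k+1}$$ (without the term $(\tilde\omega_k,\nabla)\hat u_k$ if $n=2$), $\tilde\omega_{N-1}(t_N,\cdot)=\operatorname{curl}\varphi$ and $\tilde\omega_k(t_{k+1},\cdot)=\tilde\omega_{k+1}(t_{k+1},\cdot)$ for $k\le N-2$. The velocity approximation is $\tilde u(t,\cdot)=U\tilde\omega_k(t,\cdot)$ for $t_k\le t\le t_{k+1}$. **Theorem.** For every $M$ there is a constant $K$, depending only on $n,L,T,\sigma,M$, with the following property. Let $(u,p)$ be a classical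 solution on $[0,T]$ with force $f$ and terminal field $\varphi$, let $N\ge1$, and let $\tilde\omega_k$, $0\le k<N$, be an approximation with frozen velocity. Assume that for every $k=1,\dots,N$ the Navier–Stokes problem on $[0,t_k]$ with the same force $f$ and the terminal field $\tilde u(t_k,\cdot)$ has a classical solution ${}_ku$ whose derivatives in $(t,x)$ of orders $0,1,2$ are bounded by $M$ on $[0,t_k]\times\mathbf R^n$. Then $\tilde u$ is of first order in $h$ in the $L^2$-norm: $$\|u(t,\cdot)-\tilde u(t,\cdot)\|_{L^2(Q)}\le K h\qquad\text{for all } t\in[0,T].$$ -/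

import Mathlib

open MeasureTheory Set

noncomputable section

namespace PeriodicNSE

/-- The Euclidean space of dimension `n` (with the Euclidean norm). -/
abbrev E (n : ℕ) : Type := EuclideanSpace ℝ (Fin n)

/-! ### Periodic fields and differential operators in space -/

/-- Periodicity with period `L` in every coordinate direction. -/
def SpacePeriodic {n : ℕ} {F : Type*} (L : ℝ) (v : E n → F) : Prop :=
  ∀ (x : E n) (i : Fin n), v (x + L • EuclideanSpace.single i (1 : ℝ)) = v x

/-- The cube of periods `(0, L]ⁿ`. -/
def cell (n : ℕ) (L : ℝ) : Set (E n) := {x | ∀ i, x i ∈ Ioc 0 L}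

/-- The partial derivative of the `j`-th component of `v` in the `i`-th direction. -/
def partialD {n : ℕ} (i j : Fin n) (v : E n → E n) (x : E n) : ℝ :=
  fderiv ℝ (fun y => v y j) x (EuclideanSpace.single i (1 : ℝ))

/-- The divergence of a vector field. -/
def divergence {n : ℕ} (v : E n → E n) (x : E n) : ℝ := ∑ i, partialD i i v x

/-- The (scalar) curl of a planar vector field. -/
def curl2 (v : E 2 → E 2) (x : E 2) : ℝ := partialD 0 1 v x - partialD 1 0 v x

/-- The curl of a vector field in dimension three. -/
def curl3 (v : E 3 → E 3) (x : E 3) : E 3 :=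
  !₂[partialD 1 2 v x - partialD 2 1 v x,
     partialD 2 0 v x - partialD 0 2 v x,
     partialD 0 1 v x - partialD 1 0 v x]

/-- The directional derivative `(a, ∇) v` of the field `v` along the field `a`. -/
def advect {n : ℕ} {F : Type*} [NormedAddCommGroup F] [NormedSpace ℝ F]
    (a : E n → E n) (v : E n → F) (x : E n) : F := fderiv ℝ v x (a x)

/-! ### Fourier series and the periodic Biot-Savart law -/

/-- The Fourier mode `exp (i (2π/L) (m, x))`. -/
def mode {n : ℕ} (L : ℝ) (m : Fin n → ℤ) (x : E n) : ℂ :=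
  Complex.exp (Complex.I * ((2 * Real.pi / L * ∑ i, (m i : ℝ) * x i : ℝ) : ℂ))

/-- The Fourier coefficient `L⁻ⁿ ∫ g(x) exp (-i (2π/L) (m, x)) dx` over the cube of periods. -/
def coeff {n : ℕ} (L : ℝ) (g : E n → ℝ) (m : Fin n → ℤ) : ℂ :=
  ((1 / L ^ n : ℝ) : ℂ) * ∫ x in cell n L, (g x : ℂ) * mode L (-m) x

/-- The squared length `|m|²` of a wave vector. -/
def normSqZ {n : ℕ} (m : Fin n → ℤ) : ℝ := ∑ i, (m i : ℝ) ^ 2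

/-- The series `(i L / 2π) ∑_m |m|⁻² c_m exp (i (2π/L) (m, x))`. In the uses below `c 0 = 0`, so the
sum runs over `m ≠ 0`, and the sum is real, so that taking the real part loses nothing. -/
def potentialSeries {n : ℕ} (L : ℝ) (c : (Fin n → ℤ) → ℂ) (x : E n) : ℝ :=
  (Complex.I * ((L / (2 * Real.pi) : ℝ) : ℂ) *
    ∑' m : Fin n → ℤ, ((1 / normSqZ m : ℝ) : ℂ) * mode L m x * c m).re

/-- The velocity `U ω` of a scalar vorticity in dimension two. -/
def biotSavart2 (L : ℝ) (ω : E 2 → ℝ) (x : E 2) : E 2 :=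
  !₂[potentialSeries L (fun m => coeff L ω m * (m 1 : ℂ)) x,
     -potentialSeries L (fun m => coeff L ω m * (m 0 : ℂ)) x]

/-- The velocity `U ω` of a vorticity field in dimension three. -/
def biotSavart3 (L : ℝ) (ω : E 3 → E 3) (x : E 3) : E 3 :=
  !₂[potentialSeries L (fun m =>
        coeff L (fun y => ω y 2) m * (m 1 : ℂ) - coeff L (fun y => ω y 1) m * (m 2 : ℂ)) x,
     potentialSeries L (fun m =>
        coeff L (fun y => ω y 0) m * (m 2 : ℂ) - coeff L (fun y => ω y 2) m * (m 0 : ℂ)) x,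
     potentialSeries L (fun m =>
        coeff L (fun y => ω y 1) m * (m 0 : ℂ) - coeff L (fun y => ω y 0) m * (m 1 : ℂ)) x]

/-! ### The Navier-Stokes equations with negative direction of time -/

/-- `(u, p)` is a (sufficiently smooth) classical solution on `[0, T]`, with zero space average, of
`∂u/∂t + (σ²/2) Δu - (u, ∇)u - ∇p + f = 0`, `div u = 0`, `u(T, ·) = φ`, periodic in space. -/
structure IsNSESolution {n : ℕ} (L σ T : ℝ) (f : ℝ → E n → E n) (φ : E n → E n)
    (u : ℝ → E n → E n) (p : ℝ → E n → ℝ) : Prop where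
  smooth : ContDiffOn ℝ 3 (fun z : ℝ × E n => u z.1 z.2) (Icc 0 T ×ˢ univ)
  smooth_pressure : ∀ t ∈ Ico 0 T, ContDiff ℝ 2 (p t)
  periodic : ∀ t ∈ Icc 0 T, SpacePeriodic L (u t)
  periodic_pressure : ∀ t ∈ Ico 0 T, SpacePeriodic L (p t)
  momentum : ∀ t ∈ Ico 0 T, ∀ x : E n,
    HasDerivWithinAt (fun s => u s x)
      (-((σ ^ 2 / 2) • Laplacian.laplacian (u t) x) + advect (u t) (u t) x
        + gradient (p t) x - f t x) (Icc 0 T) t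
  incompressible : ∀ t ∈ Icc 0 T, ∀ x : E n, divergence (u t) x = 0
  zero_average : ∀ t ∈ Icc 0 T, ∫ x in cell n L, u t x = 0
  terminal : u T = φ

/-- All derivatives in `(t, x)` of order at most two are bounded by `M` on `[0, T] × ℝⁿ`. -/
def DerivativesBoundedBy {n : ℕ} (M T : ℝ) (v : ℝ → E n → E n) : Prop :=
  ∀ j : ℕ, j ≤ 2 → ∀ z ∈ (Icc 0 T ×ˢ univ : Set (ℝ × E n)),
    ‖iteratedFDerivWithin ℝ j (fun z : ℝ × E n => v z.1 z.2) (Icc 0 T ×ˢ univ) z‖ ≤ M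

/-! ### The approximation with frozen velocity -/

/-- The node `t_k = k h`, `h = T / N`, of the uniform partition. -/
def node (T : ℝ) (N k : ℕ) : ℝ := k * (T / N)

/-- Dimension two: for `k < N`, `w k` is the approximation of the vorticity on `[t_k, t_{k+1}]`,
obtained backwards from `curl φ` by freezing the velocity at `U (w k t_{k+1})`. -/
structure IsVorticityApprox2 (L σ T : ℝ) (N : ℕ) (f : ℝ → E 2 → E 2) (φ : E 2 → E 2)
    (w : ℕ → ℝ → E 2 → ℝ) : Prop where
  smooth : ∀ k < N, ContDiffOn ℝ 3 (fun z : ℝ × E 2 => w k z.1 z.2)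
    (Icc (node T N k) (node T N (k + 1)) ×ˢ univ)
  periodic : ∀ k < N, ∀ t ∈ Icc (node T N k) (node T N (k + 1)), SpacePeriodic L (w k t)
  equation : ∀ k < N, ∀ t ∈ Ico (node T N k) (node T N (k + 1)), ∀ x : E 2,
    HasDerivWithinAt (fun s => w k s x)
      (-((σ ^ 2 / 2) * Laplacian.laplacian (w k t) x)
        + advect (biotSavart2 L (w k (node T N (k + 1)))) (w k t) x
        - curl2 (f t) x) (Icc (node T N k) (node T N (k + 1))) t
  terminal : w (N - 1) (node T N N) = curl2 φ
  matching : ∀ k, k + 1 < N → w k (node T N (k + 1)) = w (k + 1) (node T N (k + 1))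

/-- Dimension three: for `k < N`, `w k` is the approximation of the vorticity on `[t_k, t_{k+1}]`,
obtained backwards from `curl φ` by freezing the velocity at `U (w k t_{k+1})`. -/
structure IsVorticityApprox3 (L σ T : ℝ) (N : ℕ) (f : ℝ → E 3 → E 3) (φ : E 3 → E 3)
    (w : ℕ → ℝ → E 3 → E 3) : Prop where
  smooth : ∀ k < N, ContDiffOn ℝ 3 (fun z : ℝ × E 3 => w k z.1 z.2)
    (Icc (node T N k) (node T N (k + 1)) ×ˢ univ)
  periodic : ∀ k < N, ∀ t ∈ Icc (node T N k) (node T N (k + 1)), SpacePeriodic L (w k t)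
  equation : ∀ k < N, ∀ t ∈ Ico (node T N k) (node T N (k + 1)), ∀ x : E 3,
    HasDerivWithinAt (fun s => w k s x)
      (-((σ ^ 2 / 2) • Laplacian.laplacian (w k t) x)
        + advect (biotSavart3 L (w k (node T N (k + 1)))) (w k t) x
        - advect (w k t) (biotSavart3 L (w k (node T N (k + 1)))) x
        - curl3 (f t) x) (Icc (node T N k) (node T N (k + 1))) t
  terminal : w (N - 1) (node T N N) = curl3 φ
  matching : ∀ k, k + 1 < N → w k (node T N (k + 1)) = w (k + 1) (node T N (k + 1))

end PeriodicNSE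

end

/-!
On the interval `[t_k, t_{k+1}]` the flow `u` is compared with the flow `v` restarted from the
approximate velocity at time `t_{k+1}`. The difference `η` of the vorticities of `v` and of the
approximation vanishes at `t_{k+1}` and solves an advection-diffusion equation whose source is
linear in `η` up to a term of size `O(h)`, since `v` differs by `O(h)` from its frozen value; the
energy estimate, in which diffusion and solenoidal advection have a sign, gives `‖η‖ = O(h²)` in
`L²`. By Parseval's identity a velocity is controlled by its vorticity through the Biot–Savart
law, so that the velocity error made on one interval is `O(h²)` as well. Stability of the
Navier–Stokes flow makes the error at `t_{k+1}` grow by at most the factor `exp (M h)`, and the `N`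
local errors add up to `O(h)`.

For this the velocity restarted at `t_{k+1}` must have the approximate vorticity as its curl, that
is, the latter must be closed and of mean zero. Both properties are propagated from the terminal
time by the equation for the frozen vorticity.

Vorticities are treated as two-forms, i.e. antisymmetric matrices: the equation then has the same
form in every dimension, and the dimension is only restricted by the absolute convergence of the
Biot–Savart series.
-/

open scoped RealInnerProductSpace

noncomputable section

namespace PeriodicNSE

/-! ### The cell of periods -/

section Cell

variable {n : ℕ} {L : ℝ} {F : Type*} [NormedAddCommGroup F]

/-- The `i`-th vector of the standard basis. -/
abbrev basisVec {n : ℕ} (i : Fin n) : E n := EuclideanSpace.single i 1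

lemma sum_smul_basisVec (a : E n) : ∑ i, a i • basisVec i = a := by
  ext j
  simp [Pi.single_apply]

lemma cell_eq_preimage_ofLp :
    cell n L = (WithLp.ofLp : E n → (Fin n → ℝ)) ⁻¹' (univ.pi fun _ => Ioc 0 L) := by
  ext x
  simp [cell]

lemma measurableSet_cell : MeasurableSet (cell n L) := by
  rw [cell_eq_preimage_ofLp]
  exact (PiLp.volume_preserving_ofLp (Fin n)).measurable
    (MeasurableSet.univ_pi fun _ => measurableSet_Ioc)

lemma isBounded_cell : Bornology.IsBounded (cell n L) := by
  rw [cell_eq_preimage_ofLp]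
  exact (PiLp.antilipschitzWith_ofLp 2 _).isBounded_preimage
    (Bornology.IsBounded.pi fun _ => Metric.isBounded_Ioc 0 L)

lemma isCompact_closure_cell : IsCompact (closure (cell n L)) :=
  isBounded_cell.isCompact_closure

instance : IsFiniteMeasure (volume.restrict (cell n L) : Measure (E n)) :=
  ⟨by simpa using isBounded_cell.measure_lt_top⟩

lemma integrableOn_cell {g : E n → F} (hg : Continuous g) : IntegrableOn g (cell n L) :=
  (hg.continuousOn.integrableOn_compact isCompact_closure_cell).mono_set subset_closure

variable [NormedSpace ℝ F]

lemma integral_cell_eq (g : E n → F) :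
    ∫ x in cell n L, g x = ∫ y in Icc (0 : Fin n → ℝ) (fun _ => L), g (WithLp.toLp 2 y) := by
  have h_ae : cell n L =ᵐ[volume]
      (WithLp.ofLp : E n → (Fin n → ℝ)) ⁻¹' (Icc 0 (fun _ => L)) := by
    rw [cell_eq_preimage_ofLp]
    exact (PiLp.volume_preserving_ofLp (Fin n)).quasiMeasurePreserving.preimage_ae_eq
      (Measure.univ_pi_Ioc_ae_eq_Icc (f := (0 : Fin n → ℝ)) (g := fun _ => L))
  rw [setIntegral_congr_set h_ae]
  exact (PiLp.volume_preserving_ofLp (Fin n)).setIntegral_preimage_emb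
    (MeasurableEquiv.toLp 2 (Fin n → ℝ)).symm.measurableEmbedding (fun y => g (WithLp.toLp 2 y)) _

lemma volume_real_cell (hL : 0 ≤ L) : volume.real (cell n L) = L ^ n := by
  have h := integral_cell_eq (n := n) (L := L) (fun _ => (1 : ℝ))
  simp only [integral_const, smul_eq_mul, mul_one, measureReal_restrict_apply_univ] at h
  rw [h, measureReal_def,
    Real.volume_Icc_pi_toReal (a := (0 : Fin n → ℝ)) (b := fun _ => L) (fun _ => hL)]
  simp

end Cell

/-! ### Periodic fields -/

namespace SpacePeriodic

variable {n : ℕ} {L : ℝ} {G : Type*} {v : E n → G}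

lemma comp (hv : SpacePeriodic L v) {H : Type*} (f : G → H) :
    SpacePeriodic L (fun x => f (v x)) := fun x i => by simp only [hv x i]

lemma comp₂ {G' : Type*} {w : E n → G'} (hv : SpacePeriodic L v) (hw : SpacePeriodic L w)
    {H : Type*} (f : G → G' → H) : SpacePeriodic L (fun x => f (v x) (w x)) :=
  fun x i => by simp only [hv x i, hw x i]

lemma fderiv {F : Type*} [NormedAddCommGroup F] [NormedSpace ℝ F] {v : E n → F}
    (hv : SpacePeriodic L v) : SpacePeriodic L (fderiv ℝ v) := by
  intro x i
  rw [← fderiv_comp_add_right]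
  congr 1
  ext y
  exact hv y i

lemma eq_of_sub_int_mul (hv : SpacePeriodic L v) {x y : E n}
    (h : ∀ i, ∃ k : ℤ, y i = x i + k * L) : v y = v x := by
  choose k hk using h
  have h_lattice : ∀ s : Finset (Fin n),
      Function.Periodic v (∑ i ∈ s, k i • L • basisVec i) := by
    intro s
    induction s using Finset.induction_on with
    | empty => simp [Function.Periodic]
    | insert i s hi ih =>
      rw [Finset.sum_insert hi]
      exact (Function.Periodic.zsmul (fun x => hv x i) (k i)).add_period ih
  rw [← h_lattice Finset.univ x]
  congr 1
  ext i
  simp [hk, Finset.sum_apply, Pi.single_apply, mul_comm]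

end SpacePeriodic

lemma exists_mem_cell {n : ℕ} {L : ℝ} (hL : 0 < L) (x : E n) :
    ∃ y ∈ cell n L, ∀ i, ∃ k : ℤ, x i = y i + k * L :=
  ⟨WithLp.toLp 2 fun i => toIocMod hL 0 (x i),
    fun i => by simpa using toIocMod_mem_Ioc hL 0 (x i),
    fun i => ⟨toIocDiv hL 0 (x i), by simp⟩⟩

lemma SpacePeriodic.exists_norm_le {n : ℕ} {L : ℝ} {F : Type*} [NormedAddCommGroup F]
    {g : E n → F} (hp : SpacePeriodic L g) (hL : 0 < L) (hg : Continuous g) :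
    ∃ M, ∀ x, ‖g x‖ ≤ M := by
  obtain ⟨M, hM⟩ := isCompact_closure_cell.exists_bound_of_continuousOn hg.continuousOn
  refine ⟨M, fun x => ?_⟩
  obtain ⟨y, hy, hxy⟩ := exists_mem_cell hL x
  rw [hp.eq_of_sub_int_mul hxy]
  exact hM y (subset_closure hy)

/-! ### First-order operators with constant coefficients -/

section DiffOp

variable {n : ℕ} {L : ℝ} {G F : Type*} [NormedAddCommGroup G] [NormedSpace ℝ G]
  [NormedAddCommGroup F] [NormedSpace ℝ F]

/-- The first-order differential operator with constant coefficients whose symbol `C` is applied to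
the full derivative; partial derivatives, the exterior derivative and the curl are of this form. -/
def diffOp (C : (E n →L[ℝ] G) →L[ℝ] F) (v : E n → G) (x : E n) : F := C (fderiv ℝ v x)

/-- The partial derivative in the `i`-th direction. -/
abbrev pderiv (i : Fin n) (v : E n → G) : E n → G :=
  diffOp (ContinuousLinearMap.apply ℝ G (basisVec i)) v

lemma pderiv_eq (i : Fin n) (v : E n → G) (x : E n) :
    pderiv i v x = fderiv ℝ v x (basisVec i) := rfl

lemma fderiv_apply_eq_sum (v : E n → G) (x a : E n) :
    fderiv ℝ v x a = ∑ i, a i • pderiv i v x := by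
  conv_lhs => rw [← sum_smul_basisVec a]
  simp [pderiv_eq]

lemma partialD_eq {v : E n → E n} (hv : ContDiff ℝ 1 v) (i j : Fin n) (x : E n) :
    partialD i j v x = fderiv ℝ v x (basisVec i) j :=
  congrArg (fun A : E n →L[ℝ] ℝ => A (basisVec i))
    ((EuclideanSpace.proj j : E n →L[ℝ] ℝ).hasFDerivAt.comp x
      (hv.differentiable one_ne_zero x).hasFDerivAt).fderiv

lemma SpacePeriodic.diffOp {v : E n → G} (hv : SpacePeriodic L v)
    (C : (E n →L[ℝ] G) →L[ℝ] F) : SpacePeriodic L (diffOp C v) :=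
  hv.fderiv.comp C

lemma SpacePeriodic.laplacian {v : E n → G} (hv : SpacePeriodic L v) :
    SpacePeriodic L (Laplacian.laplacian v) := by
  intro x i
  have h_shift : (fun y => v (y + L • basisVec i)) = v := funext fun y => hv y i
  simp only [InnerProductSpace.laplacian_eq_iteratedFDeriv_orthonormalBasis v
    (EuclideanSpace.basisFun (Fin n) ℝ), ← iteratedFDeriv_comp_add_right, h_shift]

lemma contDiff_diffOp {k m : WithTop ℕ∞} {v : E n → G} (hv : ContDiff ℝ m v) (hkm : k + 1 ≤ m)
    (C : (E n →L[ℝ] G) →L[ℝ] F) : ContDiff ℝ k (diffOp C v) :=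
  C.contDiff.comp (hv.fderiv_right hkm)

lemma continuous_diffOp {v : E n → G} (hv : ContDiff ℝ 1 v) (C : (E n →L[ℝ] G) →L[ℝ] F) :
    Continuous (diffOp C v) :=
  C.continuous.comp (hv.continuous_fderiv one_ne_zero)

lemma pderiv_smul {a : E n → ℝ} {g : E n → G} (ha : ContDiff ℝ 1 a) (hg : ContDiff ℝ 1 g)
    (i : Fin n) (x : E n) :
    pderiv i (fun x => a x • g x) x = a x • pderiv i g x + pderiv i a x • g x := by
  rw [pderiv_eq, fderiv_fun_smul (ha.differentiable one_ne_zero x)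
    (hg.differentiable one_ne_zero x)]
  simp [pderiv_eq]

lemma fderiv_fderiv_symm {v : E n → G} (hv : ContDiff ℝ 2 v) (x a b : E n) :
    fderiv ℝ (fderiv ℝ v) x a b = fderiv ℝ (fderiv ℝ v) x b a :=
  (hv.contDiffAt.isSymmSndFDerivAt (by simp)).eq a b

lemma fderiv_diffOp {v : E n → G} (hv : ContDiff ℝ 2 v) (C : (E n →L[ℝ] G) →L[ℝ] F) (x : E n) :
    fderiv ℝ (diffOp C v) x = C ∘L fderiv ℝ (fderiv ℝ v) x :=
  (C.hasFDerivAt.comp x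
    ((hv.fderiv_right (m := 1) le_rfl).differentiable one_ne_zero x).hasFDerivAt).fderiv

lemma pderiv_diffOp {v : E n → G} (hv : ContDiff ℝ 2 v) (C : (E n →L[ℝ] G) →L[ℝ] F) (i : Fin n) :
    pderiv i (diffOp C v) = diffOp C (pderiv i v) := by
  ext x
  rw [pderiv_eq, fderiv_diffOp hv, diffOp, pderiv, fderiv_diffOp hv]
  refine congrArg C (ContinuousLinearMap.ext fun h => ?_)
  exact fderiv_fderiv_symm hv x _ h

lemma laplacian_eq_sum {v : E n → G} (hv : ContDiff ℝ 2 v) :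
    Laplacian.laplacian v = fun x => ∑ i, pderiv i (pderiv i v) x := by
  ext x
  rw [InnerProductSpace.laplacian_eq_iteratedFDeriv_orthonormalBasis v
    (EuclideanSpace.basisFun (Fin n) ℝ)]
  refine Finset.sum_congr rfl fun i _ => ?_
  rw [iteratedFDeriv_two_apply, pderiv_eq, fderiv_diffOp hv]
  simp

lemma continuous_laplacian {v : E n → G} (hv : ContDiff ℝ 2 v) :
    Continuous (Laplacian.laplacian v) := by
  rw [laplacian_eq_sum hv]
  exact continuous_finsetSum _ fun i _ =>
    continuous_diffOp (contDiff_diffOp (k := 1) hv le_rfl _) _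

lemma laplacian_diffOp {v : E n → G} (hv : ContDiff ℝ 3 v) (C : (E n →L[ℝ] G) →L[ℝ] F) :
    Laplacian.laplacian (diffOp C v) = diffOp C (Laplacian.laplacian v) := by
  have hv2 : ContDiff ℝ 2 v := hv.of_le (by norm_num)
  have h_pderiv : ∀ i, ContDiff ℝ 2 (pderiv i v) := fun i => contDiff_diffOp hv le_rfl _
  have h_pderiv₂ : ∀ i, ContDiff ℝ 1 (pderiv i (pderiv i v)) :=
    fun i => contDiff_diffOp (h_pderiv i) le_rfl _
  rw [laplacian_eq_sum (contDiff_diffOp hv le_rfl C), laplacian_eq_sum hv2]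
  ext x
  rw [diffOp, fderiv_fun_sum fun i _ => (h_pderiv₂ i).differentiable one_ne_zero x, map_sum]
  simp only [pderiv_diffOp hv2, pderiv_diffOp (h_pderiv _), diffOp]

end DiffOp

/-! ### Integration by parts over the cell -/

section IntegrationByParts

variable {n : ℕ} {L : ℝ} {F : Type*} [NormedAddCommGroup F] [NormedSpace ℝ F]

lemma integral_pderiv_eq_zero (hL : 0 ≤ L) {g : E n → F} (hg : ContDiff ℝ 1 g)
    (hp : SpacePeriodic L g) (i : Fin n) : ∫ x in cell n L, pderiv i g x = 0 := by
  obtain _ | n := n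
  · exact i.elim0
  let e : (Fin (n + 1) → ℝ) →L[ℝ] E (n + 1) :=
    (EuclideanSpace.equiv (Fin (n + 1)) ℝ).symm.toContinuousLinearMap
  let single : F →L[ℝ] (Fin (n + 1) → F) := ContinuousLinearMap.single ℝ (fun _ => F) i
  have h_trace : ∀ y, ∑ j, (single ∘L fderiv ℝ g (e y) ∘L e) (Pi.single j (1 : ℝ)) j =
      pderiv i g (e y) := by
    intro y
    rw [Finset.sum_eq_single i (fun j _ hj => by simp [single, hj]) (by simp)]
    simp only [ContinuousLinearMap.comp_apply, single, ContinuousLinearMap.single_apply,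
      Pi.single_eq_same]
    rfl
  have h_cont : Continuous fun y => pderiv i g (e y) :=
    (continuous_diffOp hg _).comp e.continuous
  have h_div := integral_divergence_of_hasFDerivAt_off_countable (E := F)
    (0 : Fin (n + 1) → ℝ) (fun _ => L) (fun _ => hL) (fun y => single (g (e y)))
    (fun y => single ∘L fderiv ℝ g (e y) ∘L e) ∅ countable_empty
    (single.continuous.comp (hg.continuous.comp e.continuous)).continuousOn
    (fun y _ => single.hasFDerivAt.comp y
      ((hg.differentiable one_ne_zero (e y)).hasFDerivAt.comp y e.hasFDerivAt))
    (by simpa only [h_trace] using h_cont.integrableOn_Icc)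
  have h_faces : ∀ y, g (e (i.insertNth L y)) = g (e (i.insertNth 0 y)) := by
    intro y
    rw [← hp (e (i.insertNth 0 y)) i]
    congr 1
    ext k
    refine i.succAboveCases ?_ (fun k => ?_) k <;> simp [e]
  simp only [h_trace] at h_div
  rw [integral_cell_eq]
  refine h_div.trans (Finset.sum_eq_zero fun j _ => ?_)
  obtain rfl | hj := eq_or_ne j i
  · simp [single, h_faces]
  · simp [single, hj]

lemma integral_diffOp_eq_zero {G : Type*} [NormedAddCommGroup G] [NormedSpace ℝ G]
    [CompleteSpace G] [CompleteSpace F] (hL : 0 ≤ L) {g : E n → G} (hg : ContDiff ℝ 1 g)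
    (hp : SpacePeriodic L g) (C : (E n →L[ℝ] G) →L[ℝ] F) :
    ∫ x in cell n L, diffOp C g x = 0 := by
  have h_int : IntegrableOn (fderiv ℝ g) (cell n L) :=
    integrableOn_cell (hg.continuous_fderiv one_ne_zero)
  have h_zero : ∫ x in cell n L, fderiv ℝ g x = 0 := by
    refine ContinuousLinearMap.ext fun a => ?_
    rw [ContinuousLinearMap.integral_apply h_int]
    simp only [fderiv_apply_eq_sum]
    rw [integral_finsetSum _ fun i _ =>
      (integrableOn_cell (continuous_diffOp hg _)).fun_smul (a i)]
    refine Finset.sum_eq_zero fun i _ => ?_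
    rw [integral_smul, integral_pderiv_eq_zero hL hg hp i, smul_zero]
  exact (C.integral_comp_comm h_int).trans (by rw [h_zero, map_zero])

lemma integral_laplacian_eq_zero (hL : 0 ≤ L) {g : E n → F} (hg : ContDiff ℝ 2 g)
    (hp : SpacePeriodic L g) : ∫ x in cell n L, Laplacian.laplacian g x = 0 := by
  have h_pderiv : ∀ i, ContDiff ℝ 1 (pderiv i g) := fun i => contDiff_diffOp hg le_rfl _
  rw [laplacian_eq_sum hg,
    integral_finsetSum _ fun i _ => integrableOn_cell (continuous_diffOp (h_pderiv i) _)]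
  exact Finset.sum_eq_zero fun i _ => integral_pderiv_eq_zero hL (h_pderiv i) (hp.diffOp _) i

lemma integral_advect_eq_zero (hL : 0 ≤ L) {a : E n → E n} {g : E n → F} (ha : ContDiff ℝ 1 a)
    (hg : ContDiff ℝ 1 g) (hap : SpacePeriodic L a) (hgp : SpacePeriodic L g)
    (hdiv : ∀ x, divergence a x = 0) : ∫ x in cell n L, advect a g x = 0 := by
  have ha_coord : ∀ i, ContDiff ℝ 1 (fun x => a x i) := fun i => by fun_prop
  have h_smul : ∀ i, ContDiff ℝ 1 (fun x => a x i • g x) := fun i => (ha_coord i).smul hg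
  have h_flux : ∀ x, advect a g x = ∑ i, pderiv i (fun x => a x i • g x) x := by
    intro x
    have h_div : ∑ i, pderiv i (fun y => a y i) x = 0 := hdiv x
    simp only [pderiv_smul (ha_coord _) hg, Finset.sum_add_distrib, ← Finset.sum_smul, h_div,
      zero_smul, add_zero]
    exact fderiv_apply_eq_sum g x (a x)
  simp only [h_flux]
  rw [integral_finsetSum _ fun i _ => integrableOn_cell (continuous_diffOp (h_smul i) _)]
  exact Finset.sum_eq_zero fun i _ =>
    integral_pderiv_eq_zero hL (h_smul i) (hap.comp₂ hgp fun a g => a i • g) i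

end IntegrationByParts

section EnergyIdentities

variable {n : ℕ} {L : ℝ} {F : Type*} [NormedAddCommGroup F] [InnerProductSpace ℝ F]

lemma pderiv_inner {g h : E n → F} (hg : ContDiff ℝ 1 g) (hh : ContDiff ℝ 1 h) (i : Fin n)
    (x : E n) : pderiv i (fun x => ⟪g x, h x⟫) x = ⟪g x, pderiv i h x⟫ + ⟪pderiv i g x, h x⟫ :=
  fderiv_inner_apply ℝ (hg.differentiable one_ne_zero x) (hh.differentiable one_ne_zero x) _

lemma integral_inner_advect_eq_zero (hL : 0 ≤ L) {a : E n → E n} {g : E n → F}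
    (ha : ContDiff ℝ 1 a) (hg : ContDiff ℝ 1 g) (hap : SpacePeriodic L a)
    (hgp : SpacePeriodic L g) (hdiv : ∀ x, divergence a x = 0) :
    ∫ x in cell n L, ⟪g x, advect a g x⟫ = 0 := by
  have h_normSq : ∀ x, advect a (fun y => ‖g y‖ ^ 2) x = 2 * ⟪g x, advect a g x⟫ := by
    intro x
    rw [advect, (hg.differentiable one_ne_zero x).hasFDerivAt.norm_sq.fderiv]
    simp [advect]
  have h := integral_advect_eq_zero hL ha (hg.norm_sq ℝ) hap (hgp.comp fun y => ‖y‖ ^ 2) hdiv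
  simp only [h_normSq, integral_const_mul] at h
  linarith

lemma integral_inner_laplacian_nonpos (hL : 0 ≤ L) {g : E n → F} (hg : ContDiff ℝ 2 g)
    (hp : SpacePeriodic L g) : ∫ x in cell n L, ⟪g x, Laplacian.laplacian g x⟫ ≤ 0 := by
  have hg1 : ContDiff ℝ 1 g := hg.of_le (by norm_num)
  have h_pderiv : ∀ i, ContDiff ℝ 1 (pderiv i g) := fun i => contDiff_diffOp hg le_rfl _
  have h_inner : ∀ i, ContDiff ℝ 1 (fun x => ⟪g x, pderiv i g x⟫) :=
    fun i => hg1.inner ℝ (h_pderiv i)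
  have h_parts : ∀ i x, ⟪g x, pderiv i (pderiv i g) x⟫ =
      pderiv i (fun x => ⟪g x, pderiv i g x⟫) x - ‖pderiv i g x‖ ^ 2 := by
    intro i x
    rw [pderiv_inner hg1 (h_pderiv i), real_inner_self_eq_norm_sq]
    ring
  have h_int : ∀ i, IntegrableOn (fun x => pderiv i (fun x => ⟪g x, pderiv i g x⟫) x) (cell n L) :=
    fun i => integrableOn_cell (continuous_diffOp (h_inner i) _)
  have h_int_sq : ∀ i, IntegrableOn (fun x => ‖pderiv i g x‖ ^ 2) (cell n L) :=
    fun i => integrableOn_cell ((h_pderiv i).continuous.norm.pow 2)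
  simp only [laplacian_eq_sum hg, inner_sum, h_parts]
  rw [integral_finsetSum _ fun i _ => (h_int i).fun_sub (h_int_sq i)]
  refine Finset.sum_nonpos fun i _ => ?_
  rw [integral_sub (h_int i) (h_int_sq i),
    integral_pderiv_eq_zero hL (h_inner i) (hp.comp₂ (hp.diffOp _) fun a b => ⟪a, b⟫) i, zero_sub]
  exact neg_nonpos.2 (integral_nonneg fun x => by positivity)

lemma integral_inner_gradient_eq_zero (hL : 0 ≤ L) {a : E n → E n} {q : E n → ℝ}
    (ha : ContDiff ℝ 1 a) (hq : ContDiff ℝ 1 q) (hap : SpacePeriodic L a)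
    (hqp : SpacePeriodic L q) (hdiv : ∀ x, divergence a x = 0) :
    ∫ x in cell n L, ⟪a x, gradient q x⟫ = 0 := by
  rw [← integral_advect_eq_zero hL ha hq hap hqp hdiv]
  congr 1
  ext x
  rw [real_inner_comm, gradient, InnerProductSpace.toDual_symm_apply]
  rfl

end EnergyIdentities

/-! ### Fourier series of periodic functions -/

section Modes

variable {n : ℕ} {L : ℝ}

lemma mode_neg (m : Fin n → ℤ) (x : E n) : mode L (-m) x = (starRingEnd ℂ) (mode L m x) := by
  simp only [mode, ← Complex.exp_conj, map_mul, Complex.conj_I, Complex.conj_ofReal]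
  congr 1
  simp [Finset.sum_neg_distrib]

lemma mode_mul (m k : Fin n → ℤ) (x : E n) : mode L m x * mode L k x = mode L (m + k) x := by
  simp only [mode, ← Complex.exp_add, Pi.add_apply]
  congr 1
  push_cast
  simp only [add_mul, Finset.sum_add_distrib]
  ring

lemma mode_zero (x : E n) : mode L 0 x = 1 := by simp [mode]

lemma norm_mode (m : Fin n → ℤ) (x : E n) : ‖mode L m x‖ = 1 := by
  rw [mode, mul_comm]
  exact Complex.norm_exp_ofReal_mul_I _

lemma contDiff_mode (m : Fin n → ℤ) {k : WithTop ℕ∞} : ContDiff ℝ k (mode L m : E n → ℂ) := by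
  unfold mode
  refine (contDiff_const.mul (Complex.ofRealCLM.contDiff.comp ?_)).cexp
  exact contDiff_const.mul (ContDiff.sum fun i _ => contDiff_const.mul (by fun_prop))

lemma continuous_mode (m : Fin n → ℤ) : Continuous (mode L m : E n → ℂ) :=
  (contDiff_mode (k := 0) m).continuous

lemma spacePeriodic_mode (hL : L ≠ 0) (m : Fin n → ℤ) :
    SpacePeriodic L (mode L m : E n → ℂ) := by
  intro x i
  have hL' : (L : ℂ) ≠ 0 := by exact_mod_cast hL
  have h_phase : ∑ j, (m j : ℝ) * (x + L • basisVec i) j = ∑ j, (m j : ℝ) * x j + m i * L := by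
    simp [mul_add, Finset.sum_add_distrib]
  simp only [mode]
  rw [Complex.exp_eq_exp_iff_exists_int, h_phase]
  refine ⟨m i, ?_⟩
  push_cast
  field_simp

lemma pderiv_mode (m : Fin n → ℤ) (x : E n) (i : Fin n) :
    pderiv i (mode L m) x = Complex.I * ((2 * Real.pi / L * m i : ℝ) : ℂ) * mode L m x := by
  let phase : E n →L[ℝ] ℝ :=
    (2 * Real.pi / L) • ∑ j, (m j : ℝ) • (EuclideanSpace.proj j : E n →L[ℝ] ℝ)
  have h_phase : ∀ y, phase y = 2 * Real.pi / L * ∑ j, (m j : ℝ) * y j := fun y => by simp [phase]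
  have h_basis : phase (basisVec i) = 2 * Real.pi / L * m i := by rw [h_phase]; simp
  have h_mode : (mode L m : E n → ℂ) = fun y => Complex.exp (Complex.I * (phase y : ℂ)) := by
    ext y
    simp only [mode, h_phase]
  have h_deriv : HasFDerivAt (fun y => Complex.exp (Complex.I * (phase y : ℂ))) _ x :=
    (((Complex.ofRealCLM.comp phase).hasFDerivAt (x := x)).const_mul Complex.I).cexp
  rw [pderiv_eq, h_mode, h_deriv.fderiv]
  simp only [smul_apply, ContinuousLinearMap.comp_apply, Complex.ofRealCLM_apply, smul_eq_mul,
    h_basis]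
  ring

lemma integral_mode (hL : 0 < L) {m : Fin n → ℤ} (hm : m ≠ 0) :
    ∫ x in cell n L, mode L m x = 0 := by
  obtain ⟨i, hi⟩ := Function.ne_iff.mp hm
  have h_parts :=
    integral_pderiv_eq_zero hL.le (contDiff_mode (L := L) m) (spacePeriodic_mode hL.ne' m) i
  have h_freq : Complex.I * ((2 * Real.pi / L * m i : ℝ) : ℂ) ≠ 0 :=
    mul_ne_zero Complex.I_ne_zero (Complex.ofReal_ne_zero.2
      (mul_ne_zero (div_ne_zero Real.two_pi_pos.ne' hL.ne') (Int.cast_ne_zero.2 hi)))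
  simp only [pderiv_mode, integral_const_mul] at h_parts
  exact (mul_eq_zero.1 h_parts).resolve_left h_freq

end Modes

section Parseval

variable {n : ℕ} {L : ℝ}

/-- The Fourier coefficients of a complex valued function, as opposed to `coeff`, which takes real
valued ones. -/
def complexCoeff (L : ℝ) (g : E n → ℂ) (m : Fin n → ℤ) : ℂ :=
  ((1 / L ^ n : ℝ) : ℂ) * ∫ x in cell n L, g x * mode L (-m) x

lemma coeff_eq_complexCoeff (g : E n → ℝ) (m : Fin n → ℤ) :
    coeff L g m = complexCoeff L (fun x => (g x : ℂ)) m := rfl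

lemma mode_smul_eq_mFourier (hL : L ≠ 0) (m : Fin n → ℤ) (y : Fin n → ℝ) :
    mode L m (WithLp.toLp 2 (L • y)) =
      UnitAddTorus.mFourier m (fun i => (y i : UnitAddCircle)) := by
  have hL' : (L : ℂ) ≠ 0 := by exact_mod_cast hL
  simp only [UnitAddTorus.mFourier, ContinuousMap.coe_mk, fourier_coe_apply, ← Complex.exp_sum,
    mode]
  congr 1
  push_cast
  simp only [Finset.mul_sum]
  refine Finset.sum_congr rfl fun i _ => ?_
  simp only [Pi.smul_apply, smul_eq_mul]
  push_cast
  field_simp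

lemma integral_cell_eq_unit (hL : 0 < L) {F : Type*} [NormedAddCommGroup F] [NormedSpace ℝ F]
    (g : E n → F) : ∫ x in cell n L, g x =
      L ^ n • ∫ y in {y : Fin n → ℝ | ∀ i, y i ∈ Ioc ((0 : Fin n → ℝ) i) ((0 : Fin n → ℝ) i + 1)},
        g (WithLp.toLp 2 (L • y)) := by
  have h_ofLp : ∫ x in cell n L, g x =
      ∫ y in {y : Fin n → ℝ | ∀ i, y i ∈ Ioc 0 L}, g (WithLp.toLp 2 y) :=
    (PiLp.volume_preserving_ofLp (Fin n)).setIntegral_preimage_emb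
      (MeasurableEquiv.toLp 2 (Fin n → ℝ)).symm.measurableEmbedding
      (fun y => g (WithLp.toLp 2 y)) {y : Fin n → ℝ | ∀ i, y i ∈ Ioc 0 L}
  rw [h_ofLp, Measure.setIntegral_comp_smul_of_pos volume (fun y => g (WithLp.toLp 2 y)) _ hL,
    Module.finrank_fin_fun, smul_smul, mul_inv_cancel₀ (by positivity), one_smul]
  congr 2
  ext y
  rw [Set.mem_smul_set_iff_inv_smul_mem₀ hL.ne']
  simp only [mem_ofPred_eq, Pi.smul_apply, smul_eq_mul, Pi.zero_apply, zero_add, mem_Ioc,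
    inv_mul_eq_div, div_le_one hL, div_pos_iff_of_pos_right hL]

lemma exists_torus_lift {g : E n → ℂ} (hg : Continuous g) (hp : SpacePeriodic L g) :
    ∃ G : C(UnitAddTorus (Fin n), ℂ), ∀ y : Fin n → ℝ,
      G (fun i => (y i : UnitAddCircle)) = g (WithLp.toLp 2 (L • y)) := by
  have hq : IsOpenQuotientMap (Pi.map fun (_ : Fin n) (t : ℝ) => (t : UnitAddCircle)) :=
    IsOpenQuotientMap.piMap fun _ => QuotientAddGroup.isOpenQuotientMap_mk
  let q : C(Fin n → ℝ, UnitAddTorus (Fin n)) := ⟨_, hq.continuous⟩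
  let f : C(Fin n → ℝ, ℂ) := ⟨fun y => g (WithLp.toLp 2 (L • y)),
    hg.comp ((PiLp.continuous_toLp 2 _).comp (continuous_const_smul L))⟩
  have h_factors : Function.FactorsThrough f q := by
    intro y z hyz
    refine hp.eq_of_sub_int_mul fun i => ?_
    have hi : ((y i : ℝ) : UnitAddCircle) = (z i : UnitAddCircle) := congrFun hyz i
    rw [← sub_eq_zero, ← AddCircle.coe_sub, AddCircle.coe_eq_zero_iff] at hi
    obtain ⟨k, hk⟩ := hi
    refine ⟨k, ?_⟩
    simp only [zsmul_eq_mul, mul_one] at hk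
    simp only [Pi.smul_apply, smul_eq_mul, hk]
    ring
  exact ⟨hq.isQuotientMap.lift f h_factors,
    fun y => DFunLike.congr_fun (hq.isQuotientMap.lift_comp f h_factors) y⟩

theorem hasSum_sq_norm_complexCoeff (hL : 0 < L) {g : E n → ℂ} (hg : Continuous g)
    (hp : SpacePeriodic L g) :
    HasSum (fun m => ‖complexCoeff L g m‖ ^ 2) (1 / L ^ n * ∫ x in cell n L, ‖g x‖ ^ 2) := by
  obtain ⟨G, hG⟩ := exists_torus_lift hg hp
  have hLn : L ^ n ≠ 0 := by positivity
  let _ : MeasureSpace UnitAddCircle := ⟨AddCircle.haarAddCircle⟩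
  have _ : IsProbabilityMeasure (volume : Measure UnitAddCircle) :=
    inferInstanceAs (IsProbabilityMeasure AddCircle.haarAddCircle)
  let G₂ := ContinuousMap.toLp (E := ℂ) 2 (volume : Measure (UnitAddTorus (Fin n))) ℂ G
  have h_coeff : ∀ m, UnitAddTorus.mFourierCoeff G₂ m = complexCoeff L g m := by
    intro m
    rw [UnitAddTorus.mFourierCoeff_toLp, UnitAddTorus.mFourierCoeff_eq_integral _ _ 0,
      complexCoeff, integral_cell_eq_unit hL, Complex.real_smul, ← mul_assoc,
      ← Complex.ofReal_mul, one_div, inv_mul_cancel₀ hLn, Complex.ofReal_one, one_mul]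
    congr 1
    ext y
    rw [hG, mode_smul_eq_mFourier hL.ne', smul_eq_mul, mul_comm]
  have h_normSq : ∫ t, ‖G₂ t‖ ^ 2 = 1 / L ^ n * ∫ x in cell n L, ‖g x‖ ^ 2 := by
    have h_ae : ∫ t, ‖G₂ t‖ ^ 2 = ∫ t, ‖G t‖ ^ 2 := by
      refine integral_congr_ae ?_
      filter_upwards [ContinuousMap.coeFn_toLp (p := 2) (𝕜 := ℂ) volume G] with t ht
      rw [ht]
    rw [h_ae, UnitAddTorus.integral_preimage (fun t => ‖G t‖ ^ 2) 0, integral_cell_eq_unit hL,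
      smul_eq_mul, ← mul_assoc, one_div, inv_mul_cancel₀ hLn, one_mul]
    simp only [hG]
  simpa only [h_coeff, h_normSq] using UnitAddTorus.hasSum_sq_mFourierCoeff G₂

theorem hasSum_sq_norm_coeff (hL : 0 < L) {g : E n → ℝ} (hg : Continuous g)
    (hp : SpacePeriodic L g) :
    HasSum (fun m => ‖coeff L g m‖ ^ 2) (1 / L ^ n * ∫ x in cell n L, g x ^ 2) := by
  have h := hasSum_sq_norm_complexCoeff hL (Complex.continuous_ofReal.comp hg)
    (hp.comp fun r => (r : ℂ))
  simpa [coeff_eq_complexCoeff, Function.comp_def] using h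

end Parseval

section Coefficients

variable {n : ℕ} {L : ℝ}

lemma conj_coeff_neg (g : E n → ℝ) (m : Fin n → ℤ) :
    (starRingEnd ℂ) (coeff L g (-m)) = coeff L g m := by
  simp only [coeff, map_mul, Complex.conj_ofReal, ← integral_conj, mode_neg, neg_neg]

lemma coeff_zero {g : E n → ℝ} (hg : ∫ x in cell n L, g x = 0) : coeff L g 0 = 0 := by
  simp [coeff, mode_zero, integral_complex_ofReal, hg]

lemma integrableOn_mul_mode {g : E n → ℝ} (hg : Continuous g) (m : Fin n → ℤ) :
    IntegrableOn (fun x => (g x : ℂ) * mode L m x) (cell n L) :=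
  integrableOn_cell ((Complex.continuous_ofReal.comp hg).mul (continuous_mode m))

lemma coeff_sub {g h : E n → ℝ} (hg : Continuous g) (hh : Continuous h) (m : Fin n → ℤ) :
    coeff L (fun x => g x - h x) m = coeff L g m - coeff L h m := by
  simp only [coeff, Complex.ofReal_sub, sub_mul]
  rw [integral_sub (integrableOn_mul_mode hg _) (integrableOn_mul_mode hh _), mul_sub]

lemma coeff_add {g h : E n → ℝ} (hg : Continuous g) (hh : Continuous h) (m : Fin n → ℤ) :
    coeff L (fun x => g x + h x) m = coeff L g m + coeff L h m := by
  simp only [coeff, Complex.ofReal_add, add_mul]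
  rw [integral_add (integrableOn_mul_mode hg _) (integrableOn_mul_mode hh _), mul_add]

lemma coeff_sum {ι : Type*} {s : Finset ι} {g : ι → E n → ℝ} (hg : ∀ i ∈ s, Continuous (g i))
    (m : Fin n → ℤ) : coeff L (fun x => ∑ i ∈ s, g i x) m = ∑ i ∈ s, coeff L (g i) m := by
  simp only [coeff, Complex.ofReal_sum, Finset.sum_mul]
  rw [integral_finsetSum _ fun i hi => integrableOn_mul_mode (hg i hi) _, Finset.mul_sum]

theorem coeff_pderiv (hL : 0 < L) {g : E n → ℝ} (hg : ContDiff ℝ 1 g) (hp : SpacePeriodic L g)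
    (i : Fin n) (m : Fin n → ℤ) :
    coeff L (pderiv i g) m = Complex.I * ((2 * Real.pi / L * m i : ℝ) : ℂ) * coeff L g m := by
  have h_mode := contDiff_mode (L := L) (-m) (k := 1)
  have h_parts : ∫ x in cell n L, pderiv i (fun x => g x • mode L (-m) x) x = 0 :=
    integral_pderiv_eq_zero hL.le (hg.smul h_mode)
      (hp.comp₂ (spacePeriodic_mode hL.ne' (-m)) fun a b => a • b) i
  have h_leibniz : ∀ x, pderiv i (fun x => g x • mode L (-m) x) x =
      ((pderiv i g x : ℝ) : ℂ) * mode L (-m) x -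
        Complex.I * ((2 * Real.pi / L * m i : ℝ) : ℂ) * ((g x : ℂ) * mode L (-m) x) := by
    intro x
    rw [pderiv_smul hg h_mode, pderiv_mode]
    simp only [Complex.real_smul, Pi.neg_apply]
    push_cast
    ring
  rw [integral_congr_ae (.of_forall h_leibniz),
    integral_sub (integrableOn_mul_mode (continuous_diffOp hg _) _)
    ((integrableOn_mul_mode hg.continuous _).const_mul _), integral_const_mul] at h_parts
  simp only [coeff]
  linear_combination ((1 / L ^ n : ℝ) : ℂ) * h_parts

lemma coeff_laplacian (hL : 0 < L) {g : E n → ℝ} (hg : ContDiff ℝ 2 g) (hp : SpacePeriodic L g)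
    (m : Fin n → ℤ) : coeff L (Laplacian.laplacian g) m =
      ((-(2 * Real.pi / L) ^ 2 * normSqZ m : ℝ) : ℂ) * coeff L g m := by
  have h_pderiv : ∀ i, ContDiff ℝ 1 (pderiv i g) := fun i => contDiff_diffOp hg le_rfl _
  rw [laplacian_eq_sum hg, coeff_sum fun i _ => continuous_diffOp (h_pderiv i) _]
  simp only [coeff_pderiv hL (h_pderiv _) (hp.diffOp _),
    coeff_pderiv hL (hg.of_le one_le_two) hp, normSqZ]
  push_cast
  rw [Finset.mul_sum, Finset.sum_mul]
  refine Finset.sum_congr rfl fun i _ => ?_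
  linear_combination
    (2 * Real.pi / L * m i : ℂ) ^ 2 * coeff L g m * Complex.I_sq

end Coefficients

section ModeSeries

variable {n : ℕ} {L : ℝ} {a : (Fin n → ℤ) → ℂ}

lemma continuous_modeSeries (ha : Summable fun m => ‖a m‖) :
    Continuous fun x : E n => ∑' m, a m * mode L m x :=
  continuous_tsum (fun m => continuous_const.mul (continuous_mode m)) ha fun m x => by
    rw [norm_mul, norm_mode, mul_one]

lemma complexCoeff_modeSeries (ha : Summable fun m => ‖a m‖) (hL : 0 < L) (k : Fin n → ℤ) :
    complexCoeff L (fun x => ∑' m, a m * mode L m x) k = a k := by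
  have hLn : ((L ^ n : ℝ) : ℂ) ≠ 0 := by exact_mod_cast (by positivity : L ^ n ≠ 0)
  have h_shift : ∀ x : E n, (∑' m, a m * mode L m x) * mode L (-k) x =
      ∑' m, a m * mode L (m - k) x := by
    intro x
    rw [← tsum_mul_right]
    simp only [mul_assoc, mode_mul, sub_eq_add_neg]
  have h_orthogonal : ∀ m, m ≠ k → ∫ x in cell n L, a m * mode L (m - k) x = 0 := by
    intro m hm
    rw [integral_const_mul, integral_mode hL (sub_ne_zero.mpr hm), mul_zero]
  have h_diagonal : ∫ x in cell n L, a k * mode L (k - k) x = (L ^ n : ℝ) * a k := by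
    simp only [sub_self, mode_zero, mul_one, integral_const, measureReal_restrict_apply_univ,
      volume_real_cell hL.le, Complex.real_smul]
  simp only [complexCoeff, h_shift]
  rw [← integral_tsum_of_summable_integral_norm, tsum_eq_single k h_orthogonal, h_diagonal,
    ← mul_assoc, Complex.ofReal_div, Complex.ofReal_one, one_div_mul_cancel hLn, one_mul]
  · exact fun m => integrableOn_cell (continuous_const.mul (continuous_mode _))
  · simp only [norm_mul, norm_mode, mul_one, integral_const, measureReal_restrict_apply_univ,
      smul_eq_mul]
    exact ha.mul_left _

end ModeSeries

/-! ### The potential series -/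

section Potential

variable {n : ℕ} {L : ℝ} {c : (Fin n → ℤ) → ℂ}

lemma spacePeriodic_potentialSeries (hL : L ≠ 0) (c : (Fin n → ℤ) → ℂ) :
    SpacePeriodic L (potentialSeries L c) := by
  intro x i
  simp only [potentialSeries, spacePeriodic_mode hL _ x i]

lemma normSqZ_neg (m : Fin n → ℤ) : normSqZ (-m) = normSqZ m := by simp [normSqZ]

lemma ofReal_potentialSeries (hconj : ∀ m, (starRingEnd ℂ) (c (-m)) = -c m) (x : E n) :
    (potentialSeries L c x : ℂ) = ∑' m : Fin n → ℤ,
      Complex.I * ((L / (2 * Real.pi) : ℝ) : ℂ) * (((1 / normSqZ m : ℝ) : ℂ) * c m) *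
        mode L m x := by
  have h_series : (potentialSeries L c x : ℂ) = Complex.I * ((L / (2 * Real.pi) : ℝ) : ℂ) *
      ∑' m : Fin n → ℤ, ((1 / normSqZ m : ℝ) : ℂ) * mode L m x * c m := by
    unfold potentialSeries
    rw [← Complex.conj_eq_iff_re]
    simp only [map_mul, Complex.conj_I, Complex.conj_ofReal, Complex.conj_tsum]
    rw [← (Equiv.neg (Fin n → ℤ)).tsum_eq]
    simp only [Equiv.neg_apply, hconj, normSqZ_neg, mode_neg, Complex.conj_conj, mul_neg,
      tsum_neg]
    ring
  rw [h_series, ← tsum_mul_left]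
  exact tsum_congr fun m => by ring

lemma summable_norm_potentialSeries_coeff
    (hc : Summable fun m => ‖((1 / normSqZ m : ℝ) : ℂ) * c m‖) : Summable fun m =>
      ‖Complex.I * ((L / (2 * Real.pi) : ℝ) : ℂ) * (((1 / normSqZ m : ℝ) : ℂ) * c m)‖ := by
  simp only [norm_mul _ (_ * c _)]
  exact hc.mul_left _

lemma continuous_potentialSeries (hc : Summable fun m => ‖((1 / normSqZ m : ℝ) : ℂ) * c m‖)
    (hconj : ∀ m, (starRingEnd ℂ) (c (-m)) = -c m) : Continuous (potentialSeries L c) := by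
  have h := continuous_modeSeries (L := L) (summable_norm_potentialSeries_coeff (L := L) hc)
  refine (Complex.continuous_re.comp h).congr fun x => ?_
  simp only [Function.comp_apply, ← ofReal_potentialSeries hconj, Complex.ofReal_re]

lemma coeff_potentialSeries (hc : Summable fun m => ‖((1 / normSqZ m : ℝ) : ℂ) * c m‖)
    (hconj : ∀ m, (starRingEnd ℂ) (c (-m)) = -c m) (hL : 0 < L) (m : Fin n → ℤ) :
    coeff L (potentialSeries L c) m =
      Complex.I * ((L / (2 * Real.pi) : ℝ) : ℂ) * (((1 / normSqZ m : ℝ) : ℂ) * c m) := by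
  rw [coeff_eq_complexCoeff]
  simp only [ofReal_potentialSeries hconj]
  exact complexCoeff_modeSeries (summable_norm_potentialSeries_coeff hc) hL m

end Potential

section Decay

variable {n : ℕ} {L : ℝ}

lemma sq_le_normSqZ (m : Fin n → ℤ) (i : Fin n) : (m i : ℝ) ^ 2 ≤ normSqZ m :=
  Finset.single_le_sum (f := fun i => (m i : ℝ) ^ 2) (fun _ _ => sq_nonneg _) (Finset.mem_univ i)

lemma normSqZ_nonneg (m : Fin n → ℤ) : 0 ≤ normSqZ m := Finset.sum_nonneg fun _ _ => sq_nonneg _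

lemma one_le_normSqZ {m : Fin n → ℤ} (hm : m ≠ 0) : 1 ≤ normSqZ m := by
  obtain ⟨i, hi⟩ := Function.ne_iff.mp hm
  have h_sq : 1 ≤ m i ^ 2 := Order.one_le_iff_pos.2 (sq_pos_of_ne_zero hi)
  exact le_trans (by exact_mod_cast h_sq) (sq_le_normSqZ m i)

lemma normSqZ_pos {m : Fin n → ℤ} (hm : m ≠ 0) : 0 < normSqZ m :=
  zero_lt_one.trans_le (one_le_normSqZ hm)

lemma norm_intCast_sq_le_normSqZ (m : Fin n → ℤ) : ‖fun i => (m i : ℝ)‖ ^ 2 ≤ normSqZ m := by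
  refine (Real.le_sqrt (norm_nonneg _) (normSqZ_nonneg m)).1 ?_
  rw [pi_norm_le_iff_of_nonneg (Real.sqrt_nonneg _)]
  exact fun i => Real.abs_le_sqrt (sq_le_normSqZ m i)

lemma summable_norm_intCast_inv_pow {r : ℕ} (hr : n < r) :
    Summable fun m : Fin n → ℤ => ‖fun i => (m i : ℝ)‖⁻¹ ^ r := by
  let Λ : Submodule ℤ (Fin n → ℝ) := Submodule.span ℤ (Set.range (Pi.basisFun ℝ (Fin n)))
  have h_rank : Module.finrank ℤ Λ < r := by
    rwa [ZLattice.rank ℝ Λ, Module.finrank_fin_fun]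
  have h_mem : ∀ m : Fin n → ℤ, (fun i => (m i : ℝ)) ∈ Λ := by
    intro m
    rw [show (fun i => (m i : ℝ)) = ∑ i, m i • Pi.basisFun ℝ (Fin n) i by
      ext j; simp [Finset.sum_apply, Pi.single_apply]]
    exact Submodule.sum_mem _ fun i _ => Submodule.smul_mem _ _ (Submodule.subset_span ⟨i, rfl⟩)
  have h_inj : Function.Injective (fun m : Fin n → ℤ => (⟨_, h_mem m⟩ : Λ)) := by
    intro m k h
    ext i
    have hi : (m i : ℝ) = k i := congrFun (Subtype.ext_iff.mp h) i
    exact_mod_cast hi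
  have h_comp := (ZLattice.summable_norm_pow_inv Λ r h_rank).comp_injective h_inj
  exact h_comp

lemma summable_inv_normSqZ_pow {r : ℕ} (hr : n < 2 * r) :
    Summable fun m : Fin n → ℤ => (1 / normSqZ m) ^ r := by
  refine Summable.of_nonneg_of_le (fun m => pow_nonneg (one_div_nonneg.2 (normSqZ_nonneg m)) r)
    (fun m => ?_) (summable_norm_intCast_inv_pow hr)
  obtain rfl | hm := eq_or_ne m 0
  · have hr0 : r ≠ 0 := by omega
    simp [normSqZ, hr0]
  have h_pos : 0 < ‖fun i => (m i : ℝ)‖ := by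
    refine norm_pos_iff.2 fun h => hm (funext fun i => ?_)
    have hi : (m i : ℝ) = 0 := congrFun h i
    exact_mod_cast hi
  rw [pow_mul, inv_pow, ← one_div]
  exact pow_le_pow_left₀ (one_div_nonneg.2 (normSqZ_nonneg m))
    (one_div_le_one_div_of_le (by positivity) (norm_intCast_sq_le_normSqZ m)) r

lemma norm_coeff_eq (hL : 0 < L) {g : E n → ℝ} (hg : ContDiff ℝ 2 g) (hp : SpacePeriodic L g)
    {m : Fin n → ℤ} (hm : m ≠ 0) :
    ‖coeff L g m‖ =
      (L / (2 * Real.pi)) ^ 2 / normSqZ m * ‖coeff L (Laplacian.laplacian g) m‖ := by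
  have h_pos := normSqZ_pos hm
  rw [coeff_laplacian hL hg hp, norm_mul, Complex.norm_real, neg_mul, norm_neg,
    Real.norm_of_nonneg (by positivity)]
  field_simp

-- By Parseval `∑ |m|⁴ |g_m|²` is finite, and `|m|⁻¹ |g_m| ≤ |m|⁻⁶ + |m|⁴ |g_m|²`, up to constants.
theorem summable_norm_coeff_mul_div_normSqZ (hn : n < 6) (hL : 0 < L) {g : E n → ℝ}
    (hg : ContDiff ℝ 2 g) (hp : SpacePeriodic L g) (j : Fin n) :
    Summable fun m : Fin n → ℤ => ‖((1 / normSqZ m : ℝ) : ℂ) * (coeff L g m * m j)‖ := by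
  have h_lap := (hasSum_sq_norm_coeff hL (continuous_laplacian hg) hp.laplacian).summable
  refine Summable.of_nonneg_of_le (fun m => norm_nonneg _) (fun m => ?_)
    (((summable_inv_normSqZ_pow (n := n) (r := 3) hn).add h_lap).mul_left
      ((L / (2 * Real.pi)) ^ 2))
  obtain rfl | hm := eq_or_ne m 0
  · simp only [normSqZ, Pi.zero_apply, Int.cast_zero, mul_zero, norm_zero]
    positivity
  have h_pos := normSqZ_pos hm
  rw [norm_mul, norm_mul, norm_coeff_eq hL hg hp hm, Complex.norm_intCast, Complex.norm_real,
    Real.norm_of_nonneg (one_div_nonneg.2 h_pos.le)]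
  set A := ‖coeff L (Laplacian.laplacian g) m‖
  set s := √(normSqZ m)
  have hs : normSqZ m = s ^ 2 := (Real.sq_sqrt h_pos.le).symm
  have hs0 : 0 < s := Real.sqrt_pos.2 h_pos
  rw [hs]
  calc 1 / s ^ 2 * ((L / (2 * Real.pi)) ^ 2 / s ^ 2 * A * |(m j : ℝ)|)
      ≤ 1 / s ^ 2 * ((L / (2 * Real.pi)) ^ 2 / s ^ 2 * A * s) := by
        gcongr
        exact Real.abs_le_sqrt (sq_le_normSqZ m j)
    _ = (L / (2 * Real.pi)) ^ 2 * (1 / s ^ 3 * A) := by field_simp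
    _ ≤ (L / (2 * Real.pi)) ^ 2 * ((1 / s ^ 2) ^ 3 + A ^ 2) := by
        gcongr
        have h_six : (1 / s ^ 2) ^ 3 = (1 / s ^ 3) ^ 2 := by ring
        nlinarith [sq_nonneg (1 / s ^ 3 - A), sq_nonneg (1 / s ^ 3), sq_nonneg A]

end Decay

/-! ### Vorticity as a two-form -/

section Forms

variable {n : ℕ} {L : ℝ}

/-- Tensors of rank two. A vorticity in dimension `n` is an antisymmetric one: this covers the
scalar vorticity for `n = 2` and the vector vorticity for `n = 3`. -/
abbrev Tensor2 (n : ℕ) : Type := EuclideanSpace ℝ (Fin n × Fin n)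

/-- Tensors of rank three, the values of the exterior derivative of a vorticity. -/
abbrev Tensor3 (n : ℕ) : Type := EuclideanSpace ℝ (Fin n × Fin n × Fin n)

/-- Antisymmetry of a tensor of rank two. -/
def IsAntisymm (W : Tensor2 n) : Prop := ∀ i j, W (j, i) = -W (i, j)

/-- The symbol of `rot`. -/
def rotSymbol : (E n →L[ℝ] E n) →L[ℝ] Tensor2 n :=
  LinearMap.toContinuousLinearMap
    { toFun := fun A => WithLp.toLp 2 fun q => A (basisVec q.1) q.2 - A (basisVec q.2) q.1
      map_add' := fun A B => by ext q; simp; ring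
      map_smul' := fun c A => by ext q; simp; ring }

/-- The vorticity `(rot v)ᵢⱼ = ∂ᵢ vⱼ - ∂ⱼ vᵢ` of a vector field, in any dimension. -/
def rot (v : E n → E n) : E n → Tensor2 n := diffOp rotSymbol v

/-- The symbol of `extD`. -/
def extDSymbol : (E n →L[ℝ] Tensor2 n) →L[ℝ] Tensor3 n :=
  LinearMap.toContinuousLinearMap
    { toFun := fun B => WithLp.toLp 2 fun q => B (basisVec q.1) (q.2.1, q.2.2) +
        B (basisVec q.2.1) (q.2.2, q.1) + B (basisVec q.2.2) (q.1, q.2.1)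
      map_add' := fun A B => by ext q; simp; ring
      map_smul' := fun c A => by ext q; simp; ring }

/-- The exterior derivative `∂ᵢ Wⱼₖ + ∂ⱼ Wₖᵢ + ∂ₖ Wᵢⱼ` of a two-form. -/
def extD (W : E n → Tensor2 n) : E n → Tensor3 n := diffOp extDSymbol W

lemma rotSymbol_apply (A : E n →L[ℝ] E n) (i j : Fin n) :
    rotSymbol A (i, j) = A (basisVec i) j - A (basisVec j) i := rfl

lemma extDSymbol_apply (B : E n →L[ℝ] Tensor2 n) (i j k : Fin n) :
    extDSymbol B (i, j, k) =
      B (basisVec i) (j, k) + B (basisVec j) (k, i) + B (basisVec k) (i, j) := rfl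

lemma pderiv_coord {ι : Type*} [Fintype ι] {v : E n → EuclideanSpace ℝ ι} (hv : ContDiff ℝ 1 v)
    (i : Fin n) (q : ι) : pderiv i (fun x => v x q) = fun x => pderiv i v x q := by
  ext x
  exact congrArg (fun A : E n →L[ℝ] ℝ => A (basisVec i))
    ((EuclideanSpace.proj q : EuclideanSpace ℝ ι →L[ℝ] ℝ).hasFDerivAt.comp x
      (hv.differentiable one_ne_zero x).hasFDerivAt).fderiv

lemma coeff_pderiv_coord (hL : 0 < L) {ι : Type*} [Fintype ι] {v : E n → EuclideanSpace ℝ ι}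
    (hv : ContDiff ℝ 1 v) (hp : SpacePeriodic L v) (i : Fin n) (q : ι) (m : Fin n → ℤ) :
    coeff L (fun x => pderiv i v x q) m =
      Complex.I * ((2 * Real.pi / L * m i : ℝ) : ℂ) * coeff L (fun x => v x q) m := by
  rw [← pderiv_coord hv, coeff_pderiv hL (by fun_prop) (hp.comp fun y => y q)]

lemma continuous_pderiv_coord {ι : Type*} [Fintype ι] {v : E n → EuclideanSpace ℝ ι}
    (hv : ContDiff ℝ 1 v) (i : Fin n) (q : ι) : Continuous fun x => pderiv i v x q :=
  (EuclideanSpace.proj q : EuclideanSpace ℝ ι →L[ℝ] ℝ).continuous.comp (continuous_diffOp hv _)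

lemma coeff_rot (hL : 0 < L) {v : E n → E n} (hv : ContDiff ℝ 1 v) (hp : SpacePeriodic L v)
    (i j : Fin n) (m : Fin n → ℤ) : coeff L (fun x => rot v x (i, j)) m =
      Complex.I * ((2 * Real.pi / L : ℝ) : ℂ) *
        (m i * coeff L (fun x => v x j) m - m j * coeff L (fun x => v x i) m) := by
  have h_rot : ∀ x, rot v x (i, j) = pderiv i v x j - pderiv j v x i := fun _ => rfl
  simp only [h_rot]
  rw [coeff_sub (continuous_pderiv_coord hv i j) (continuous_pderiv_coord hv j i),
    coeff_pderiv_coord hL hv hp, coeff_pderiv_coord hL hv hp]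
  push_cast
  ring

lemma sum_mul_coeff_eq_zero_of_divergence_eq_zero (hL : 0 < L) {v : E n → E n}
    (hv : ContDiff ℝ 1 v) (hp : SpacePeriodic L v) (hdiv : ∀ x, divergence v x = 0)
    (m : Fin n → ℤ) : ∑ i, (m i : ℂ) * coeff L (fun x => v x i) m = 0 := by
  have h_div : ∀ x, ∑ i, pderiv i v x i = 0 := by
    intro x
    rw [← hdiv x]
    exact Finset.sum_congr rfl fun i _ => (partialD_eq hv i i x).symm
  have h := coeff_sum (L := L) (s := Finset.univ)
    (fun i _ => continuous_pderiv_coord hv i i) m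
  have h_pi : Complex.I * ((2 * Real.pi / L : ℝ) : ℂ) ≠ 0 :=
    mul_ne_zero Complex.I_ne_zero (Complex.ofReal_ne_zero.2 (by positivity))
  simp only [h_div, coeff_pderiv_coord hL hv hp] at h
  refine (mul_eq_zero.1 ?_).resolve_left h_pi
  rw [Finset.mul_sum]
  refine Eq.trans (Finset.sum_congr rfl fun i _ => ?_) (h.symm.trans (by simp [coeff]))
  push_cast
  ring

lemma sum_mul_coeff_of_extD_eq_zero (hL : 0 < L) {W : E n → Tensor2 n} (hW : ContDiff ℝ 1 W)
    (hp : SpacePeriodic L W) (hclosed : extD W = 0) (i j k : Fin n) (m : Fin n → ℤ) :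
    m i * coeff L (fun x => W x (j, k)) m + m j * coeff L (fun x => W x (k, i)) m +
      m k * coeff L (fun x => W x (i, j)) m = 0 := by
  have h_sum : ∀ x, pderiv i W x (j, k) + pderiv j W x (k, i) + pderiv k W x (i, j) = 0 :=
    fun x => congrArg (fun Z : Tensor3 n => Z (i, j, k)) (congrFun hclosed x)
  have h_cont := fun l q => continuous_pderiv_coord hW l q
  have h := coeff_add (L := L) ((h_cont i (j, k)).fun_add (h_cont j (k, i))) (h_cont k (i, j)) m
  rw [coeff_add (h_cont i _) (h_cont j _)] at h
  simp only [h_sum, coeff_pderiv_coord hL hW hp] at h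
  have h_pi : Complex.I * ((2 * Real.pi / L : ℝ) : ℂ) ≠ 0 :=
    mul_ne_zero Complex.I_ne_zero (Complex.ofReal_ne_zero.2 (by positivity))
  refine (mul_eq_zero.1 (Eq.trans ?_ (h.symm.trans (by simp [coeff])))).resolve_left h_pi
  push_cast
  ring

end Forms

/-! ### Uniqueness of Fourier series -/

section Uniqueness

variable {n : ℕ} {L : ℝ}

lemma cell_subset_closure_interior (hL : 0 < L) : cell n L ⊆ closure (interior (cell n L)) := by
  have h_homeo : cell n L = (EuclideanSpace.equiv (Fin n) ℝ).toHomeomorph ⁻¹'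
      (univ.pi fun _ => Ioc 0 L) := cell_eq_preimage_ofLp
  rw [h_homeo, ← Homeomorph.preimage_interior, ← Homeomorph.preimage_closure,
    interior_pi_set finite_univ, closure_pi_set]
  refine preimage_mono (pi_mono fun _ _ => ?_)
  rw [interior_Ioc, closure_Ioo hL.ne]
  exact Ioc_subset_Icc_self

lemma eq_zero_of_integral_norm_sq_eq_zero {F : Type*} [NormedAddCommGroup F] (hL : 0 < L)
    {g : E n → F} (hg : Continuous g) (hp : SpacePeriodic L g)
    (h : ∫ x in cell n L, ‖g x‖ ^ 2 = 0) : g = 0 := by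
  have h_ae : (fun x => ‖g x‖ ^ 2) =ᵐ[volume.restrict (cell n L)] 0 :=
    (integral_eq_zero_iff_of_nonneg (fun x => sq_nonneg _)
      (integrableOn_cell (hg.norm.pow 2))).1 h
  have h_cell : EqOn (fun x => ‖g x‖ ^ 2) 0 (cell n L) :=
    Measure.eqOn_of_ae_eq h_ae (hg.norm.pow 2).continuousOn continuousOn_const
      (cell_subset_closure_interior hL)
  ext x
  obtain ⟨y, hy, hxy⟩ := exists_mem_cell hL x
  rw [hp.eq_of_sub_int_mul hxy]
  simpa using h_cell hy

variable {ι : Type*} {v : E n → EuclideanSpace ℝ ι}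

lemma hasSum_sum_sq_norm_coeff [Fintype ι] (hL : 0 < L) (hv : Continuous v)
    (hp : SpacePeriodic L v) :
    HasSum (fun m => ∑ q, ‖coeff L (fun x => v x q) m‖ ^ 2)
      (1 / L ^ n * ∫ x in cell n L, ‖v x‖ ^ 2) := by
  have h_coord : ∀ q, Continuous fun x => v x q := fun q => by fun_prop
  simp only [EuclideanSpace.real_norm_sq_eq]
  rw [integral_finsetSum _ fun q _ => integrableOn_cell ((h_coord q).fun_pow 2), Finset.mul_sum]
  exact hasSum_sum fun q _ => hasSum_sq_norm_coeff hL (h_coord q) (hp.comp fun y => y q)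

lemma eq_zero_of_coeff_eq_zero [Finite ι] (hL : 0 < L) (hv : Continuous v)
    (hp : SpacePeriodic L v) (h : ∀ q m, coeff L (fun x => v x q) m = 0) : v = 0 := by
  have := Fintype.ofFinite ι
  refine eq_zero_of_integral_norm_sq_eq_zero hL hv hp ?_
  have h_sum := hasSum_sum_sq_norm_coeff hL hv hp
  simp only [h, norm_zero, ne_eq, OfNat.ofNat_ne_zero, not_false_eq_true, zero_pow,
    Finset.sum_const_zero] at h_sum
  exact (mul_eq_zero.1 (h_sum.unique hasSum_zero)).resolve_left (by positivity)

end Uniqueness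

/-! ### The Biot-Savart law for two-forms -/

section BiotSavart

variable {n : ℕ} {L : ℝ}

/-- The Fourier coefficients `∑ᵢ mᵢ (Wⱼᵢ)_m` of the `j`-th component of the divergence of `W`, up to
a constant factor. -/
def divCoeff (L : ℝ) (W : E n → Tensor2 n) (j : Fin n) (m : Fin n → ℤ) : ℂ :=
  ∑ i, coeff L (fun y => W y (j, i)) m * m i

/-- The Biot-Savart velocity of a two-form in any dimension. -/
def biotSavart (L : ℝ) (W : E n → Tensor2 n) (x : E n) : E n :=
  WithLp.toLp 2 fun j => potentialSeries L (divCoeff L W j) x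

lemma conj_divCoeff_neg (W : E n → Tensor2 n) (j : Fin n) (m : Fin n → ℤ) :
    (starRingEnd ℂ) (divCoeff L W j (-m)) = -divCoeff L W j m := by
  simp [divCoeff, map_sum, conj_coeff_neg]

lemma spacePeriodic_biotSavart (hL : L ≠ 0) (W : E n → Tensor2 n) :
    SpacePeriodic L (biotSavart L W) := fun x i => by
  ext j
  exact spacePeriodic_potentialSeries hL (divCoeff L W j) x i

section Regular

variable {W : E n → Tensor2 n} (hn : n < 6) (hL : 0 < L) (hW : ContDiff ℝ 2 W)
  (hp : SpacePeriodic L W)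
include hn hL hW hp

lemma summable_norm_divCoeff_div_normSqZ (j : Fin n) :
    Summable fun m => ‖((1 / normSqZ m : ℝ) : ℂ) * divCoeff L W j m‖ := by
  refine Summable.of_nonneg_of_le (fun m => norm_nonneg _) (fun m => ?_)
    (summable_sum (s := Finset.univ) fun i _ => summable_norm_coeff_mul_div_normSqZ hn hL
      (g := fun y => W y (j, i)) (by fun_prop) (hp.comp fun y => y (j, i)) i)
  rw [divCoeff, Finset.mul_sum]
  exact norm_sum_le _ _

lemma continuous_biotSavart : Continuous (biotSavart L W) :=
  (PiLp.continuous_toLp 2 _).comp (continuous_pi fun j =>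
    continuous_potentialSeries (summable_norm_divCoeff_div_normSqZ hn hL hW hp j)
      (conj_divCoeff_neg W j))

lemma coeff_biotSavart (j : Fin n) (m : Fin n → ℤ) :
    coeff L (fun x => biotSavart L W x j) m =
      Complex.I * ((L / (2 * Real.pi) : ℝ) : ℂ) *
        (((1 / normSqZ m : ℝ) : ℂ) * divCoeff L W j m) :=
  coeff_potentialSeries (summable_norm_divCoeff_div_normSqZ hn hL hW hp j)
    (conj_divCoeff_neg W j) hL m

end Regular

lemma coeff_coord_sub {ι : Type*} {v w : E n → EuclideanSpace ℝ ι}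
    (hv : Continuous v) (hw : Continuous w) (q : ι) (m : Fin n → ℤ) :
    coeff L (fun x => (v x - w x) q) m =
      coeff L (fun x => v x q) m - coeff L (fun x => w x q) m :=
  coeff_sub ((PiLp.continuous_apply 2 _ q).comp hv) ((PiLp.continuous_apply 2 _ q).comp hw) m

lemma divCoeff_sub {V W : E n → Tensor2 n} (hV : Continuous V) (hW : Continuous W) (j : Fin n)
    (m : Fin n → ℤ) :
    divCoeff L (fun x => V x - W x) j m = divCoeff L V j m - divCoeff L W j m := by
  simp only [divCoeff, ← Finset.sum_sub_distrib, ← sub_mul, coeff_coord_sub hV hW]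

lemma ofReal_normSqZ (m : Fin n → ℤ) : (normSqZ m : ℂ) = ∑ i, (m i : ℂ) ^ 2 := by
  simp [normSqZ]

lemma coeff_coord_zero {ι : Type*} [Fintype ι] {v : E n → EuclideanSpace ℝ ι} (hv : Continuous v)
    (h : ∫ x in cell n L, v x = 0) (q : ι) : coeff L (fun x => v x q) 0 = 0 := by
  have h_coord : ∫ x in cell n L, v x q = (∫ x in cell n L, v x) q :=
    (EuclideanSpace.proj q : EuclideanSpace ℝ ι →L[ℝ] ℝ).integral_comp_comm (integrableOn_cell hv)
  exact coeff_zero (by rw [h_coord, h, PiLp.zero_apply])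

lemma coeff_eq_divCoeff_rot (hL : 0 < L) {v : E n → E n} (hv : ContDiff ℝ 1 v)
    (hp : SpacePeriodic L v) (hdiv : ∀ x, divergence v x = 0) (hmean : ∫ x in cell n L, v x = 0)
    (j : Fin n) (m : Fin n → ℤ) : coeff L (fun x => v x j) m =
      Complex.I * ((L / (2 * Real.pi) : ℝ) : ℂ) *
        (((1 / normSqZ m : ℝ) : ℂ) * divCoeff L (rot v) j m) := by
  obtain rfl | hm := eq_or_ne m 0
  · rw [coeff_coord_zero hv.continuous hmean]
    simp [normSqZ]
  have h_norm : (normSqZ m : ℂ) ≠ 0 := Complex.ofReal_ne_zero.2 (normSqZ_pos hm).ne'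
  have h_pi : (Real.pi : ℂ) ≠ 0 := Complex.ofReal_ne_zero.2 Real.pi_ne_zero
  have hL' : (L : ℂ) ≠ 0 := Complex.ofReal_ne_zero.2 hL.ne'
  have h_divCoeff : divCoeff L (rot v) j m =
      -(Complex.I * ((2 * Real.pi / L : ℝ) : ℂ) * normSqZ m * coeff L (fun x => v x j) m) := by
    have h := sum_mul_coeff_eq_zero_of_divergence_eq_zero hL hv hp hdiv m
    calc divCoeff L (rot v) j m
        = Complex.I * ((2 * Real.pi / L : ℝ) : ℂ) *
            (m j * (∑ i, (m i : ℂ) * coeff L (fun x => v x i) m) -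
              (∑ i, (m i : ℂ) ^ 2) * coeff L (fun x => v x j) m) := by
          simp only [divCoeff, coeff_rot hL hv hp, Finset.mul_sum, Finset.sum_mul,
            ← Finset.sum_sub_distrib]
          exact Finset.sum_congr rfl fun i _ => by ring
      _ = _ := by rw [h, ofReal_normSqZ]; ring
  rw [h_divCoeff]
  push_cast
  field_simp
  linear_combination coeff L (fun x => v x j) m * Complex.I_sq

lemma norm_sq_divCoeff_div_normSqZ_le (W : E n → Tensor2 n) (j : Fin n) (m : Fin n → ℤ) :
    ‖Complex.I * ((L / (2 * Real.pi) : ℝ) : ℂ) * (((1 / normSqZ m : ℝ) : ℂ) * divCoeff L W j m)‖ ^ 2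
      ≤ (L / (2 * Real.pi)) ^ 2 * ∑ i, ‖coeff L (fun y => W y (j, i)) m‖ ^ 2 := by
  have h_sum_nonneg : 0 ≤ ∑ i, ‖coeff L (fun y => W y (j, i)) m‖ ^ 2 :=
    Finset.sum_nonneg fun i _ => by positivity
  obtain rfl | hm := eq_or_ne m 0
  · simpa [normSqZ] using mul_nonneg (sq_nonneg (L / (2 * Real.pi))) h_sum_nonneg
  have h_pos := normSqZ_pos hm
  have h_cauchySchwarz : ‖divCoeff L W j m‖ ^ 2 ≤
      (∑ i, ‖coeff L (fun y => W y (j, i)) m‖ ^ 2) * normSqZ m := by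
    calc ‖divCoeff L W j m‖ ^ 2
        ≤ (∑ i, ‖coeff L (fun y => W y (j, i)) m‖ * |(m i : ℝ)|) ^ 2 := by
          gcongr
          refine (norm_sum_le _ _).trans_eq (Finset.sum_congr rfl fun i _ => ?_)
          rw [norm_mul, Complex.norm_intCast]
      _ ≤ _ := by
          refine (Finset.sum_mul_sq_le_sq_mul_sq _ _ _).trans_eq ?_
          simp only [sq_abs, normSqZ]
  rw [norm_mul, norm_mul, norm_mul, Complex.norm_I, one_mul, Complex.norm_real, Complex.norm_real,
    mul_pow, mul_pow, Real.norm_eq_abs, Real.norm_eq_abs, sq_abs, sq_abs]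
  gcongr
  calc (1 / normSqZ m) ^ 2 * ‖divCoeff L W j m‖ ^ 2
      ≤ (1 / normSqZ m) ^ 2 * ((∑ i, ‖coeff L (fun y => W y (j, i)) m‖ ^ 2) * normSqZ m) := by
        gcongr
    _ = (∑ i, ‖coeff L (fun y => W y (j, i)) m‖ ^ 2) / normSqZ m := by field_simp
    _ ≤ _ := div_le_self h_sum_nonneg (one_le_normSqZ hm)

theorem integral_norm_sq_sub_biotSavart_le (hn : n < 6) (hL : 0 < L) {v : E n → E n}
    {W : E n → Tensor2 n} (hv : ContDiff ℝ 1 v) (hvp : SpacePeriodic L v)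
    (hdiv : ∀ x, divergence v x = 0) (hmean : ∫ x in cell n L, v x = 0) (hW : ContDiff ℝ 2 W)
    (hWp : SpacePeriodic L W) :
    ∫ x in cell n L, ‖v x - biotSavart L W x‖ ^ 2 ≤
      (L / (2 * Real.pi)) ^ 2 * ∫ x in cell n L, ‖rot v x - W x‖ ^ 2 := by
  have h_rot : Continuous (rot v) := continuous_diffOp hv _
  have h_bs := continuous_biotSavart hn hL hW hWp
  have h_coeff : ∀ j m, coeff L (fun x => (v x - biotSavart L W x) j) m =
      Complex.I * ((L / (2 * Real.pi) : ℝ) : ℂ) * (((1 / normSqZ m : ℝ) : ℂ) *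
        divCoeff L (fun x => rot v x - W x) j m) := by
    intro j m
    rw [coeff_coord_sub hv.continuous h_bs, coeff_biotSavart hn hL hW hWp,
      coeff_eq_divCoeff_rot hL hv hvp hdiv hmean, divCoeff_sub h_rot hW.continuous]
    ring
  have h_velocity := hasSum_sum_sq_norm_coeff hL (hv.continuous.sub h_bs)
    (hvp.comp₂ (spacePeriodic_biotSavart hL.ne' W) fun a b => a - b)
  have h_vorticity := (hasSum_sum_sq_norm_coeff hL (h_rot.sub hW.continuous)
    ((hvp.diffOp rotSymbol).comp₂ hWp fun a b => a - b)).mul_left ((L / (2 * Real.pi)) ^ 2)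
  have h_le := hasSum_le (fun m => ?_) h_velocity h_vorticity
  · rw [mul_left_comm] at h_le
    exact le_of_mul_le_mul_left h_le (by positivity)
  · simp only [Pi.sub_apply, h_coeff, Fintype.sum_prod_type]
    rw [Finset.mul_sum]
    exact Finset.sum_le_sum fun j _ => norm_sq_divCoeff_div_normSqZ_le _ j m

theorem rot_biotSavart (hn : n < 6) (hL : 0 < L) {W : E n → Tensor2 n} (hW : ContDiff ℝ 2 W)
    (hp : SpacePeriodic L W) (hanti : ∀ x, IsAntisymm (W x)) (hmean : ∫ x in cell n L, W x = 0)
    (hclosed : extD W = 0) (hU : ContDiff ℝ 1 (biotSavart L W)) : rot (biotSavart L W) = W := by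
  have hUp := spacePeriodic_biotSavart hL.ne' W
  have h_rot : Continuous (rot (biotSavart L W)) := continuous_diffOp hU _
  refine sub_eq_zero.1 (eq_zero_of_coeff_eq_zero hL (h_rot.sub hW.continuous)
    ((hUp.diffOp rotSymbol).comp₂ hp fun a b => a - b) fun ⟨i, j⟩ m => ?_)
  simp only [Pi.sub_apply]
  rw [coeff_coord_sub h_rot hW.continuous, coeff_rot hL hU hUp,
    coeff_biotSavart hn hL hW hp, coeff_biotSavart hn hL hW hp]
  obtain rfl | hm := eq_or_ne m 0
  · simp [coeff_coord_zero hW.continuous hmean]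
  have h_norm : (normSqZ m : ℂ) ≠ 0 := Complex.ofReal_ne_zero.2 (normSqZ_pos hm).ne'
  have h_pi : (Real.pi : ℂ) ≠ 0 := Complex.ofReal_ne_zero.2 Real.pi_ne_zero
  have hL' : (L : ℂ) ≠ 0 := Complex.ofReal_ne_zero.2 hL.ne'
  have h_anti : ∀ k, coeff L (fun x => W x (i, k)) m = -coeff L (fun x => W x (k, i)) m := by
    intro k
    simp only [hanti _ k i, coeff, Complex.ofReal_neg, neg_mul, integral_neg, mul_neg]
  have h_divCoeff : m i * divCoeff L W j m - m j * divCoeff L W i m =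
      -(normSqZ m * coeff L (fun x => W x (i, j)) m) := by
    rw [ofReal_normSqZ]
    simp only [divCoeff, h_anti, Finset.mul_sum, Finset.sum_mul, ← Finset.sum_sub_distrib,
      ← Finset.sum_neg_distrib]
    refine Finset.sum_congr rfl fun k _ => ?_
    have h_closed := sum_mul_coeff_of_extD_eq_zero hL (hW.of_le one_le_two) hp hclosed i j k m
    linear_combination (m k : ℂ) * h_closed - (m k : ℂ) ^ 2 * h_anti j
  push_cast
  field_simp
  rw [Complex.I_sq, h_divCoeff]
  ring

end BiotSavart

/-! ### Fields on a time slab -/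

/-- The time-space slab `[a, b] × ℝⁿ`. -/
def slab (n : ℕ) (a b : ℝ) : Set (ℝ × E n) := Icc a b ×ˢ univ

/-- The time derivative of a field on a slab; it is one-sided at the ends of the time interval. -/
def timeDeriv {n : ℕ} {F : Type*} [NormedAddCommGroup F] [NormedSpace ℝ F] (a b : ℝ)
    (V : ℝ → E n → F) (t : ℝ) (x : E n) : F :=
  fderivWithin ℝ (fun z : ℝ × E n => V z.1 z.2) (slab n a b) (t, x) (1, 0)

section Slab

variable {n : ℕ} {L a b t : ℝ} {F : Type*} [NormedAddCommGroup F]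

lemma slab_mem_nhds (ht : t ∈ Ioo a b) (x : E n) : slab n a b ∈ nhds (t, x) :=
  prod_mem_nhds (Icc_mem_nhds ht.1 ht.2) Filter.univ_mem

lemma slab_mono {a' b' : ℝ} (h : Icc a' b' ⊆ Icc a b) : slab n a' b' ⊆ slab n a b :=
  prod_mono h subset_rfl

lemma continuous_slice {V : ℝ → E n → F}
    (hV : ContinuousOn (fun z : ℝ × E n => V z.1 z.2) (slab n a b)) (ht : t ∈ Icc a b) :
    Continuous (V t) := by
  rw [← continuousOn_univ]
  exact hV.comp (f := fun x : E n => (t, x)) (by fun_prop) fun x _ => ⟨ht, mem_univ x⟩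

lemma exists_bound_on_cell {g : ℝ → E n → F}
    (hg : ContinuousOn (fun z : ℝ × E n => g z.1 z.2) (slab n a b)) :
    ∃ B, ∀ t ∈ Icc a b, ∀ x ∈ cell n L, ‖g t x‖ ≤ B := by
  obtain ⟨B, hB⟩ := (isCompact_Icc.prod isCompact_closure_cell).exists_bound_of_continuousOn
    (f := fun z : ℝ × E n => g z.1 z.2) (s := Icc a b ×ˢ closure (cell n L))
    (hg.mono (prod_mono subset_rfl (subset_univ _)))
  exact ⟨B, fun t ht x hx => hB (t, x) ⟨ht, subset_closure hx⟩⟩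

variable [NormedSpace ℝ F]

lemma uniqueDiffOn_slab (hab : a < b) : UniqueDiffOn ℝ (slab n a b) :=
  (uniqueDiffOn_Icc hab).prod uniqueDiffOn_univ

lemma continuousOn_integral_cell {g : ℝ → E n → F}
    (hg : ContinuousOn (fun z : ℝ × E n => g z.1 z.2) (slab n a b)) :
    ContinuousOn (fun t => ∫ x in cell n L, g t x) (Icc a b) := by
  obtain ⟨B, hB⟩ := exists_bound_on_cell (L := L) hg
  refine continuousOn_of_dominated (bound := fun _ => B) (fun t ht => ?_) (fun t ht => ?_)
    (integrable_const _) (.of_forall fun x => ?_)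
  · exact (continuous_slice hg ht).aestronglyMeasurable
  · filter_upwards [ae_restrict_mem measurableSet_cell] with x hx using hB t ht x hx
  · exact hg.comp (f := fun t : ℝ => (t, x)) (by fun_prop) fun t ht => ⟨ht, mem_univ x⟩

variable {V : ℝ → E n → F} {k m : WithTop ℕ∞}

lemma contDiff_slice (hV : ContDiffOn ℝ k (fun z : ℝ × E n => V z.1 z.2) (slab n a b))
    (ht : t ∈ Icc a b) : ContDiff ℝ k (V t) := by
  rw [← contDiffOn_univ]
  exact hV.comp (f := fun x : E n => (t, x)) (by fun_prop) fun x _ => ⟨ht, mem_univ x⟩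

lemma fderiv_slice (hV : ContDiffOn ℝ 1 (fun z : ℝ × E n => V z.1 z.2) (slab n a b))
    (ht : t ∈ Icc a b) (x : E n) : fderiv ℝ (V t) x =
      (fderivWithin ℝ (fun z : ℝ × E n => V z.1 z.2) (slab n a b) (t, x)).comp
        (ContinuousLinearMap.inr ℝ ℝ (E n)) := by
  have h_joint := (hV.differentiableOn one_ne_zero (t, x) ⟨ht, mem_univ x⟩).hasFDerivWithinAt
  have h_slice := h_joint.comp (s := univ) x
    (hasFDerivAt_prodMk_right t x).hasFDerivWithinAt (fun y _ => ⟨ht, mem_univ y⟩)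
  rw [hasFDerivWithinAt_univ] at h_slice
  exact h_slice.fderiv

lemma contDiffOn_fderiv_slice (hab : a < b) (hkm : k + 1 ≤ m)
    (hV : ContDiffOn ℝ m (fun z : ℝ × E n => V z.1 z.2) (slab n a b)) :
    ContDiffOn ℝ k (fun z : ℝ × E n => fderiv ℝ (V z.1) z.2) (slab n a b) :=
  ((hV.fderivWithin (uniqueDiffOn_slab hab) hkm).clm_comp
    (contDiffOn_const (c := ContinuousLinearMap.inr ℝ ℝ (E n)))).congr fun z hz =>
      fderiv_slice (hV.of_le (le_trans le_add_self hkm)) hz.1 z.2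

lemma hasDerivWithinAt_slice
    (hV : ContDiffOn ℝ 1 (fun z : ℝ × E n => V z.1 z.2) (slab n a b)) (ht : t ∈ Icc a b)
    (x : E n) : HasDerivWithinAt (fun s => V s x) (timeDeriv a b V t x) (Icc a b) t := by
  have h_joint := (hV.differentiableOn one_ne_zero (t, x) ⟨ht, mem_univ x⟩).hasFDerivWithinAt
  exact h_joint.comp_hasDerivWithinAt (f := fun s : ℝ => (s, x)) t
    ((hasDerivWithinAt_id t _).prodMk (hasDerivWithinAt_const t _ x))
    fun s hs => ⟨hs, mem_univ x⟩

lemma hasDerivAt_slice (hV : ContDiffOn ℝ 1 (fun z : ℝ × E n => V z.1 z.2) (slab n a b))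
    (ht : t ∈ Ioo a b) (x : E n) : HasDerivAt (fun s => V s x) (timeDeriv a b V t x) t :=
  (hasDerivWithinAt_slice hV (Ioo_subset_Icc_self ht) x).hasDerivAt (Icc_mem_nhds ht.1 ht.2)

lemma continuousOn_timeDeriv (hab : a < b)
    (hV : ContDiffOn ℝ 1 (fun z : ℝ × E n => V z.1 z.2) (slab n a b)) :
    ContinuousOn (fun z : ℝ × E n => timeDeriv a b V z.1 z.2) (slab n a b) :=
  (hV.continuousOn_fderivWithin (uniqueDiffOn_slab hab) le_rfl).clm_apply continuousOn_const

lemma hasDerivAt_fderiv_prodMk {G : Type*} [NormedAddCommGroup G] [NormedSpace ℝ G]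
    {W : ℝ × G → F} {x : G} (hW : ContDiffAt ℝ 2 W (t, x)) :
    HasDerivAt (fun s => fderiv ℝ W (s, x) ∘L ContinuousLinearMap.inr ℝ ℝ G)
      (fderiv ℝ (fun y => fderiv ℝ W (t, y) (1, 0)) x) t := by
  have h_second : HasFDerivAt (fderiv ℝ W) (fderiv ℝ (fderiv ℝ W) (t, x)) (t, x) :=
    ((hW.fderiv_right (m := 1) le_rfl).differentiableAt one_ne_zero).hasFDerivAt
  have h_time : HasDerivAt (fun s => fderiv ℝ W (s, x)) (fderiv ℝ (fderiv ℝ W) (t, x) (1, 0)) t :=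
    h_second.comp_hasDerivAt t ((hasDerivAt_id t).prodMk (hasDerivAt_const t x))
  have h_space : HasFDerivAt (fun y => fderiv ℝ W (t, y) (1, 0))
      ((fderiv ℝ (fderiv ℝ W) (t, x) ∘L ContinuousLinearMap.inr ℝ ℝ G).flip (1, 0)) x := by
    simpa using (h_second.comp x (hasFDerivAt_prodMk_right t x)).clm_apply
      (hasFDerivAt_const ((1 : ℝ), (0 : G)) x)
  rw [h_space.fderiv]
  refine (h_time.clm_comp (hasDerivAt_const t _)).congr_deriv ?_
  ext h
  simpa using (hW.isSymmSndFDerivAt (by simp)).eq (1, 0) (0, h)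

lemma hasDerivAt_fderiv_slice
    (hV : ContDiffOn ℝ 2 (fun z : ℝ × E n => V z.1 z.2) (slab n a b)) (ht : t ∈ Ioo a b)
    (x : E n) {V' : E n → F} (hV' : ∀ y, HasDerivAt (fun s => V s y) (V' y) t) :
    HasDerivAt (fun s => fderiv ℝ (V s) x) (fderiv ℝ V' x) t := by
  have hV1 : ContDiffOn ℝ 1 (fun z : ℝ × E n => V z.1 z.2) (slab n a b) := hV.of_le one_le_two
  have h_interior : ∀ s ∈ Ioo a b, ∀ y, fderivWithin ℝ (fun z : ℝ × E n => V z.1 z.2)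
      (slab n a b) (s, y) = fderiv ℝ (fun z : ℝ × E n => V z.1 z.2) (s, y) :=
    fun s hs y => fderivWithin_of_mem_nhds (slab_mem_nhds hs y)
  have hV'_eq : V' = fun y => fderiv ℝ (fun z : ℝ × E n => V z.1 z.2) (t, y) (1, 0) := by
    ext y
    rw [← h_interior t ht y]
    exact (hV' y).unique (hasDerivAt_slice hV1 ht y)
  rw [hV'_eq]
  refine (hasDerivAt_fderiv_prodMk
    (hV.contDiffAt (slab_mem_nhds ht x))).congr_of_eventuallyEq ?_
  filter_upwards [Ioo_mem_nhds ht.1 ht.2] with s hs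
  rw [fderiv_slice hV1 (Ioo_subset_Icc_self hs) x, h_interior s hs]

theorem hasDerivAt_integral_cell (hab : a < b)
    (hV : ContDiffOn ℝ 1 (fun z : ℝ × E n => V z.1 z.2) (slab n a b)) (ht : t ∈ Ioo a b) :
    HasDerivAt (fun s => ∫ x in cell n L, V s x) (∫ x in cell n L, timeDeriv a b V t x) t := by
  have h_timeDeriv := continuousOn_timeDeriv hab hV
  obtain ⟨B, hB⟩ := exists_bound_on_cell (L := L) h_timeDeriv
  refine (hasDerivAt_integral_of_dominated_loc_of_deriv_le (bound := fun _ => B)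
    (F' := timeDeriv a b V) (Ioo_mem_nhds ht.1 ht.2) ?_ ?_ ?_ ?_ (integrable_const _) ?_).2
  · filter_upwards [Ioo_mem_nhds ht.1 ht.2] with s hs
    exact (contDiff_slice hV (Ioo_subset_Icc_self hs)).continuous.aestronglyMeasurable
  · exact integrableOn_cell (contDiff_slice hV (Ioo_subset_Icc_self ht)).continuous
  · exact (continuous_slice h_timeDeriv (Ioo_subset_Icc_self ht)).aestronglyMeasurable
  · filter_upwards [ae_restrict_mem measurableSet_cell] with x hx s hs
    exact hB s (Ioo_subset_Icc_self hs) x hx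
  · exact .of_forall fun x s hs => hasDerivAt_slice hV hs x

end Slab

/-! ### The energy estimate -/

lemma backward_gronwall {a b κ β : ℝ} (hκ : 0 ≤ κ) (hβ : 0 ≤ β) {y y' : ℝ → ℝ}
    (hy : ContinuousOn y (Icc a b)) (hd : ∀ t ∈ Ioo a b, HasDerivAt y (y' t) t)
    (hle : ∀ t ∈ Ioo a b, -(κ * y t + β) ≤ y' t) {t : ℝ} (ht : t ∈ Icc a b) :
    y t ≤ Real.exp (κ * (b - t)) * (y b + β * (b - t)) := by
  set ψ : ℝ → ℝ := fun t => Real.exp (κ * t) * y t + β * Real.exp (κ * b) * t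
  have h_deriv : ∀ t ∈ Ioo a b, HasDerivAt ψ
      (Real.exp (κ * t) * (κ * y t + y' t) + β * Real.exp (κ * b)) t := by
    intro t ht
    have h_exp : HasDerivAt (fun t => Real.exp (κ * t)) (Real.exp (κ * t) * κ) t := by
      simpa using ((hasDerivAt_id t).const_mul κ).exp
    refine ((h_exp.mul (hd t ht)).add
      ((hasDerivAt_id t).const_mul (β * Real.exp (κ * b)))).congr_deriv ?_
    ring
  have h_mono : MonotoneOn ψ (Icc a b) := by
    refine monotoneOn_of_deriv_nonneg (convex_Icc a b)
      (((Continuous.continuousOn (by fun_prop)).mul hy).add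
        (Continuous.continuousOn (by fun_prop))) ?_ ?_ <;> rw [interior_Icc] <;> intro t ht
    · exact (h_deriv t ht).differentiableAt.differentiableWithinAt
    · rw [(h_deriv t ht).deriv]
      have h_exp_le : Real.exp (κ * t) ≤ Real.exp (κ * b) :=
        Real.exp_le_exp.mpr (mul_le_mul_of_nonneg_left ht.2.le hκ)
      nlinarith [mul_le_mul_of_nonneg_left h_exp_le hβ,
        mul_nonneg (Real.exp_pos (κ * t)).le (by linarith [hle t ht] : 0 ≤ y' t + (κ * y t + β))]
  have h_exp_add : Real.exp (κ * b) = Real.exp (κ * t) * Real.exp (κ * (b - t)) := by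
    rw [← Real.exp_add]
    ring_nf
  have h_end : ψ t ≤ ψ b := h_mono ht ⟨ht.1.trans ht.2, le_rfl⟩ ht.2
  simp only [ψ, h_exp_add] at h_end
  refine le_of_mul_le_mul_left ?_ (Real.exp_pos (κ * t))
  linarith

/-- A periodic, divergence-free `C¹` field, by which one may advect without changing `L²`-norms. -/
structure IsSolenoidal {n : ℕ} (L : ℝ) (v : E n → E n) : Prop where
  contDiff : ContDiff ℝ 1 v
  periodic : SpacePeriodic L v
  divergence_eq_zero : ∀ x, divergence v x = 0

/-- `η` is a periodic solution on `(a, b)` of the advection-diffusion equation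
`∂η/∂t = -c Δη + (v, ∇)η + R`, which is parabolic in the negative direction of time. -/
structure IsAdvectionDiffusion {n : ℕ} {F : Type*} [NormedAddCommGroup F] [NormedSpace ℝ F]
    (L c a b : ℝ) (v : ℝ → E n → E n) (R η : ℝ → E n → F) : Prop where
  contDiffOn : ContDiffOn ℝ 2 (fun z : ℝ × E n => η z.1 z.2) (slab n a b)
  periodic : ∀ t ∈ Icc a b, SpacePeriodic L (η t)
  solenoidal : ∀ t ∈ Ioo a b, IsSolenoidal L (v t)
  equation : ∀ t ∈ Ioo a b, ∀ x, HasDerivAt (fun s => η s x)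
    (-(c • Laplacian.laplacian (η t) x) + advect (v t) (η t) x + R t x) t

section Energy

variable {n : ℕ} {L a b c κ β t : ℝ} {v : ℝ → E n → E n}

lemma continuous_advect {F : Type*} [NormedAddCommGroup F] [NormedSpace ℝ F] {v : E n → E n}
    {η : E n → F} (hv : Continuous v) (hη : ContDiff ℝ 1 η) : Continuous (advect v η) :=
  (hη.continuous_fderiv one_ne_zero).clm_apply hv

variable {F : Type*} [NormedAddCommGroup F] [InnerProductSpace ℝ F] {η R : ℝ → E n → F}

lemma IsAdvectionDiffusion.continuous_source (h : IsAdvectionDiffusion L c a b v R η)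
    (ht : t ∈ Ioo a b) : Continuous (R t) := by
  have ht' := Ioo_subset_Icc_self ht
  have h1 := h.contDiffOn.of_le one_le_two
  have hη := contDiff_slice h.contDiffOn ht'
  refine (((continuous_slice (continuousOn_timeDeriv (ht.1.trans ht.2) h1) ht').fun_add
    ((continuous_laplacian hη).fun_const_smul c)).fun_sub (continuous_advect
      (h.solenoidal t ht).contDiff.continuous (hη.of_le one_le_two))).congr fun x => ?_
  rw [(hasDerivAt_slice h1 ht x).unique (h.equation t ht x)]
  abel

lemma IsAdvectionDiffusion.two_mul_integral_inner_source_le (hL : 0 ≤ L) (hc : 0 ≤ c)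
    (h : IsAdvectionDiffusion L c a b v R η) (ht : t ∈ Ioo a b) :
    2 * ∫ x in cell n L, ⟪η t x, R t x⟫ ≤
      ∫ x in cell n L, timeDeriv a b (fun t x => ‖η t x‖ ^ 2) t x := by
  have ht' := Ioo_subset_Icc_self ht
  have hη := contDiff_slice h.contDiffOn ht'
  have hη1 : ContDiff ℝ 1 (η t) := hη.of_le one_le_two
  have hv := h.solenoidal t ht
  have h_sq : ContDiffOn ℝ 1 (fun z : ℝ × E n => ‖η z.1 z.2‖ ^ 2) (slab n a b) :=
    (h.contDiffOn.of_le one_le_two).norm_sq ℝ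
  have h_timeDeriv : ∀ x, timeDeriv a b (fun t x => ‖η t x‖ ^ 2) t x =
      -(2 * c) * ⟪η t x, Laplacian.laplacian (η t) x⟫ + 2 * ⟪η t x, advect (v t) (η t) x⟫ +
        2 * ⟪η t x, R t x⟫ := by
    intro x
    rw [(hasDerivAt_slice h_sq ht x).unique (h.equation t ht x).norm_sq, inner_add_right,
      inner_add_right, inner_neg_right, inner_smul_right]
    ring
  have h_int : ∀ {g : E n → F}, Continuous g → ∀ r : ℝ,
      IntegrableOn (fun x => r * ⟪η t x, g x⟫) (cell n L) :=
    fun hg r => integrableOn_cell (continuous_const.mul (hη.continuous.inner hg))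
  have h_lap := h_int (continuous_laplacian hη) (-(2 * c))
  have h_advect := h_int (continuous_advect hv.contDiff.continuous hη1) 2
  simp only [h_timeDeriv]
  rw [integral_add (h_lap.fun_add h_advect) (h_int (h.continuous_source ht) 2),
    integral_add h_lap h_advect, integral_const_mul, integral_const_mul, integral_const_mul,
    integral_inner_advect_eq_zero hL hv.contDiff hη1 hv.periodic (h.periodic t ht')
      hv.divergence_eq_zero]
  nlinarith [mul_nonneg hc (neg_nonneg.mpr
    (integral_inner_laplacian_nonpos hL hη (h.periodic t ht')))]

theorem IsAdvectionDiffusion.energy_estimate (hL : 0 ≤ L) (hab : a < b) (hc : 0 ≤ c)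
    (hκ : 0 ≤ κ) (hβ : 0 ≤ β) (h : IsAdvectionDiffusion L c a b v R η)
    (hR : ∀ t ∈ Ioo a b, -(κ * (∫ x in cell n L, ‖η t x‖ ^ 2) + β) ≤
      2 * ∫ x in cell n L, ⟪η t x, R t x⟫) (ht : t ∈ Icc a b) :
    ∫ x in cell n L, ‖η t x‖ ^ 2 ≤
      Real.exp (κ * (b - t)) * ((∫ x in cell n L, ‖η b x‖ ^ 2) + β * (b - t)) := by
  have h_sq : ContDiffOn ℝ 1 (fun z : ℝ × E n => ‖η z.1 z.2‖ ^ 2) (slab n a b) :=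
    (h.contDiffOn.of_le one_le_two).norm_sq ℝ
  exact backward_gronwall (y := fun t => ∫ x in cell n L, ‖η t x‖ ^ 2) hκ hβ
    (continuousOn_integral_cell (g := fun t x => ‖η t x‖ ^ 2) h_sq.continuousOn)
    (fun s hs => hasDerivAt_integral_cell hab (V := fun t x => ‖η t x‖ ^ 2) h_sq hs)
    (fun s hs => (hR s hs).trans (h.two_mul_integral_inner_source_le hL hc hs)) ht

theorem IsAdvectionDiffusion.energy_estimate_of_pointwise {ρ : ℝ} (hL : 0 ≤ L) (hab : a < b)
    (hc : 0 ≤ c) (hκ : 0 ≤ κ) (hρ : 0 ≤ ρ) (h : IsAdvectionDiffusion L c a b v R η)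
    (hR : ∀ t ∈ Ioo a b, ∀ x, -(κ * ‖η t x‖ ^ 2 + ρ) ≤ 2 * ⟪η t x, R t x⟫) (ht : t ∈ Icc a b) :
    ∫ x in cell n L, ‖η t x‖ ^ 2 ≤
      Real.exp (κ * (b - t)) * ((∫ x in cell n L, ‖η b x‖ ^ 2) + ρ * L ^ n * (b - t)) := by
  refine h.energy_estimate hL hab hc hκ (by positivity) (fun s hs => ?_) ht
  have hη : Continuous (η s) := (contDiff_slice h.contDiffOn (Ioo_subset_Icc_self hs)).continuous
  have h_sq : IntegrableOn (fun x => κ * ‖η s x‖ ^ 2) (cell n L) := integrableOn_cell (by fun_prop)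
  have h_const : IntegrableOn (fun _ => ρ) (cell n L) := integrableOn_cell continuous_const
  calc -(κ * (∫ x in cell n L, ‖η s x‖ ^ 2) + ρ * L ^ n)
      = ∫ x in cell n L, -(κ * ‖η s x‖ ^ 2 + ρ) := by
        rw [integral_neg, integral_add h_sq h_const, integral_const_mul, setIntegral_const,
          volume_real_cell hL, smul_eq_mul, mul_comm ρ]
    _ ≤ ∫ x in cell n L, 2 * ⟪η s x, R s x⟫ :=
        integral_mono (h_sq.fun_add h_const).fun_neg
          (integrableOn_cell (continuous_const.mul (hη.inner (h.continuous_source hs)))) (hR s hs)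
    _ = 2 * ∫ x in cell n L, ⟪η s x, R s x⟫ := integral_const_mul _ _

end Energy

/-! ### Lie derivatives of two-forms -/

section Derivatives

variable {n : ℕ} {G F : Type*} [NormedAddCommGroup G] [NormedSpace ℝ G]
  [NormedAddCommGroup F] [NormedSpace ℝ F]

lemma hasFDerivAt_fderiv {v : E n → G} (hv : ContDiff ℝ 2 v) (x : E n) :
    HasFDerivAt (fderiv ℝ v) (fderiv ℝ (fderiv ℝ v) x) x :=
  ((hv.fderiv_right le_rfl).differentiable one_ne_zero x).hasFDerivAt

lemma hasFDerivAt_advect {a : E n → E n} {v : E n → G} (ha : ContDiff ℝ 1 a)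
    (hv : ContDiff ℝ 2 v) (x : E n) :
    HasFDerivAt (advect a v)
      (fderiv ℝ v x ∘L fderiv ℝ a x + fderiv ℝ (fderiv ℝ v) x (a x)) x := by
  refine ((hasFDerivAt_fderiv hv x).clm_apply
    (ha.differentiable one_ne_zero x).hasFDerivAt).congr_fderiv ?_
  congr 1
  ext1 h
  rw [ContinuousLinearMap.flip_apply, fderiv_fderiv_symm hv]

lemma diffOp_advect {a : E n → E n} {v : E n → G} (ha : ContDiff ℝ 1 a) (hv : ContDiff ℝ 2 v)
    (C : (E n →L[ℝ] G) →L[ℝ] F) (x : E n) :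
    diffOp C (advect a v) x = advect a (diffOp C v) x + C (fderiv ℝ v x ∘L fderiv ℝ a x) := by
  rw [diffOp, (hasFDerivAt_advect ha hv x).fderiv, map_add, advect, fderiv_diffOp hv, add_comm,
    ContinuousLinearMap.comp_apply]

lemma advect_fun_sub {a : E n → E n} {v w : E n → G} (hv : ContDiff ℝ 1 v) (hw : ContDiff ℝ 1 w)
    (x : E n) : advect a (fun y => v y - w y) x = advect a v x - advect a w x :=
  congrArg (fun A : E n →L[ℝ] G => A (a x)) (fderiv_fun_sub (hv.differentiable one_ne_zero x)
    (hw.differentiable one_ne_zero x))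

lemma gradient_apply (q : E n → ℝ) (x : E n) (i : Fin n) : gradient q x i = pderiv i q x := by
  rw [pderiv_eq, ← inner_gradient_left, EuclideanSpace.inner_single_right]
  simp

lemma contDiff_gradient {q : E n → ℝ} (hq : ContDiff ℝ 2 q) : ContDiff ℝ 1 (gradient q) :=
  contDiff_euclidean.2 fun i => by
    simpa only [gradient_apply] using contDiff_diffOp hq le_rfl _

end Derivatives

section LieDerivative

variable {n : ℕ} {L : ℝ}

/-- The zeroth-order part of the Lie derivative of a two-form `W` along a field with Jacobian `A`:
`∑ₖ (Aᵢₖ Wₖⱼ + Aⱼₖ Wᵢₖ)`, where `Aᵢₖ = ∂ᵢ aₖ`. It is minus the vortex stretching term. -/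
def stretch : Tensor2 n →L[ℝ] (E n →L[ℝ] E n) →L[ℝ] Tensor2 n :=
  LinearMap.toContinuousBilinearMap <| LinearMap.mk₂ ℝ
    (fun W A => WithLp.toLp 2 fun q =>
      ∑ k, (A (basisVec q.1) k * W (k, q.2) + A (basisVec q.2) k * W (q.1, k)))
    (fun _ _ _ => by
      ext q
      simp only [PiLp.add_apply, ← Finset.sum_add_distrib]
      exact Finset.sum_congr rfl fun _ _ => by ring)
    (fun _ _ _ => by
      ext q
      simp only [PiLp.smul_apply, smul_eq_mul, Finset.mul_sum]
      exact Finset.sum_congr rfl fun _ _ => by ring)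
    (fun _ _ _ => by
      ext q
      simp only [PiLp.add_apply, add_apply, ← Finset.sum_add_distrib]
      exact Finset.sum_congr rfl fun _ _ => by ring)
    (fun _ _ _ => by
      ext q
      simp only [PiLp.smul_apply, smul_apply, smul_eq_mul, Finset.mul_sum]
      exact Finset.sum_congr rfl fun _ _ => by ring)

/-- The zeroth-order part `∑ₗ (Aᵢₗ Zₗⱼₖ + Aⱼₗ Zₗₖᵢ + Aₖₗ Zₗᵢⱼ)` of the Lie derivative of a
three-form `Z` along a field with Jacobian `A`. -/
def stretch3 : Tensor3 n →L[ℝ] (E n →L[ℝ] E n) →L[ℝ] Tensor3 n :=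
  LinearMap.toContinuousBilinearMap <| LinearMap.mk₂ ℝ
    (fun Z A => WithLp.toLp 2 fun q => ∑ l, (A (basisVec q.1) l * Z (l, q.2.1, q.2.2) +
      A (basisVec q.2.1) l * Z (l, q.2.2, q.1) + A (basisVec q.2.2) l * Z (l, q.1, q.2.1)))
    (fun _ _ _ => by
      ext q
      simp only [PiLp.add_apply, ← Finset.sum_add_distrib]
      exact Finset.sum_congr rfl fun _ _ => by ring)
    (fun _ _ _ => by
      ext q
      simp only [PiLp.smul_apply, smul_eq_mul, Finset.mul_sum]
      exact Finset.sum_congr rfl fun _ _ => by ring)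
    (fun _ _ _ => by
      ext q
      simp only [PiLp.add_apply, add_apply, ← Finset.sum_add_distrib]
      exact Finset.sum_congr rfl fun _ _ => by ring)
    (fun _ _ _ => by
      ext q
      simp only [PiLp.smul_apply, smul_apply, smul_eq_mul, Finset.mul_sum]
      exact Finset.sum_congr rfl fun _ _ => by ring)

lemma stretch_apply (W : Tensor2 n) (A : E n →L[ℝ] E n) (i j : Fin n) :
    stretch W A (i, j) = ∑ k, (A (basisVec i) k * W (k, j) + A (basisVec j) k * W (i, k)) := rfl

lemma stretch3_apply (Z : Tensor3 n) (A : E n →L[ℝ] E n) (i j k : Fin n) :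
    stretch3 Z A (i, j, k) = ∑ l, (A (basisVec i) l * Z (l, j, k) +
      A (basisVec j) l * Z (l, k, i) + A (basisVec k) l * Z (l, i, j)) := rfl

/-- The Lie derivative of a two-form `W` along a vector field `a`. -/
def lieDeriv (a : E n → E n) (W : E n → Tensor2 n) (x : E n) : Tensor2 n :=
  advect a W x + stretch (W x) (fderiv ℝ a x)

/-- The contraction `(∑ₖ aₖ Wₖⱼ)ⱼ` of a two-form with a vector field. -/
def contract (a : E n → E n) (W : E n → Tensor2 n) (x : E n) : E n :=
  WithLp.toLp 2 fun j => ∑ k, a x k * W x (k, j)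

lemma apply_coord_eq_sum {ι : Type*} (B : E n →L[ℝ] EuclideanSpace ℝ ι) (a : E n) (q : ι) :
    B a q = ∑ l, a l * B (basisVec l) q := by
  conv_lhs => rw [← sum_smul_basisVec a]
  simp

lemma rotSymbol_comp_self (A : E n →L[ℝ] E n) : rotSymbol (A ∘L A) = stretch (rotSymbol A) A := by
  ext ⟨i, j⟩
  rw [rotSymbol_apply, stretch_apply, ContinuousLinearMap.comp_apply,
    ContinuousLinearMap.comp_apply, apply_coord_eq_sum A (A _), apply_coord_eq_sum A (A _),
    ← Finset.sum_sub_distrib]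
  refine Finset.sum_congr rfl fun k _ => ?_
  rw [rotSymbol_apply, rotSymbol_apply]
  ring

lemma extDSymbol_comp_add_stretch (B : E n →L[ℝ] Tensor2 n) (A : E n →L[ℝ] E n) :
    extDSymbol (B ∘L A + stretch.flip A ∘L B) = stretch3 (extDSymbol B) A := by
  ext ⟨i, j, k⟩
  simp only [extDSymbol_apply, stretch3_apply, add_apply, PiLp.add_apply,
    ContinuousLinearMap.comp_apply, apply_coord_eq_sum B (A _), ContinuousLinearMap.flip_apply,
    stretch_apply, ← Finset.sum_add_distrib]
  exact Finset.sum_congr rfl fun l _ => by ring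

lemma extDSymbol_stretch_comp {W : Tensor2 n} (hW : IsAntisymm W)
    {D : E n →L[ℝ] E n →L[ℝ] E n} (hD : ∀ h k, D h k = D k h) :
    extDSymbol (stretch W ∘L D) = 0 := by
  ext ⟨i, j, k⟩
  simp only [extDSymbol_apply, ContinuousLinearMap.comp_apply, stretch_apply,
    ← Finset.sum_add_distrib]
  refine Finset.sum_eq_zero fun l _ => ?_
  rw [hW j l, hW k l, hW i l, hD (basisVec k) (basisVec i), hD (basisVec j) (basisVec i),
    hD (basisVec k) (basisVec j)]
  ring

lemma extDSymbol_rotSymbol_comp {D : E n →L[ℝ] E n →L[ℝ] E n} (hD : ∀ h k, D h k = D k h) :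
    extDSymbol (rotSymbol ∘L D) = 0 := by
  ext ⟨i, j, k⟩
  simp only [extDSymbol_apply, ContinuousLinearMap.comp_apply, rotSymbol_apply]
  rw [hD (basisVec k) (basisVec i), hD (basisVec j) (basisVec i), hD (basisVec k) (basisVec j)]
  simp

lemma extD_rot {v : E n → E n} (hv : ContDiff ℝ 2 v) : extD (rot v) = 0 := by
  ext1 x
  rw [extD, diffOp, rot, fderiv_diffOp hv]
  exact extDSymbol_rotSymbol_comp (fderiv_fderiv_symm hv x)

lemma rot_gradient {q : E n → ℝ} (hq : ContDiff ℝ 2 q) : rot (gradient q) = 0 := by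
  have h_grad : ∀ i j x, pderiv i (gradient q) x j = pderiv i (pderiv j q) x := fun i j x => by
    rw [← congrFun (pderiv_coord (contDiff_gradient hq) i j) x]
    simp only [gradient_apply]
  ext x ⟨i, j⟩
  change pderiv i (gradient q) x j - pderiv j (gradient q) x i = 0
  rw [h_grad, h_grad, pderiv_diffOp hq, sub_self]

lemma rot_advect_self {v : E n → E n} (hv : ContDiff ℝ 2 v) :
    rot (advect v v) = lieDeriv v (rot v) := by
  ext1 x
  rw [rot, diffOp_advect (hv.of_le one_le_two) hv, rotSymbol_comp_self]
  rfl

lemma hasFDerivAt_stretch_fderiv {a : E n → E n} {W : E n → Tensor2 n} (ha : ContDiff ℝ 2 a)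
    (hW : ContDiff ℝ 1 W) (x : E n) :
    HasFDerivAt (fun y => stretch (W y) (fderiv ℝ a y))
      (stretch.flip (fderiv ℝ a x) ∘L fderiv ℝ W x + stretch (W x) ∘L fderiv ℝ (fderiv ℝ a) x)
      x := by
  refine (stretch.hasFDerivAt_of_bilinear (hW.differentiable one_ne_zero x).hasFDerivAt
    (hasFDerivAt_fderiv ha x)).congr_fderiv ?_
  ext h : 1
  simp [ContinuousLinearMap.precompR, ContinuousLinearMap.precompL, add_comm]

lemma differentiable_lieDeriv {a : E n → E n} {W : E n → Tensor2 n} (ha : ContDiff ℝ 2 a)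
    (hW : ContDiff ℝ 2 W) : Differentiable ℝ (lieDeriv a W) := fun x =>
  ((hasFDerivAt_advect (ha.of_le one_le_two) hW x).add
    (hasFDerivAt_stretch_fderiv ha (hW.of_le one_le_two) x)).differentiableAt

lemma extD_lieDeriv {a : E n → E n} {W : E n → Tensor2 n} (ha : ContDiff ℝ 2 a)
    (hW : ContDiff ℝ 2 W) {x : E n} (hx : IsAntisymm (W x)) :
    extD (lieDeriv a W) x = advect a (extD W) x + stretch3 (extD W x) (fderiv ℝ a x) := by
  have h_advect := hasFDerivAt_advect (ha.of_le one_le_two) hW x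
  have h_fderiv : fderiv ℝ (lieDeriv a W) x = _ :=
    (h_advect.add (hasFDerivAt_stretch_fderiv ha (hW.of_le one_le_two) x)).fderiv
  have h_second : extDSymbol (fderiv ℝ (fderiv ℝ W) x (a x)) = advect a (extD W) x := by
    rw [advect, extD, fderiv_diffOp hW, ContinuousLinearMap.comp_apply]
  rw [extD, diffOp, h_fderiv, add_right_comm, ← add_assoc, map_add, map_add, h_second,
    extDSymbol_comp_add_stretch, extDSymbol_stretch_comp hx (fderiv_fderiv_symm ha x), add_zero,
    add_comm]
  rfl

lemma contDiff_contract {a : E n → E n} {W : E n → Tensor2 n} (ha : ContDiff ℝ 1 a)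
    (hW : ContDiff ℝ 1 W) : ContDiff ℝ 1 (contract a W) :=
  contDiff_euclidean.2 fun j => by
    unfold contract
    fun_prop

lemma isAntisymm_pderiv {W : E n → Tensor2 n} (hW : ContDiff ℝ 1 W)
    (hanti : ∀ x, IsAntisymm (W x)) (i : Fin n) (x : E n) : IsAntisymm (pderiv i W x) :=
  fun j k => by
    rw [← congrFun (pderiv_coord hW i _) x, ← congrFun (pderiv_coord hW i _) x, pderiv_eq,
      pderiv_eq, funext fun y => hanti y j k, fderiv_fun_neg]
    rfl

lemma lieDeriv_eq_rot_contract {a : E n → E n} {W : E n → Tensor2 n} (ha : ContDiff ℝ 1 a)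
    (hW : ContDiff ℝ 1 W) (hanti : ∀ x, IsAntisymm (W x)) (hclosed : extD W = 0) :
    lieDeriv a W = rot (contract a W) := by
  have h_diff : ∀ {ι : Type} [Fintype ι] (g : E n → EuclideanSpace ℝ ι), ContDiff ℝ 1 g →
      ∀ q, Differentiable ℝ fun x => g x q := fun g hg q => by fun_prop
  have h_contract : ∀ i j x, pderiv i (contract a W) x j =
      ∑ k, (fderiv ℝ a x (basisVec i) k * W x (k, j) + a x k * pderiv i W x (k, j)) := by
    intro i j x
    have h_sum : HasFDerivAt (fun y => contract a W y j) _ x := HasFDerivAt.fun_sum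
      (u := Finset.univ) fun k _ =>
        (h_diff a ha k x).hasFDerivAt.fun_mul (h_diff W hW (k, j) x).hasFDerivAt
    rw [← congrFun (pderiv_coord (contDiff_contract ha hW) i j) x, pderiv_eq,
      h_sum.fderiv, sum_apply]
    refine Finset.sum_congr rfl fun k _ => ?_
    rw [← pderiv_eq, ← congrFun (pderiv_coord ha i k) x, ← congrFun (pderiv_coord hW i (k, j)) x,
      pderiv_eq, pderiv_eq, add_comm, mul_comm]
    rfl
  ext x ⟨i, j⟩
  have h_cycle : ∀ k, pderiv k W x (i, j) = pderiv i W x (k, j) - pderiv j W x (k, i) := fun k => by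
    have h_cyclic : pderiv i W x (j, k) + pderiv j W x (k, i) + pderiv k W x (i, j) = 0 :=
      congrArg (fun Z : Tensor3 n => Z (i, j, k)) (congrFun hclosed x)
    linarith [isAntisymm_pderiv hW hanti i x k j]
  change advect a W x (i, j) + stretch (W x) (fderiv ℝ a x) (i, j) =
    pderiv i (contract a W) x j - pderiv j (contract a W) x i
  rw [h_contract, h_contract, advect, apply_coord_eq_sum, stretch_apply,
    ← Finset.sum_add_distrib, ← Finset.sum_sub_distrib]
  refine Finset.sum_congr rfl fun k _ => ?_
  rw [← pderiv_eq, h_cycle, hanti x k i]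
  ring

end LieDerivative

/-! ### Solutions of the Navier-Stokes equations -/

section VorticityEquation

variable {n : ℕ} {G F : Type*} [NormedAddCommGroup G] [NormedSpace ℝ G]
  [NormedAddCommGroup F] [NormedSpace ℝ F]

lemma differentiable_laplacian {w : E n → G} (hw : ContDiff ℝ 3 w) :
    Differentiable ℝ (Laplacian.laplacian w) := by
  rw [laplacian_eq_sum (hw.of_le (by norm_num))]
  exact Differentiable.fun_sum fun i _ => (contDiff_diffOp (k := 1) (m := 2)
    (contDiff_diffOp hw le_rfl _) le_rfl _).differentiable one_ne_zero

lemma hasDerivAt_diffOp_slice {a b c t : ℝ} {V : ℝ → E n → G} {g f : E n → G}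
    (hV : ContDiffOn ℝ 3 (fun z : ℝ × E n => V z.1 z.2) (slab n a b)) (ht : t ∈ Ioo a b)
    (hg : Differentiable ℝ g) (hf : Differentiable ℝ f)
    (hV' : ∀ y, HasDerivAt (fun s => V s y) (-(c • Laplacian.laplacian (V t) y) + g y - f y) t)
    (C : (E n →L[ℝ] G) →L[ℝ] F) (x : E n) :
    HasDerivAt (fun s => diffOp C (V s) x)
      (-(c • Laplacian.laplacian (diffOp C (V t)) x) + diffOp C g x - diffOp C f x) t := by
  have h_slice : ContDiff ℝ 3 (V t) := contDiff_slice hV (Ioo_subset_Icc_self ht)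
  have h_fderiv := ((((differentiable_laplacian h_slice x).hasFDerivAt.const_smul c).neg.add
    (hg x).hasFDerivAt).sub (hf x).hasFDerivAt).fderiv
  refine (C.hasFDerivAt.comp_hasDerivAt t (hasDerivAt_fderiv_slice (hV.of_le (by norm_num)) ht x
    hV')).congr_deriv ((congrArg C h_fderiv).trans ?_)
  rw [map_sub, map_add, map_neg, map_smul, laplacian_diffOp h_slice]
  rfl

end VorticityEquation

section Solutions

variable {n : ℕ} {L σ T t : ℝ} {f : ℝ → E n → E n} {φ ψ : E n → E n} {u v : ℝ → E n → E n}
  {p q : ℝ → E n → ℝ}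

lemma IsSolenoidal.sub {v w : E n → E n} (hv : IsSolenoidal L v) (hw : IsSolenoidal L w) :
    IsSolenoidal L fun x => v x - w x where
  contDiff := hv.contDiff.sub hw.contDiff
  periodic := hv.periodic.comp₂ hw.periodic fun a b => a - b
  divergence_eq_zero x := by
    have h_diff := (hv.contDiff.differentiable one_ne_zero x).hasFDerivAt.fun_sub
      (hw.contDiff.differentiable one_ne_zero x).hasFDerivAt
    have h_div := congrArg₂ (· - ·) (hv.divergence_eq_zero x) (hw.divergence_eq_zero x)
    simp only [divergence, partialD_eq hv.contDiff, partialD_eq hw.contDiff,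
      partialD_eq (hv.contDiff.sub hw.contDiff)] at h_div ⊢
    rw [h_diff.fderiv]
    simpa [Finset.sum_sub_distrib] using h_div

lemma IsNSESolution.contDiff (h : IsNSESolution L σ T f φ u p) (ht : t ∈ Icc 0 T) :
    ContDiff ℝ 3 (u t) := contDiff_slice h.smooth ht

lemma IsNSESolution.hasDerivAt (h : IsNSESolution L σ T f φ u p) (ht : t ∈ Ioo 0 T) (x : E n) :
    HasDerivAt (fun s => u s x) (-((σ ^ 2 / 2) • Laplacian.laplacian (u t) x)
      + advect (u t) (u t) x + gradient (p t) x - f t x) t :=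
  (h.momentum t (Ioo_subset_Ico_self ht) x).hasDerivAt (Icc_mem_nhds ht.1 ht.2)

lemma IsNSESolution.isSolenoidal (h : IsNSESolution L σ T f φ u p) (ht : t ∈ Icc 0 T) :
    IsSolenoidal L (u t) :=
  ⟨(h.contDiff ht).of_le (by norm_num), h.periodic t ht, h.incompressible t ht⟩

lemma IsNSESolution.contDiff_terminal (h : IsNSESolution L σ T f φ u p) (hT : 0 ≤ T) :
    ContDiff ℝ 3 φ := h.terminal ▸ h.contDiff (right_mem_Icc.2 hT)

lemma IsNSESolution.isSolenoidal_terminal (h : IsNSESolution L σ T f φ u p) (hT : 0 ≤ T) :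
    IsSolenoidal L φ := h.terminal ▸ h.isSolenoidal (right_mem_Icc.2 hT)

lemma IsNSESolution.restrict {τ : ℝ} (h : IsNSESolution L σ T f φ u p) (hτ : τ ≤ T) :
    IsNSESolution L σ τ f (u τ) u p where
  smooth := h.smooth.mono (slab_mono (Icc_subset_Icc_right hτ))
  smooth_pressure t ht := h.smooth_pressure t (Ico_subset_Ico_right hτ ht)
  periodic t ht := h.periodic t (Icc_subset_Icc_right hτ ht)
  periodic_pressure t ht := h.periodic_pressure t (Ico_subset_Ico_right hτ ht)
  momentum t ht x :=
    (h.momentum t (Ico_subset_Ico_right hτ ht) x).mono (Icc_subset_Icc_right hτ)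
  incompressible t ht := h.incompressible t (Icc_subset_Icc_right hτ ht)
  zero_average t ht := h.zero_average t (Icc_subset_Icc_right hτ ht)
  terminal := rfl

theorem IsNSESolution.hasDerivAt_rot (h : IsNSESolution L σ T f φ u p) (ht : t ∈ Ioo 0 T)
    (hf : Differentiable ℝ (f t)) (x : E n) :
    HasDerivAt (fun s => rot (u s) x) (-((σ ^ 2 / 2) • Laplacian.laplacian (rot (u t)) x)
      + lieDeriv (u t) (rot (u t)) x - rot (f t) x) t := by
  have hu : ContDiff ℝ 2 (u t) := (h.contDiff (Ioo_subset_Icc_self ht)).of_le (by norm_num)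
  have hp := h.smooth_pressure t (Ioo_subset_Ico_self ht)
  have h_advect : Differentiable ℝ (advect (u t) (u t)) := fun y =>
    (hasFDerivAt_advect (hu.of_le one_le_two) hu y).differentiableAt
  have h_grad := (contDiff_gradient hp).differentiable one_ne_zero
  have h_rot : rot (fun y => advect (u t) (u t) y + gradient (p t) y) x =
      lieDeriv (u t) (rot (u t)) x := by
    rw [rot, diffOp, fderiv_fun_add (h_advect x) (h_grad x), map_add]
    exact (congrArg₂ (· + ·) (congrFun (rot_advect_self hu) x)
      (congrFun (rot_gradient hp) x)).trans (add_zero _)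
  rw [← h_rot]
  exact hasDerivAt_diffOp_slice h.smooth ht (h_advect.fun_add h_grad) hf
    (fun y => (h.hasDerivAt ht y).congr_deriv (by rw [add_assoc])) rotSymbol x

lemma IsNSESolution.isAdvectionDiffusion_sub (hu : IsNSESolution L σ T f φ u p)
    (hv : IsNSESolution L σ T f ψ v q) : IsAdvectionDiffusion L (σ ^ 2 / 2) 0 T u
      (fun t x => fderiv ℝ (v t) x (u t x - v t x) + gradient (p t) x - gradient (q t) x)
      (fun t x => u t x - v t x) where
  contDiffOn := (hu.smooth.sub hv.smooth).of_le (by norm_num)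
  periodic t ht := (hu.periodic t ht).comp₂ (hv.periodic t ht) fun a b => a - b
  solenoidal t ht := hu.isSolenoidal (Ioo_subset_Icc_self ht)
  equation t ht x := by
    have hut := hu.contDiff (Ioo_subset_Icc_self ht)
    have hvt := hv.contDiff (Ioo_subset_Icc_self ht)
    have h_laplacian : Laplacian.laplacian (fun y => u t y - v t y) x =
        Laplacian.laplacian (u t) x - Laplacian.laplacian (v t) x :=
      (hut.of_le (by norm_num)).contDiffAt.laplacian_sub (hvt.of_le (by norm_num)).contDiffAt
    refine ((hu.hasDerivAt ht x).fun_sub (hv.hasDerivAt ht x)).congr_deriv ?_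
    rw [h_laplacian, advect_fun_sub (hut.of_le (by norm_num)) (hvt.of_le (by norm_num)), smul_sub]
    simp only [advect, map_sub]
    abel

lemma IsNSESolution.integral_inner_sub_gradient_eq_zero (hL : 0 ≤ L)
    (hu : IsNSESolution L σ T f φ u p) (hv : IsNSESolution L σ T f ψ v q) (ht : t ∈ Ioo 0 T) :
    ∫ x in cell n L, ⟪u t x - v t x, gradient (p t) x⟫ = 0 := by
  have ht' := Ioo_subset_Icc_self ht
  have h_sub := (hu.isSolenoidal ht').sub (hv.isSolenoidal ht')
  exact integral_inner_gradient_eq_zero hL h_sub.contDiff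
    ((hu.smooth_pressure t (Ioo_subset_Ico_self ht)).of_le one_le_two) h_sub.periodic
    (hu.periodic_pressure t (Ioo_subset_Ico_self ht)) h_sub.divergence_eq_zero

lemma neg_mul_sq_le_inner_apply {F : Type*} [NormedAddCommGroup F] [InnerProductSpace ℝ F]
    {A : F →L[ℝ] F} {M : ℝ} (hA : ‖A‖ ≤ M) (η : F) : -(M * ‖η‖ ^ 2) ≤ ⟪η, A η⟫ := by
  refine neg_le_of_abs_le ((abs_real_inner_le_norm _ _).trans ?_)
  calc ‖η‖ * ‖A η‖ ≤ ‖η‖ * (M * ‖η‖) := by gcongr; exact A.le_of_opNorm_le hA η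
    _ = M * ‖η‖ ^ 2 := by ring

theorem IsNSESolution.integral_norm_sq_sub_le {M : ℝ} (hL : 0 ≤ L) (hT : 0 < T) (hM : 0 ≤ M)
    (hu : IsNSESolution L σ T f φ u p) (hv : IsNSESolution L σ T f ψ v q)
    (hbound : ∀ t ∈ Icc 0 T, ∀ x, ‖fderiv ℝ (v t) x‖ ≤ M) (ht : t ∈ Icc 0 T) :
    ∫ x in cell n L, ‖u t x - v t x‖ ^ 2 ≤
      Real.exp (2 * M * (T - t)) * ∫ x in cell n L, ‖u T x - v T x‖ ^ 2 := by
  refine ((hu.isAdvectionDiffusion_sub hv).energy_estimate hL hT (by positivity)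
    (κ := 2 * M) (β := 0) (by positivity) le_rfl (fun s hs => ?_) ht).trans_eq (by simp)
  have hs' := Ioo_subset_Icc_self hs
  have h_sub : Continuous fun x => u s x - v s x :=
    (hu.contDiff hs').continuous.sub (hv.contDiff hs').continuous
  have h_fderiv : Continuous fun x => fderiv ℝ (v s) x (u s x - v s x) :=
    ((hv.contDiff hs').continuous_fderiv (by norm_num)).clm_apply h_sub
  have h_int : ∀ {g : E n → E n}, Continuous g →
      IntegrableOn (fun x => ⟪u s x - v s x, g x⟫) (cell n L) :=
    fun hg => integrableOn_cell (h_sub.inner hg)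
  have h_grad_p := h_int
    (contDiff_gradient (hu.smooth_pressure s (Ioo_subset_Ico_self hs))).continuous
  have h_grad_q := h_int
    (contDiff_gradient (hv.smooth_pressure s (Ioo_subset_Ico_self hs))).continuous
  have h_grad_q_eq : ∫ x in cell n L, ⟪u s x - v s x, gradient (q s) x⟫ = 0 := by
    simpa only [← neg_sub (v s _), inner_neg_left, integral_neg, neg_eq_zero]
      using hv.integral_inner_sub_gradient_eq_zero hL hu hs
  have h_lower := integral_mono (μ := volume.restrict (cell n L))
    (integrableOn_cell (by fun_prop)) (h_int h_fderiv)
    fun x => neg_mul_sq_le_inner_apply (hbound s hs' x) (u s x - v s x)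
  simp only [inner_sub_right (u s _ - v s _) (_ + _), inner_add_right]
  rw [integral_sub ((h_int h_fderiv).fun_add h_grad_p) h_grad_q,
    integral_add (h_int h_fderiv) h_grad_p, h_grad_q_eq,
    hu.integral_inner_sub_gradient_eq_zero hL hv hs]
  rw [integral_neg, integral_const_mul] at h_lower
  linarith

end Solutions

section Bounds

variable {n : ℕ} {F : Type*} [NormedAddCommGroup F] [NormedSpace ℝ F] {a b B : ℝ}
  {V : ℝ → E n → F}

lemma norm_fderiv_slice_le {t : ℝ} {x : E n}
    (hV : ContDiffOn ℝ 1 (fun z : ℝ × E n => V z.1 z.2) (slab n a b)) (ht : t ∈ Icc a b)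
    (hB : ‖fderivWithin ℝ (fun z : ℝ × E n => V z.1 z.2) (slab n a b) (t, x)‖ ≤ B) :
    ‖fderiv ℝ (V t) x‖ ≤ B := by
  rw [fderiv_slice hV ht]
  exact ((ContinuousLinearMap.opNorm_comp_le _ _).trans (mul_le_of_le_one_right (norm_nonneg _)
    (ContinuousLinearMap.norm_inr_le_one _ _ _))).trans hB

lemma norm_slice_sub_slice_le {s t : ℝ} {x : E n}
    (hV : ContDiffOn ℝ 1 (fun z : ℝ × E n => V z.1 z.2) (slab n a b))
    (hB : ∀ r ∈ Icc a b,
      ‖fderivWithin ℝ (fun z : ℝ × E n => V z.1 z.2) (slab n a b) (r, x)‖ ≤ B)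
    (hs : s ∈ Icc a b) (ht : t ∈ Icc a b) : ‖V t x - V s x‖ ≤ B * |t - s| := by
  refine Convex.norm_image_sub_le_of_norm_hasDerivWithin_le (f := fun t => V t x)
    (fun r hr => hasDerivWithinAt_slice hV hr x) (fun r hr => ?_) (convex_Icc a b) hs ht
  refine (ContinuousLinearMap.le_of_opNorm_le _ (hB r hr) _).trans_eq ?_
  simp [Prod.norm_def]

lemma norm_fderivWithin_fderiv_slice_le {z : ℝ × E n} (hab : a < b)
    (hV : ContDiffOn ℝ 2 (fun z : ℝ × E n => V z.1 z.2) (slab n a b)) (hz : z ∈ slab n a b) :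
    ‖fderivWithin ℝ (fun z : ℝ × E n => fderiv ℝ (V z.1) z.2) (slab n a b) z‖ ≤
      ‖fderivWithin ℝ (fderivWithin ℝ (fun z : ℝ × E n => V z.1 z.2) (slab n a b))
        (slab n a b) z‖ := by
  set restrictSpace : (ℝ × E n →L[ℝ] F) →L[ℝ] (E n →L[ℝ] F) :=
    (ContinuousLinearMap.compL ℝ (E n) (ℝ × E n) F).flip (ContinuousLinearMap.inr ℝ ℝ (E n))
  have h_norm : ‖restrictSpace‖ ≤ 1 := ContinuousLinearMap.opNorm_le_bound _ zero_le_one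
    fun A => by
      rw [one_mul]
      exact (ContinuousLinearMap.opNorm_comp_le _ _).trans (mul_le_of_le_one_right
        (norm_nonneg _) (ContinuousLinearMap.norm_inr_le_one _ _ _))
  have h_second := (((hV.fderivWithin (uniqueDiffOn_slab hab) (m := 1) le_rfl).differentiableOn
    one_ne_zero) z hz).hasFDerivWithinAt
  have h_slice : ∀ y ∈ slab n a b, fderiv ℝ (V y.1) y.2 = restrictSpace
      (fderivWithin ℝ (fun z : ℝ × E n => V z.1 z.2) (slab n a b) y) :=
    fun y hy => fderiv_slice (hV.of_le one_le_two) hy.1 y.2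
  rw [((restrictSpace.hasFDerivAt.comp_hasFDerivWithinAt z h_second).congr h_slice
    (h_slice z hz)).fderivWithin (uniqueDiffOn_slab hab z hz)]
  exact (ContinuousLinearMap.opNorm_comp_le _ _).trans
    (mul_le_of_le_one_left (norm_nonneg _) h_norm)

end Bounds

section DerivativesBoundedBy

variable {n : ℕ} {M T : ℝ} {v : ℝ → E n → E n}

lemma DerivativesBoundedBy.nonneg (hM : DerivativesBoundedBy M T v) (hT : 0 ≤ T) : 0 ≤ M :=
  (norm_nonneg _).trans (hM 0 zero_le_two (0, 0) ⟨⟨le_rfl, hT⟩, mem_univ _⟩)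

lemma DerivativesBoundedBy.norm_fderivWithin_le (hM : DerivativesBoundedBy M T v) (hT : 0 < T)
    {z : ℝ × E n} (hz : z ∈ slab n 0 T) :
    ‖fderivWithin ℝ (fun z : ℝ × E n => v z.1 z.2) (slab n 0 T) z‖ ≤ M := by
  rw [← norm_iteratedFDerivWithin_one _ (uniqueDiffOn_slab hT z hz)]
  exact hM 1 one_le_two z hz

lemma DerivativesBoundedBy.norm_fderivWithin_fderiv_le (hM : DerivativesBoundedBy M T v)
    (hT : 0 < T) (hv : ContDiffOn ℝ 2 (fun z : ℝ × E n => v z.1 z.2) (slab n 0 T))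
    {z : ℝ × E n} (hz : z ∈ slab n 0 T) :
    ‖fderivWithin ℝ (fun z : ℝ × E n => fderiv ℝ (v z.1) z.2) (slab n 0 T) z‖ ≤ M := by
  refine (norm_fderivWithin_fderiv_slice_le hT hv hz).trans ?_
  rw [← norm_iteratedFDerivWithin_one _ (uniqueDiffOn_slab hT z hz),
    norm_iteratedFDerivWithin_fderivWithin (uniqueDiffOn_slab hT) hz]
  exact hM 2 le_rfl z hz

lemma DerivativesBoundedBy.norm_fderiv_le (hM : DerivativesBoundedBy M T v) (hT : 0 < T)
    (hv : ContDiffOn ℝ 1 (fun z : ℝ × E n => v z.1 z.2) (slab n 0 T)) {t : ℝ}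
    (ht : t ∈ Icc 0 T) (x : E n) : ‖fderiv ℝ (v t) x‖ ≤ M :=
  norm_fderiv_slice_le hv ht (hM.norm_fderivWithin_le hT ⟨ht, mem_univ x⟩)

lemma DerivativesBoundedBy.norm_fderiv_fderiv_le (hM : DerivativesBoundedBy M T v) (hT : 0 < T)
    (hv : ContDiffOn ℝ 2 (fun z : ℝ × E n => v z.1 z.2) (slab n 0 T)) {t : ℝ}
    (ht : t ∈ Icc 0 T) (x : E n) : ‖fderiv ℝ (fderiv ℝ (v t)) x‖ ≤ M :=
  norm_fderiv_slice_le (V := fun t => fderiv ℝ (v t)) (contDiffOn_fderiv_slice hT le_rfl hv) ht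
    (hM.norm_fderivWithin_fderiv_le hT hv ⟨ht, mem_univ x⟩)

lemma DerivativesBoundedBy.norm_sub_le (hM : DerivativesBoundedBy M T v) (hT : 0 < T)
    (hv : ContDiffOn ℝ 1 (fun z : ℝ × E n => v z.1 z.2) (slab n 0 T)) {s t : ℝ}
    (hs : s ∈ Icc 0 T) (ht : t ∈ Icc 0 T) (x : E n) : ‖v t x - v s x‖ ≤ M * |t - s| :=
  norm_slice_sub_slice_le hv (fun _ hr => hM.norm_fderivWithin_le hT ⟨hr, mem_univ x⟩) hs ht

lemma DerivativesBoundedBy.norm_fderiv_sub_le (hM : DerivativesBoundedBy M T v) (hT : 0 < T)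
    (hv : ContDiffOn ℝ 2 (fun z : ℝ × E n => v z.1 z.2) (slab n 0 T)) {s t : ℝ}
    (hs : s ∈ Icc 0 T) (ht : t ∈ Icc 0 T) (x : E n) :
    ‖fderiv ℝ (v t) x - fderiv ℝ (v s) x‖ ≤ M * |t - s| :=
  norm_slice_sub_slice_le (V := fun t => fderiv ℝ (v t)) (contDiffOn_fderiv_slice hT le_rfl hv)
    (fun _ hr => hM.norm_fderivWithin_fderiv_le hT hv ⟨hr, mem_univ x⟩) hs ht

end DerivativesBoundedBy

/-! ### Vorticity transported by a frozen velocity -/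

/-- `W` solves, on the time interval `[a, b]` and in the negative direction of time, the vorticity
equation with force `f` in which the velocity is frozen to the field `v`. Vorticities are written as
antisymmetric matrices, in any dimension. -/
structure IsFrozenVorticity {n : ℕ} (L c a b : ℝ) (v : E n → E n) (f : ℝ → E n → E n)
    (W : ℝ → E n → Tensor2 n) : Prop where
  contDiffOn : ContDiffOn ℝ 3 (fun z : ℝ × E n => W z.1 z.2) (slab n a b)
  periodic : ∀ t ∈ Icc a b, SpacePeriodic L (W t)
  antisymm : ∀ t ∈ Icc a b, ∀ x, IsAntisymm (W t x)
  equation : ∀ t ∈ Ioo a b, ∀ x, HasDerivAt (fun s => W s x)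
    (-(c • Laplacian.laplacian (W t) x) + lieDeriv v (W t) x - rot (f t) x) t

section FrozenVorticity

set_option maxSynthPendingDepth 3

variable {n : ℕ} {L c a b M t : ℝ} {v : E n → E n} {f : ℝ → E n → E n}
  {W : ℝ → E n → Tensor2 n}

lemma IsFrozenVorticity.contDiff (h : IsFrozenVorticity L c a b v f W) (ht : t ∈ Icc a b) :
    ContDiff ℝ 3 (W t) := contDiff_slice h.contDiffOn ht

lemma norm_flip_apply_le {F G H : Type*} [NormedAddCommGroup F] [NormedSpace ℝ F]
    [NormedAddCommGroup G] [NormedSpace ℝ G] [NormedAddCommGroup H] [NormedSpace ℝ H]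
    (B : F →L[ℝ] G →L[ℝ] H) {A : G} (hA : ‖A‖ ≤ M) : ‖B.flip A‖ ≤ ‖B‖ * M := by
  simpa using B.flip.le_opNorm_of_le hA

lemma IsFrozenVorticity.isAdvectionDiffusion_extD (h : IsFrozenVorticity L c a b v f W)
    (hab : a < b) (hv : ContDiff ℝ 2 v) (hsol : IsSolenoidal L v)
    (hf : ∀ t ∈ Ioo a b, ContDiff ℝ 2 (f t)) :
    IsAdvectionDiffusion L c a b (fun _ => v)
      (fun t x => stretch3 (extD (W t) x) (fderiv ℝ v x)) (fun t => extD (W t)) where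
  contDiffOn := extDSymbol.contDiff.comp_contDiffOn
    (contDiffOn_fderiv_slice hab le_rfl h.contDiffOn)
  periodic t ht := (h.periodic t ht).diffOp extDSymbol
  solenoidal _ _ := hsol
  equation t ht x := by
    have hW : ContDiff ℝ 2 (W t) := (h.contDiff (Ioo_subset_Icc_self ht)).of_le (by norm_num)
    have h_rot : Differentiable ℝ (rot (f t)) :=
      (contDiff_diffOp (hf t ht) le_rfl rotSymbol).differentiable one_ne_zero
    have h_lie : diffOp extDSymbol (lieDeriv v (W t)) x = _ :=
      extD_lieDeriv hv hW (h.antisymm t (Ioo_subset_Icc_self ht) x)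
    have h_force : diffOp extDSymbol (rot (f t)) x = 0 := congrFun (extD_rot (hf t ht)) x
    refine (hasDerivAt_diffOp_slice h.contDiffOn ht (differentiable_lieDeriv hv hW) h_rot
      (h.equation t ht) extDSymbol x).congr_deriv ?_
    rw [h_lie, h_force, sub_zero, ← add_assoc]
    rfl

theorem IsFrozenVorticity.extD_eq_zero (h : IsFrozenVorticity L c a b v f W) (hL : 0 < L)
    (hab : a < b) (hc : 0 ≤ c) (hv : ContDiff ℝ 2 v) (hsol : IsSolenoidal L v)
    (hf : ∀ t ∈ Ioo a b, ContDiff ℝ 2 (f t)) (hb : extD (W b) = 0) (ht : t ∈ Icc a b) :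
    extD (W t) = 0 := by
  obtain ⟨M, hM⟩ := hsol.periodic.fderiv.exists_norm_le hL (hv.continuous_fderiv two_ne_zero)
  have hM0 : 0 ≤ M := (norm_nonneg _).trans (hM 0)
  have h_energy := (h.isAdvectionDiffusion_extD hab hv hsol hf).energy_estimate_of_pointwise
    hL.le hab hc (κ := 2 * (‖stretch3 (n := n)‖ * M)) (by positivity) le_rfl (fun s _ x => by
      have h_stretch : -(‖stretch3 (n := n)‖ * M * ‖extD (W s) x‖ ^ 2) ≤
          ⟪extD (W s) x, stretch3 (extD (W s) x) (fderiv ℝ v x)⟫ :=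
        neg_mul_sq_le_inner_apply (norm_flip_apply_le stretch3 (hM x)) _
      linarith) ht
  refine eq_zero_of_integral_norm_sq_eq_zero hL
    (continuous_diffOp ((h.contDiff ht).of_le (by norm_num)) _)
    ((h.periodic t ht).diffOp extDSymbol) (le_antisymm (h_energy.trans_eq ?_)
      (integral_nonneg fun x => sq_nonneg _))
  simp [hb]

lemma IsFrozenVorticity.integral_timeDeriv_eq_zero (h : IsFrozenVorticity L c a b v f W)
    (hL : 0 ≤ L) (hsol : IsSolenoidal L v) (ht : t ∈ Ioo a b) (hf : ContDiff ℝ 1 (f t))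
    (hfp : SpacePeriodic L (f t)) (hclosed : extD (W t) = 0) :
    ∫ x in cell n L, timeDeriv a b W t x = 0 := by
  have ht' := Ioo_subset_Icc_self ht
  have hW : ContDiff ℝ 2 (W t) := (h.contDiff ht').of_le (by norm_num)
  have hW1 : ContDiff ℝ 1 (W t) := hW.of_le one_le_two
  have h_contract := contDiff_contract hsol.contDiff hW1
  have h_contract_periodic : SpacePeriodic L (contract v (W t)) :=
    hsol.periodic.comp₂ (h.periodic t ht') fun a w => WithLp.toLp 2 fun j => ∑ k, a k * w (k, j)
  have h_lap : IntegrableOn (fun x => -(c • Laplacian.laplacian (W t) x)) (cell n L) :=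
    integrableOn_cell ((continuous_laplacian hW).fun_const_smul c).fun_neg
  have h_lie : IntegrableOn (rot (contract v (W t))) (cell n L) :=
    integrableOn_cell (continuous_diffOp h_contract _)
  have h_force : IntegrableOn (rot (f t)) (cell n L) := integrableOn_cell (continuous_diffOp hf _)
  have h_timeDeriv : ∀ x, timeDeriv a b W t x =
      -(c • Laplacian.laplacian (W t) x) + rot (contract v (W t)) x - rot (f t) x := fun x => by
    rw [(hasDerivAt_slice (h.contDiffOn.of_le (by norm_num)) ht x).unique (h.equation t ht x),
      lieDeriv_eq_rot_contract hsol.contDiff hW1 (h.antisymm t ht') hclosed]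
  simp only [h_timeDeriv]
  rw [integral_sub (h_lap.fun_add h_lie) h_force,
    integral_add h_lap h_lie, integral_neg, integral_smul,
    integral_laplacian_eq_zero hL hW (h.periodic t ht'),
    rot, integral_diffOp_eq_zero hL h_contract h_contract_periodic,
    rot, integral_diffOp_eq_zero hL hf hfp]
  simp

theorem IsFrozenVorticity.integral_eq_zero (h : IsFrozenVorticity L c a b v f W) (hL : 0 ≤ L)
    (hab : a < b) (hsol : IsSolenoidal L v) (hf : ∀ t ∈ Ioo a b, ContDiff ℝ 1 (f t))
    (hfp : ∀ t ∈ Ioo a b, SpacePeriodic L (f t)) (hclosed : ∀ t ∈ Icc a b, extD (W t) = 0)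
    (hb : ∫ x in cell n L, W b x = 0) (ht : t ∈ Icc a b) : ∫ x in cell n L, W t x = 0 := by
  have hW1 : ContDiffOn ℝ 1 (fun z : ℝ × E n => W z.1 z.2) (slab n a b) :=
    h.contDiffOn.of_le (by norm_num)
  have h_deriv : ∀ s ∈ Ioo a b, HasDerivAt (fun s => ∫ x in cell n L, W s x) 0 s := fun s hs =>
    (hasDerivAt_integral_cell hab hW1 hs).congr_deriv
      (h.integral_timeDeriv_eq_zero hL hsol hs (hf s hs) (hfp s hs)
        (hclosed s (Ioo_subset_Icc_self hs)))
  have h_norm_sq := backward_gronwall (κ := 0) (β := 0) le_rfl le_rfl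
    (y := fun s => ‖∫ x in cell n L, W s x‖ ^ 2)
    ((continuousOn_integral_cell hW1.continuousOn).norm.pow 2)
    (fun s hs => (h_deriv s hs).norm_sq) (fun s _ => by simp) ht
  simpa [hb] using h_norm_sq

end FrozenVorticity

section LocalError

set_option maxSynthPendingDepth 3

variable {n : ℕ} {L σ a b M t : ℝ} {f : ℝ → E n → E n} {ψ : E n → E n} {v : ℝ → E n → E n}
  {q : ℝ → E n → ℝ} {W : ℝ → E n → Tensor2 n}

lemma IsNSESolution.isAdvectionDiffusion_rot_sub (hv : IsNSESolution L σ b f ψ v q) (ha : 0 ≤ a)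
    (hab : a < b) (hW : IsFrozenVorticity L (σ ^ 2 / 2) a b (v b) f W)
    (hf : ∀ t ∈ Ioo a b, Differentiable ℝ (f t)) :
    IsAdvectionDiffusion L (σ ^ 2 / 2) a b (fun _ => v b)
      (fun t x => fderiv ℝ (rot (v t)) x (v t x - v b x)
        + stretch (rot (v t) x) (fderiv ℝ (v t) x - fderiv ℝ (v b) x)
        + stretch (rot (v t) x - W t x) (fderiv ℝ (v b) x))
      (fun t x => rot (v t) x - W t x) where
  contDiffOn := (rotSymbol.contDiff.comp_contDiffOn (contDiffOn_fderiv_slice hab le_rfl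
    (hv.smooth.mono (slab_mono (Icc_subset_Icc_left ha))))).sub (hW.contDiffOn.of_le (by norm_num))
  periodic t ht := ((hv.periodic t (Icc_subset_Icc_left ha ht)).diffOp rotSymbol).comp₂
    (hW.periodic t ht) fun a b => a - b
  solenoidal _ _ := hv.isSolenoidal ⟨ha.trans hab.le, le_rfl⟩
  equation t ht x := by
    have h_rot : ContDiff ℝ 2 (rot (v t)) :=
      contDiff_diffOp (hv.contDiff (Icc_subset_Icc_left ha (Ioo_subset_Icc_self ht))) le_rfl _
    have hWt : ContDiff ℝ 2 (W t) := (hW.contDiff (Ioo_subset_Icc_self ht)).of_le (by norm_num)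
    have h_laplacian : Laplacian.laplacian (fun y => rot (v t) y - W t y) x =
        Laplacian.laplacian (rot (v t)) x - Laplacian.laplacian (W t) x :=
      h_rot.contDiffAt.laplacian_sub hWt.contDiffAt
    refine ((hv.hasDerivAt_rot (Ioo_subset_Ioo_left ha ht) (hf t ht) x).fun_sub
      (hW.equation t ht x)).congr_deriv ?_
    rw [h_laplacian, advect_fun_sub (h_rot.of_le one_le_two) (hWt.of_le one_le_two), smul_sub]
    simp only [lieDeriv, advect, map_sub, sub_apply]
    abel

/-- The `L^∞`-error per unit of time which freezing the velocity makes in the equation for the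
vorticity of a flow whose derivatives of order at most two are bounded by `M`. -/
def freezingRate (n : ℕ) (M : ℝ) : ℝ :=
  ‖rotSymbol (n := n)‖ * M ^ 2 * (1 + ‖stretch (n := n)‖)

lemma norm_frozen_source_le {x δ : E n} {A B : E n →L[ℝ] E n} {w : E n → E n}
    {η : Tensor2 n} {h : ℝ} (hw : ContDiff ℝ 2 w) (h1 : ‖fderiv ℝ w x‖ ≤ M)
    (h2 : ‖fderiv ℝ (fderiv ℝ w) x‖ ≤ M) (hδ : ‖δ‖ ≤ M * h) (hA : ‖A‖ ≤ M * h)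
    (hB : ‖B‖ ≤ M) :
    ‖fderiv ℝ (rot w) x δ + stretch (rot w x) A + stretch η B‖ ≤
      ‖stretch (n := n)‖ * M * ‖η‖ + freezingRate n M * h := by
  have hM : 0 ≤ M := (norm_nonneg _).trans h1
  have h_rot : ‖rot w x‖ ≤ ‖rotSymbol (n := n)‖ * M := rotSymbol.le_opNorm_of_le h1
  have h_fderiv_rot : ‖fderiv ℝ (rot w) x‖ ≤ ‖rotSymbol (n := n)‖ * M := by
    rw [rot, fderiv_diffOp hw]
    exact (ContinuousLinearMap.opNorm_comp_le _ _).trans (by gcongr)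
  calc _ ≤ ‖fderiv ℝ (rot w) x δ‖ + ‖stretch (rot w x) A‖ + ‖stretch η B‖ := norm_add₃_le
    _ ≤ ‖rotSymbol (n := n)‖ * M * (M * h)
        + ‖stretch (n := n)‖ * (‖rotSymbol (n := n)‖ * M) * (M * h)
        + ‖stretch (n := n)‖ * ‖η‖ * M := by
      gcongr
      · exact ContinuousLinearMap.le_of_opNorm_le_of_le _ h_fderiv_rot hδ
      · exact ContinuousLinearMap.le_of_opNorm_le_of_le _
          (stretch.le_opNorm_of_le h_rot) hA
      · exact ContinuousLinearMap.le_of_opNorm_le_of_le _ (stretch.le_opNorm η) hB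
    _ = _ := by rw [freezingRate]; ring

lemma IsNSESolution.norm_freezing_source_le {η : Tensor2 n} {x : E n} {h : ℝ}
    (hv : IsNSESolution L σ b f ψ v q) (hb : 0 < b) (hM : DerivativesBoundedBy M b v)
    (ht : t ∈ Icc 0 b) (hh : b - t ≤ h) :
    ‖fderiv ℝ (rot (v t)) x (v t x - v b x)
        + stretch (rot (v t) x) (fderiv ℝ (v t) x - fderiv ℝ (v b) x)
        + stretch η (fderiv ℝ (v b) x)‖ ≤
      ‖stretch (n := n)‖ * M * ‖η‖ + freezingRate n M * h := by
  have hbb : b ∈ Icc 0 b := ⟨hb.le, le_rfl⟩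
  have hv1 := hv.smooth.of_le (m := 1) (by norm_num)
  have hv2 := hv.smooth.of_le (m := 2) (by norm_num)
  have h_time : M * |t - b| ≤ M * h := by
    rw [abs_sub_comm, abs_of_nonneg (sub_nonneg.2 ht.2)]
    exact mul_le_mul_of_nonneg_left hh (hM.nonneg hb.le)
  exact norm_frozen_source_le ((hv.contDiff ht).of_le (by norm_num))
    (hM.norm_fderiv_le hb hv1 ht x) (hM.norm_fderiv_fderiv_le hb hv2 ht x)
    ((hM.norm_sub_le hb hv1 hbb ht x).trans h_time)
    ((hM.norm_fderiv_sub_le hb hv2 hbb ht x).trans h_time) (hM.norm_fderiv_le hb hv1 hbb x)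

lemma neg_le_two_mul_inner_of_norm_le {F : Type*} [NormedAddCommGroup F] [InnerProductSpace ℝ F]
    {η R : F} {μ ρ h : ℝ} (hh : 0 < h) (hR : ‖R‖ ≤ μ * ‖η‖ + ρ) :
    -((2 * μ + 1 / h) * ‖η‖ ^ 2 + h * ρ ^ 2) ≤ 2 * ⟪η, R⟫ := by
  have h_inner : -(‖η‖ * (μ * ‖η‖ + ρ)) ≤ ⟪η, R⟫ := neg_le_of_abs_le
    ((abs_real_inner_le_norm _ _).trans (mul_le_mul_of_nonneg_left hR (norm_nonneg _)))
  have h_young : 2 * (‖η‖ * ρ) ≤ 1 / h * ‖η‖ ^ 2 + h * ρ ^ 2 := by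
    have h_sq : 0 ≤ h * (1 / h * ‖η‖ - ρ) ^ 2 := by positivity
    have h_expand : h * (1 / h * ‖η‖ - ρ) ^ 2 =
        1 / h * ‖η‖ ^ 2 - 2 * (‖η‖ * ρ) + h * ρ ^ 2 := by
      field_simp
      ring
    linarith
  linarith

theorem IsNSESolution.integral_norm_sq_rot_sub_le (hv : IsNSESolution L σ b f ψ v q)
    (hL : 0 ≤ L) (ha : 0 ≤ a) (hab : a < b)
    (hW : IsFrozenVorticity L (σ ^ 2 / 2) a b (v b) f W)
    (hf : ∀ t ∈ Ioo a b, Differentiable ℝ (f t)) (hM : DerivativesBoundedBy M b v)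
    (hb : rot (v b) = W b) (ht : t ∈ Icc a b) :
    ∫ x in cell n L, ‖rot (v t) x - W t x‖ ^ 2 ≤
      Real.exp (2 * (‖stretch (n := n)‖ * M) * (b - a) + 1) * L ^ n *
        (freezingRate n M * (b - a) ^ 2) ^ 2 := by
  have hb0 : 0 < b := ha.trans_lt hab
  have hM0 := hM.nonneg hb0.le
  have hh : 0 < b - a := sub_pos.2 hab
  set s := ‖stretch (n := n)‖
  set ρ := freezingRate n M * (b - a)
  have h_source := (hv.isAdvectionDiffusion_rot_sub ha hab hW hf).energy_estimate_of_pointwise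
    hL hab (by positivity) (κ := 2 * (s * M) + 1 / (b - a)) (ρ := (b - a) * ρ ^ 2)
    (by positivity) (by positivity)
    (fun r hr x => neg_le_two_mul_inner_of_norm_le hh (hv.norm_freezing_source_le hb0 hM
      ⟨ha.trans hr.1.le, hr.2.le⟩ (sub_le_sub_left hr.1.le b))) ht
  simp only [hb, sub_self, norm_zero, ne_eq, OfNat.ofNat_ne_zero, not_false_eq_true, zero_pow,
    integral_zero, zero_add] at h_source
  have h_exponent : (2 * (s * M) + 1 / (b - a)) * (b - t) ≤ 2 * (s * M) * (b - a) + 1 := by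
    have h_le : b - t ≤ b - a := sub_le_sub_left ht.1 b
    have h_div : 1 / (b - a) * (b - t) ≤ 1 := by rwa [one_div_mul_eq_div, div_le_one hh]
    rw [add_mul]
    gcongr
  calc _ ≤ Real.exp ((2 * (s * M) + 1 / (b - a)) * (b - t)) *
        ((b - a) * ρ ^ 2 * L ^ n * (b - t)) := h_source
    _ ≤ Real.exp (2 * (s * M) * (b - a) + 1) * ((b - a) * ρ ^ 2 * L ^ n * (b - a)) := by
      have h_sub := sub_nonneg.2 ht.2
      gcongr
      exact ht.1
    _ = _ := by simp only [ρ]; ring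

theorem IsNSESolution.integral_norm_sq_sub_biotSavart_le (hv : IsNSESolution L σ b f ψ v q)
    (hn : n < 6) (hL : 0 < L) (ha : 0 ≤ a) (hab : a < b)
    (hW : IsFrozenVorticity L (σ ^ 2 / 2) a b (v b) f W)
    (hf : ∀ t ∈ Ioo a b, Differentiable ℝ (f t)) (hM : DerivativesBoundedBy M b v)
    (hb : rot (v b) = W b) (ht : t ∈ Icc a b) :
    ∫ x in cell n L, ‖v t x - biotSavart L (W t) x‖ ^ 2 ≤ (L / (2 * Real.pi)) ^ 2 *
      (Real.exp (2 * (‖stretch (n := n)‖ * M) * (b - a) + 1) * L ^ n *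
        (freezingRate n M * (b - a) ^ 2) ^ 2) := by
  have ht' := Icc_subset_Icc_left ha ht
  have h_sol := hv.isSolenoidal ht'
  refine (PeriodicNSE.integral_norm_sq_sub_biotSavart_le hn hL h_sol.contDiff h_sol.periodic
    h_sol.divergence_eq_zero (hv.zero_average t ht') ((hW.contDiff ht).of_le (by norm_num))
    (hW.periodic t ht)).trans ?_
  gcongr
  exact hv.integral_norm_sq_rot_sub_le hL.le ha hab hW hf hM hb ht

end LocalError

/-! ### Error of the velocity on a single time interval -/

section SingleInterval

set_option maxSynthPendingDepth 3

variable {n : ℕ} {L σ a b M T t : ℝ} {f : ℝ → E n → E n} {φ ψ : E n → E n}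
  {u v : ℝ → E n → E n} {p q : ℝ → E n → ℝ} {W : ℝ → E n → Tensor2 n}

lemma eLpNorm_cell_le_ofReal_iff {F : Type*} [NormedAddCommGroup F] {g : E n → F}
    (hg : Continuous g) {c : ℝ} (hc : 0 ≤ c) :
    eLpNorm g 2 (volume.restrict (cell n L)) ≤ ENNReal.ofReal c ↔
      ∫ x in cell n L, ‖g x‖ ^ 2 ≤ c ^ 2 := by
  have h_memLp : MemLp g 2 (volume.restrict (cell n L)) :=
    (memLp_two_iff_integrable_sq_norm hg.aestronglyMeasurable).2
      (integrableOn_cell (hg.norm.pow 2))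
  rw [h_memLp.eLpNorm_eq_integral_rpow_norm two_ne_zero ENNReal.ofNat_ne_top,
    ENNReal.ofReal_le_ofReal_iff hc, ← Real.sqrt_le_left hc, Real.sqrt_eq_rpow]
  simp

lemma eLpNorm_cell_sub_le_add {F : Type*} [NormedAddCommGroup F] {g₁ g₂ g₃ : E n → F}
    (h₁ : Continuous g₁) (h₂ : Continuous g₂) (h₃ : Continuous g₃) :
    eLpNorm (fun x => g₁ x - g₃ x) 2 (volume.restrict (cell n L)) ≤
      eLpNorm (fun x => g₁ x - g₂ x) 2 (volume.restrict (cell n L)) +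
        eLpNorm (fun x => g₂ x - g₃ x) 2 (volume.restrict (cell n L)) := by
  refine (eLpNorm_add_le (h₁.sub h₂).aestronglyMeasurable (h₂.sub h₃).aestronglyMeasurable
    one_le_two).trans_eq' (congrArg (eLpNorm · 2 _) ?_)
  ext x
  simp

/-- The constant `D` such that freezing the velocity during a time `h` makes an `L²`-error of at
most `D h²` in the velocity of a flow on `[0, T]` with derivatives bounded by `M`. -/
def localErrorConst (n : ℕ) (L T M : ℝ) : ℝ :=
  L / (2 * Real.pi) * √(Real.exp (2 * (‖stretch (n := n)‖ * M) * T + 1) * L ^ n) *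
    freezingRate n M

lemma localErrorConst_nonneg (hL : 0 ≤ L) : 0 ≤ localErrorConst n L T M := by
  unfold localErrorConst freezingRate
  positivity

theorem IsNSESolution.eLpNorm_sub_biotSavart_le (hv : IsNSESolution L σ b f ψ v q) (hn : n < 6)
    (hL : 0 < L) (ha : 0 ≤ a) (hab : a < b) (hbT : b ≤ T)
    (hW : IsFrozenVorticity L (σ ^ 2 / 2) a b (v b) f W)
    (hf : ∀ t ∈ Ioo a b, Differentiable ℝ (f t)) (hM : DerivativesBoundedBy M b v)
    (hb : rot (v b) = W b) (ht : t ∈ Icc a b) :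
    eLpNorm (fun x => v t x - biotSavart L (W t) x) 2 (volume.restrict (cell n L)) ≤
      ENNReal.ofReal (localErrorConst n L T M * (b - a) ^ 2) := by
  have hM0 := hM.nonneg (ha.trans hab.le)
  have hD := localErrorConst_nonneg (n := n) (T := T) (M := M) hL.le
  have h_cont : Continuous fun x => v t x - biotSavart L (W t) x :=
    (hv.contDiff (Icc_subset_Icc_left ha ht)).continuous.sub
      (continuous_biotSavart hn hL ((hW.contDiff ht).of_le (by norm_num)) (hW.periodic t ht))
  refine (eLpNorm_cell_le_ofReal_iff h_cont (by positivity)).2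
    ((hv.integral_norm_sq_sub_biotSavart_le hn hL ha hab hW hf hM hb ht).trans ?_)
  have h_time : b - a ≤ T := by linarith
  calc (L / (2 * Real.pi)) ^ 2 * (Real.exp (2 * (‖stretch (n := n)‖ * M) * (b - a) + 1) * L ^ n *
        (freezingRate n M * (b - a) ^ 2) ^ 2)
      ≤ (L / (2 * Real.pi)) ^ 2 * (Real.exp (2 * (‖stretch (n := n)‖ * M) * T + 1) * L ^ n *
        (freezingRate n M * (b - a) ^ 2) ^ 2) := by gcongr
    _ = (localErrorConst n L T M * (b - a) ^ 2) ^ 2 := by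
      simp only [localErrorConst, mul_pow]
      rw [Real.sq_sqrt (by positivity)]
      ring

-- The true flow is compared with the flow `v` started from the approximate velocity at time `b`:
-- the distance of the two grows by stability, and `v` leaves the approximation at second order.
theorem IsNSESolution.eLpNorm_sub_biotSavart_le_of_terminal {c : ℝ}
    (hu : IsNSESolution L σ b f φ u p) (hv : IsNSESolution L σ b f (biotSavart L (W b)) v q)
    (hn : n < 6) (hL : 0 < L) (ha : 0 ≤ a) (hab : a < b) (hbT : b ≤ T)
    (hW : IsFrozenVorticity L (σ ^ 2 / 2) a b (biotSavart L (W b)) f W)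
    (hf : ∀ t ∈ Ioo a b, Differentiable ℝ (f t)) (hM : DerivativesBoundedBy M b v)
    (hb : rot (biotSavart L (W b)) = W b) (hc : 0 ≤ c)
    (h_terminal : eLpNorm (fun x => u b x - biotSavart L (W b) x) 2 (volume.restrict (cell n L)) ≤
      ENNReal.ofReal c) (ht : t ∈ Icc a b) :
    eLpNorm (fun x => u t x - biotSavart L (W t) x) 2 (volume.restrict (cell n L)) ≤
      ENNReal.ofReal (Real.exp (M * (b - t)) * c + localErrorConst n L T M * (b - a) ^ 2) := by
  have hb0 : 0 < b := ha.trans_lt hab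
  have hbb : b ∈ Icc 0 b := ⟨hb0.le, le_rfl⟩
  have ht' := Icc_subset_Icc_left ha ht
  have hv1 := hv.smooth.of_le (m := 1) (by norm_num)
  rw [← hv.terminal] at hW hb h_terminal
  have h_local := hv.eLpNorm_sub_biotSavart_le hn hL ha hab hbT hW hf hM hb ht
  have h_stability : eLpNorm (fun x => u t x - v t x) 2 (volume.restrict (cell n L)) ≤
      ENNReal.ofReal (Real.exp (M * (b - t)) * c) := by
    have h_terminal_sq : ∫ x in cell n L, ‖u b x - v b x‖ ^ 2 ≤ c ^ 2 :=
      (eLpNorm_cell_le_ofReal_iff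
        ((hu.contDiff hbb).continuous.sub (hv.contDiff hbb).continuous) hc).1 h_terminal
    refine (eLpNorm_cell_le_ofReal_iff ((hu.contDiff ht').continuous.sub
      (hv.contDiff ht').continuous) (by positivity)).2 ?_
    calc ∫ x in cell n L, ‖u t x - v t x‖ ^ 2
        ≤ Real.exp (2 * M * (b - t)) * ∫ x in cell n L, ‖u b x - v b x‖ ^ 2 :=
          hu.integral_norm_sq_sub_le hL.le hb0 (hM.nonneg hb0.le) hv
            (fun s hs => hM.norm_fderiv_le hb0 hv1 hs) ht'
      _ ≤ Real.exp (2 * M * (b - t)) * c ^ 2 := by gcongr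
      _ = (Real.exp (M * (b - t)) * c) ^ 2 := by
        rw [mul_pow, ← Real.exp_nat_mul]
        push_cast
        ring_nf
  rw [ENNReal.ofReal_add (by positivity)
    (mul_nonneg (localErrorConst_nonneg hL.le) (sq_nonneg _))]
  exact (eLpNorm_cell_sub_le_add (hu.contDiff ht').continuous (hv.contDiff ht').continuous
    (continuous_biotSavart hn hL ((hW.contDiff ht).of_le (by norm_num)) (hW.periodic t ht))).trans
    (add_le_add h_stability h_local)

end SingleInterval

/-! ### The approximation on the whole time interval -/

section Node

variable {T : ℝ} {N k : ℕ}

lemma node_succ_sub_node : node T N (k + 1) - node T N k = T / N := by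
  simp only [node]
  push_cast
  ring

lemma node_nonneg (hT : 0 ≤ T) : 0 ≤ node T N k := by
  unfold node
  positivity

lemma node_lt_node_succ (hT : 0 < T) (hk : k < N) : node T N k < node T N (k + 1) := by
  have hN : (0 : ℝ) < N := by exact_mod_cast k.zero_le.trans_lt hk
  rw [← sub_pos, node_succ_sub_node]
  positivity

lemma node_self (hN : N ≠ 0) : node T N N = T := mul_div_cancel₀ T (Nat.cast_ne_zero.2 hN)

lemma node_succ_le (hT : 0 ≤ T) (hk : k < N) : node T N (k + 1) ≤ T := by
  refine le_of_le_of_eq ?_ (node_self (T := T) (Nat.ne_zero_of_lt hk))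
  unfold node
  gcongr
  exact hk

lemma Ioo_node_subset (hT : 0 ≤ T) (hk : k < N) :
    Ioo (node T N k) (node T N (k + 1)) ⊆ Ico 0 T := fun _ ht =>
  ⟨(node_nonneg hT).trans ht.1.le, ht.2.trans_le (node_succ_le hT hk)⟩

end Node

/-- The vorticity approximation with frozen velocity of a flow with terminal velocity `φ`, in any
dimension: `W k` is defined on the `k`-th time interval, where the velocity is frozen to its value
at the end of the interval. -/
structure IsVorticityApprox {n : ℕ} (L σ T : ℝ) (N : ℕ) (f : ℝ → E n → E n) (φ : E n → E n)
    (W : ℕ → ℝ → E n → Tensor2 n) : Prop where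
  isFrozenVorticity : ∀ k < N, IsFrozenVorticity L (σ ^ 2 / 2) (node T N k) (node T N (k + 1))
    (biotSavart L (W k (node T N (k + 1)))) f (W k)
  terminal : W (N - 1) (node T N N) = rot φ
  matching : ∀ k, k + 1 < N → W k (node T N (k + 1)) = W (k + 1) (node T N (k + 1))

namespace IsVorticityApprox

variable {n : ℕ} {L σ T M : ℝ} {N k : ℕ} {f : ℝ → E n → E n} {φ : E n → E n}
  {W : ℕ → ℝ → E n → Tensor2 n}

section Nodes

variable (hW : IsVorticityApprox L σ T N f φ W) (hL : 0 < L) (hT : 0 < T)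
  (hf : ∀ t ∈ Ico 0 T, ContDiff ℝ 2 (f t) ∧ SpacePeriodic L (f t)) (hφ : ContDiff ℝ 2 φ)
  (hφp : SpacePeriodic L φ)
  (hU : ∀ k < N, ContDiff ℝ 2 (biotSavart L (W k (node T N (k + 1)))))
  (hsol : ∀ k < N, IsSolenoidal L (biotSavart L (W k (node T N (k + 1)))))
include hW hL hT hf hφ hφp hU hsol

lemma extD_eq_zero_and_integral_eq_zero (hk : k < N) :
    extD (W k (node T N (k + 1))) = 0 ∧ ∫ x in cell n L, W k (node T N (k + 1)) x = 0 := by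
  refine Nat.decreasingInduction'
    (P := fun k => extD (W k (node T N (k + 1))) = 0 ∧
      ∫ x in cell n L, W k (node T N (k + 1)) x = 0)
    (fun k hk _ ih => ?_) (Nat.le_sub_one_of_lt hk) ?_
  · have hk1 : k + 1 < N := Nat.add_lt_of_lt_sub hk
    have hWk := hW.isFrozenVorticity _ hk1
    have hlt := node_lt_node_succ hT hk1
    have hfk : ∀ t ∈ Ioo (node T N (k + 1)) (node T N (k + 1 + 1)), ContDiff ℝ 2 (f t) :=
      fun t ht => (hf t (Ioo_node_subset hT.le hk1 ht)).1
    have h_closed : ∀ t ∈ Icc (node T N (k + 1)) (node T N (k + 1 + 1)), extD (W (k + 1) t) = 0 :=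
      fun t ht => hWk.extD_eq_zero hL hlt (by positivity) (hU _ hk1) (hsol _ hk1) hfk ih.1 ht
    rw [hW.matching k hk1]
    exact ⟨h_closed _ (left_mem_Icc.2 hlt.le),
      hWk.integral_eq_zero hL.le hlt (hsol _ hk1) (fun t ht => (hfk t ht).of_le one_le_two)
        (fun t ht => (hf t (Ioo_node_subset hT.le hk1 ht)).2) h_closed ih.2
        (left_mem_Icc.2 hlt.le)⟩
  · rw [Nat.sub_add_cancel (Nat.one_le_of_lt hk), hW.terminal]
    exact ⟨extD_rot hφ, integral_diffOp_eq_zero hL.le (hφ.of_le one_le_two) hφp _⟩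

theorem rot_biotSavart_node (hn : n < 6) (hk : k < N) :
    rot (biotSavart L (W k (node T N (k + 1)))) = W k (node T N (k + 1)) := by
  have h_end := right_mem_Icc.2 (node_lt_node_succ hT hk).le
  have hWk := hW.isFrozenVorticity k hk
  obtain ⟨h_closed, h_mean⟩ :=
    hW.extD_eq_zero_and_integral_eq_zero hL hT hf hφ hφp hU hsol hk
  exact rot_biotSavart hn hL ((hWk.contDiff h_end).of_le (by norm_num)) (hWk.periodic _ h_end)
    (hWk.antisymm _ h_end) h_mean h_closed (hsol k hk).contDiff

end Nodes

section Convergence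

variable {u : ℝ → E n → E n} {p : ℝ → E n → ℝ} {t : ℝ}
  (hW : IsVorticityApprox L σ T N f φ W) (hn : n < 6) (hL : 0 < L) (hT : 0 < T)
  (hf : ∀ t ∈ Ico 0 T, ContDiff ℝ 2 (f t) ∧ SpacePeriodic L (f t))
  (hu : IsNSESolution L σ T f φ u p)
  (h_restart : ∀ k < N, ∃ (v : ℝ → E n → E n) (q : ℝ → E n → ℝ),
    IsNSESolution L σ (node T N (k + 1)) f (biotSavart L (W k (node T N (k + 1)))) v q ∧
      DerivativesBoundedBy M (node T N (k + 1)) v)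
include hW hn hL hT hf hu h_restart

lemma eLpNorm_sub_le_of_node {m : ℝ} (hm : 0 ≤ m) (hk : k < N)
    (h_node : eLpNorm (fun x => u (node T N (k + 1)) x - biotSavart L (W k (node T N (k + 1))) x) 2
        (volume.restrict (cell n L)) ≤ ENNReal.ofReal
      (m * (Real.exp (M * (T - node T N (k + 1))) * (localErrorConst n L T M * (T / N) ^ 2))))
    (ht : t ∈ Icc (node T N k) (node T N (k + 1))) :
    eLpNorm (fun x => u t x - biotSavart L (W k t) x) 2 (volume.restrict (cell n L)) ≤
      ENNReal.ofReal ((m + 1) *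
        (Real.exp (M * (T - t)) * (localErrorConst n L T M * (T / N) ^ 2))) := by
  have hlt := node_lt_node_succ hT hk
  have hb := hW.rot_biotSavart_node hL hT hf ((hu.contDiff_terminal hT.le).of_le (by norm_num))
    (hu.isSolenoidal_terminal hT.le).periodic
    (fun k hk => by
      obtain ⟨v, q, hv, -⟩ := h_restart k hk
      exact (hv.contDiff_terminal (node_nonneg hT.le)).of_le (by norm_num))
    (fun k hk => by
      obtain ⟨v, q, hv, -⟩ := h_restart k hk
      exact hv.isSolenoidal_terminal (node_nonneg hT.le)) hn hk
  obtain ⟨v, q, hv, hM⟩ := h_restart k hk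
  have hM0 := hM.nonneg (node_nonneg hT.le)
  have hD := localErrorConst_nonneg (n := n) (T := T) (M := M) hL.le
  refine ((hu.restrict (node_succ_le hT.le hk)).eLpNorm_sub_biotSavart_le_of_terminal hv hn hL
    (node_nonneg hT.le) hlt (node_succ_le hT.le hk) (hW.isFrozenVorticity k hk)
    (fun s hs => (hf s (Ioo_node_subset hT.le hk hs)).1.differentiable two_ne_zero) hM hb
    (by positivity) h_node ht).trans (ENNReal.ofReal_le_ofReal ?_)
  set ε := localErrorConst n L T M * (T / N) ^ 2 with hε
  have h_one_le : 1 ≤ Real.exp (M * (T - t)) := Real.one_le_exp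
    (mul_nonneg hM0 (sub_nonneg.2 (ht.2.trans (node_succ_le hT.le hk))))
  have h_exp : Real.exp (M * (node T N (k + 1) - t)) * Real.exp (M * (T - node T N (k + 1))) =
      Real.exp (M * (T - t)) := by
    rw [← Real.exp_add]
    ring_nf
  calc _ = m * (Real.exp (M * (node T N (k + 1) - t)) * Real.exp (M * (T - node T N (k + 1))) * ε)
        + 1 * ε := by rw [node_succ_sub_node, ← hε]; ring
    _ ≤ m * (Real.exp (M * (T - t)) * ε) + Real.exp (M * (T - t)) * ε := by
      rw [h_exp]
      gcongr
    _ = _ := by ring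

lemma eLpNorm_sub_node_le (hk : k < N) :
    eLpNorm (fun x => u (node T N (k + 1)) x - biotSavart L (W k (node T N (k + 1))) x) 2
        (volume.restrict (cell n L)) ≤ ENNReal.ofReal ((N - (k + 1)) *
      (Real.exp (M * (T - node T N (k + 1))) * (localErrorConst n L T M * (T / N) ^ 2))) := by
  refine Nat.decreasingInduction'
    (P := fun k => eLpNorm
        (fun x => u (node T N (k + 1)) x - biotSavart L (W k (node T N (k + 1))) x) 2
        (volume.restrict (cell n L)) ≤ ENNReal.ofReal ((N - (k + 1)) *
      (Real.exp (M * (T - node T N (k + 1))) * (localErrorConst n L T M * (T / N) ^ 2))))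
    (fun k hk _ ih => ?_) (Nat.le_sub_one_of_lt hk) ?_
  · have hk1 : k + 1 < N := Nat.add_lt_of_lt_sub hk
    have h_le : ((k + 1 : ℕ) + 1 : ℝ) ≤ N := by exact_mod_cast hk1
    rw [hW.matching k hk1]
    refine (hW.eLpNorm_sub_le_of_node hn hL hT hf hu h_restart (sub_nonneg.2 h_le) hk1 ih
      (left_mem_Icc.2 (node_lt_node_succ hT hk1).le)).trans_eq ?_
    push_cast
    ring_nf
  · have hTT : T ∈ Icc 0 T := right_mem_Icc.2 hT.le
    have h_sol := hu.isSolenoidal hTT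
    have h_rot : ContDiff ℝ 2 (rot (u T)) := contDiff_diffOp (hu.contDiff hTT) le_rfl _
    have h_rotp : SpacePeriodic L (rot (u T)) := (hu.periodic T hTT).diffOp _
    have h_sq := integral_norm_sq_sub_biotSavart_le hn hL h_sol.contDiff h_sol.periodic
      h_sol.divergence_eq_zero (hu.zero_average T hTT) h_rot h_rotp
    rw [Nat.sub_add_cancel (Nat.one_le_of_lt hk), hW.terminal, node_self (Nat.ne_zero_of_lt hk),
      ← hu.terminal]
    refine ((eLpNorm_cell_le_ofReal_iff ((hu.contDiff hTT).continuous.sub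
      (continuous_biotSavart hn hL h_rot h_rotp)) le_rfl).2 (by simpa using h_sq)).trans (by simp)

theorem eLpNorm_sub_le (hk : k < N) (ht : t ∈ Icc (node T N k) (node T N (k + 1))) :
    eLpNorm (fun x => u t x - biotSavart L (W k t) x) 2 (volume.restrict (cell n L)) ≤
      ENNReal.ofReal (Real.exp (M * T) * localErrorConst n L T M * T * (T / N)) := by
  have hkN : (k + 1 : ℝ) ≤ N := by exact_mod_cast hk
  have hN : (0 : ℝ) < N := (by positivity : (0 : ℝ) < k + 1).trans_le hkN
  have ht0 : 0 ≤ t := (node_nonneg hT.le).trans ht.1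
  have hD := localErrorConst_nonneg (n := n) (T := T) (M := M) hL.le
  refine (hW.eLpNorm_sub_le_of_node hn hL hT hf hu h_restart (sub_nonneg.2 hkN) hk
    (hW.eLpNorm_sub_node_le hn hL hT hf hu h_restart hk) ht).trans (ENNReal.ofReal_le_ofReal ?_)
  obtain ⟨v, q, -, hM⟩ := h_restart k hk
  have hM0 := hM.nonneg (node_nonneg hT.le)
  calc (N - (k + 1) + 1) * (Real.exp (M * (T - t)) * (localErrorConst n L T M * (T / N) ^ 2))
      ≤ N * (Real.exp (M * T) * (localErrorConst n L T M * (T / N) ^ 2)) := by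
        gcongr <;> linarith
    _ = Real.exp (M * T) * localErrorConst n L T M * T * (T / N) := by
        field_simp

end Convergence

end IsVorticityApprox

/-! ### Vorticities in dimensions two and three as two-forms -/

section TwoForm

variable {n : ℕ} {L : ℝ}

lemma coeff_neg (g : E n → ℝ) (m : Fin n → ℤ) : coeff L (fun x => -g x) m = -coeff L g m := by
  simp only [coeff, Complex.ofReal_neg, neg_mul, integral_neg, mul_neg]

lemma coeff_const_zero (m : Fin n → ℤ) : coeff L (fun _ : E n => 0) m = 0 := by
  simp [coeff]

lemma potentialSeries_neg (c : (Fin n → ℤ) → ℂ) (x : E n) :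
    potentialSeries L (fun m => -c m) x = -potentialSeries L c x := by
  simp only [potentialSeries, mul_neg, tsum_neg, Complex.neg_re]

lemma trace_fderiv_eq_zero {v : E n → E n} {x : E n} (hv : ContDiff ℝ 1 v)
    (hdiv : divergence v x = 0) : ∑ i, fderiv ℝ v x (basisVec i) i = 0 := by
  simpa only [divergence, partialD_eq hv] using hdiv

lemma isFrozenVorticity_comp {F : Type*} [NormedAddCommGroup F] [NormedSpace ℝ F]
    {c a b : ℝ} {v : E n → E n} {f : ℝ → E n → E n} {w g : ℝ → E n → F} (J : F →L[ℝ] Tensor2 n)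
    (hJ : ∀ ω, IsAntisymm (J ω))
    (hw : ContDiffOn ℝ 3 (fun z : ℝ × E n => w z.1 z.2) (slab n a b))
    (hp : ∀ t ∈ Icc a b, SpacePeriodic L (w t))
    (hw' : ∀ t ∈ Ico a b, ∀ x, HasDerivWithinAt (fun s => w s x)
      (-(c • Laplacian.laplacian (w t) x) + advect v (w t) x + g t x) (Icc a b) t)
    (hg : ∀ t ∈ Ioo a b, ∀ x, J (g t x) = stretch (J (w t x)) (fderiv ℝ v x) - rot (f t) x) :
    IsFrozenVorticity L c a b v f fun t x => J (w t x) where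
  contDiffOn := J.contDiff.comp_contDiffOn hw
  periodic t ht := (hp t ht).comp J
  antisymm t _ x := hJ _
  equation t ht x := by
    have h_slice : ContDiff ℝ 3 (w t) := contDiff_slice hw (Ioo_subset_Icc_self ht)
    have h_laplacian : Laplacian.laplacian (fun y => J (w t y)) x =
        J (Laplacian.laplacian (w t) x) :=
      (h_slice.of_le (by norm_num)).contDiffAt.laplacian_CLM_comp_left
    have h_advect : advect v (fun y => J (w t y)) x = J (advect v (w t) x) := by
      have h := (J.hasFDerivAt.comp x (h_slice.differentiable (by norm_num) x).hasFDerivAt).fderiv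
      exact congrArg (· (v x)) h
    refine (J.hasFDerivAt.comp_hasDerivAt t ((hw' t (Ioo_subset_Ico_self ht) x).hasDerivAt
      (Icc_mem_nhds ht.1 ht.2))).congr_deriv ?_
    rw [map_add, map_add, map_neg, map_smul, hg t ht, lieDeriv, h_laplacian, h_advect]
    abel

end TwoForm

section Planar

variable {L : ℝ}

/-- The two-form `ω dx₀ ∧ dx₁` of a scalar vorticity `ω` in dimension two. -/
def twoForm2 : ℝ →L[ℝ] Tensor2 2 :=
  LinearMap.toContinuousLinearMap
    { toFun := fun ω => WithLp.toLp 2 fun q => !![0, ω; -ω, 0] q.1 q.2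
      map_add' := fun ω₁ ω₂ => by
        ext ⟨i, j⟩
        fin_cases i <;> fin_cases j <;> simp [add_comm]
      map_smul' := fun c ω => by
        ext ⟨i, j⟩
        fin_cases i <;> fin_cases j <;> simp }

lemma twoForm2_apply (ω : ℝ) (i j : Fin 2) : twoForm2 ω (i, j) = !![0, ω; -ω, 0] i j := rfl

lemma isAntisymm_twoForm2 (ω : ℝ) : IsAntisymm (twoForm2 ω) := fun i j => by
  fin_cases i <;> fin_cases j <;> simp [twoForm2_apply]

lemma rot_eq_twoForm2_curl2 {v : E 2 → E 2} (hv : ContDiff ℝ 1 v) :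
    rot v = fun x => twoForm2 (curl2 v x) := by
  ext x ⟨i, j⟩
  simp only [rot, diffOp, rotSymbol_apply, twoForm2_apply, curl2, partialD_eq hv]
  fin_cases i <;> fin_cases j <;> simp

lemma biotSavart_twoForm2 (ω : E 2 → ℝ) :
    biotSavart L (fun x => twoForm2 (ω x)) = biotSavart2 L ω := by
  ext x j
  simp only [biotSavart, biotSavart2]
  unfold divCoeff
  fin_cases j <;> simp [twoForm2_apply, coeff_neg, coeff_const_zero, Fin.sum_univ_two,
    potentialSeries_neg]

lemma stretch_twoForm2 (ω : ℝ) {A : E 2 →L[ℝ] E 2} (hA : ∑ i, A (basisVec i) i = 0) :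
    stretch (twoForm2 ω) A = 0 := by
  rw [Fin.sum_univ_two] at hA
  ext ⟨i, j⟩
  rw [stretch_apply, Fin.sum_univ_two]
  simp only [twoForm2_apply]
  fin_cases i <;> fin_cases j <;> simp
  · linear_combination ω * hA
  · linear_combination -ω * hA

theorem IsVorticityApprox2.isVorticityApprox {σ T : ℝ} {N : ℕ} {f : ℝ → E 2 → E 2}
    {φ : E 2 → E 2} {w : ℕ → ℝ → E 2 → ℝ} (hw : IsVorticityApprox2 L σ T N f φ w) (hT : 0 ≤ T)
    (hf : ∀ t ∈ Ico 0 T, ContDiff ℝ 1 (f t)) (hφ : ContDiff ℝ 1 φ)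
    (hsol : ∀ k < N, IsSolenoidal L (biotSavart2 L (w k (node T N (k + 1))))) :
    IsVorticityApprox L σ T N f φ fun k t x => twoForm2 (w k t x) where
  isFrozenVorticity k hk := by
    rw [biotSavart_twoForm2]
    refine isFrozenVorticity_comp (g := fun t x => -curl2 (f t) x) twoForm2 isAntisymm_twoForm2
      (hw.smooth k hk) (hw.periodic k hk) (fun t ht x => ?_) (fun t ht x => ?_)
    · simpa only [smul_eq_mul, sub_eq_add_neg] using hw.equation k hk t ht x
    · rw [stretch_twoForm2 _ (trace_fderiv_eq_zero (hsol k hk).contDiff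
          ((hsol k hk).divergence_eq_zero x)),
        rot_eq_twoForm2_curl2 (hf t (Ioo_node_subset hT hk ht)), map_neg, zero_sub]
  terminal := by rw [hw.terminal, rot_eq_twoForm2_curl2 hφ]
  matching k hk := by rw [hw.matching k hk]

end Planar

section Spatial

variable {L : ℝ}

/-- The two-form `ω₀ dx₁ ∧ dx₂ + ω₁ dx₂ ∧ dx₀ + ω₂ dx₀ ∧ dx₁` of a vorticity vector `ω` in dimension
three. -/
def twoForm3 : E 3 →L[ℝ] Tensor2 3 :=
  LinearMap.toContinuousLinearMap
    { toFun := fun ω => WithLp.toLp 2 fun q =>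
        !![0, ω 2, -ω 1; -ω 2, 0, ω 0; ω 1, -ω 0, 0] q.1 q.2
      map_add' := fun ω₁ ω₂ => by
        ext ⟨i, j⟩
        simp only [PiLp.add_apply]
        fin_cases i <;> fin_cases j <;> simp [add_comm]
      map_smul' := fun c ω => by
        ext ⟨i, j⟩
        fin_cases i <;> fin_cases j <;> simp }

lemma twoForm3_apply (ω : E 3) (i j : Fin 3) :
    twoForm3 ω (i, j) = !![0, ω 2, -ω 1; -ω 2, 0, ω 0; ω 1, -ω 0, 0] i j := rfl

lemma isAntisymm_twoForm3 (ω : E 3) : IsAntisymm (twoForm3 ω) := fun i j => by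
  fin_cases i <;> fin_cases j <;> simp [twoForm3_apply]

lemma rot_eq_twoForm3_curl3 {v : E 3 → E 3} (hv : ContDiff ℝ 1 v) :
    rot v = fun x => twoForm3 (curl3 v x) := by
  ext x ⟨i, j⟩
  simp only [rot, diffOp, rotSymbol_apply, twoForm3_apply, curl3, partialD_eq hv]
  fin_cases i <;> fin_cases j <;> simp

lemma biotSavart_twoForm3 (ω : E 3 → E 3) :
    biotSavart L (fun x => twoForm3 (ω x)) = biotSavart3 L ω := by
  ext x j
  simp only [biotSavart, biotSavart3]
  unfold divCoeff
  fin_cases j <;> simp [twoForm3_apply, coeff_neg, coeff_const_zero, Fin.sum_univ_three,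
    sub_eq_add_neg, add_comm]

lemma stretch_twoForm3 (ω : E 3) {A : E 3 →L[ℝ] E 3} (hA : ∑ i, A (basisVec i) i = 0) :
    stretch (twoForm3 ω) A = twoForm3 (-A ω) := by
  rw [Fin.sum_univ_three] at hA
  ext ⟨i, j⟩
  rw [stretch_apply, Fin.sum_univ_three]
  simp only [twoForm3_apply, PiLp.neg_apply, apply_coord_eq_sum A ω, Fin.sum_univ_three]
  fin_cases i <;> fin_cases j <;> simp
  · linear_combination ω 2 * hA
  · linear_combination -ω 1 * hA
  · linear_combination -ω 2 * hA
  · linear_combination ω 0 * hA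
  · linear_combination ω 1 * hA
  · linear_combination -ω 0 * hA

theorem IsVorticityApprox3.isVorticityApprox {σ T : ℝ} {N : ℕ} {f : ℝ → E 3 → E 3}
    {φ : E 3 → E 3} {w : ℕ → ℝ → E 3 → E 3} (hw : IsVorticityApprox3 L σ T N f φ w) (hT : 0 ≤ T)
    (hf : ∀ t ∈ Ico 0 T, ContDiff ℝ 1 (f t)) (hφ : ContDiff ℝ 1 φ)
    (hsol : ∀ k < N, IsSolenoidal L (biotSavart3 L (w k (node T N (k + 1))))) :
    IsVorticityApprox L σ T N f φ fun k t x => twoForm3 (w k t x) where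
  isFrozenVorticity k hk := by
    rw [biotSavart_twoForm3]
    refine isFrozenVorticity_comp
      (g := fun t x => -advect (w k t) (biotSavart3 L (w k (node T N (k + 1)))) x - curl3 (f t) x)
      twoForm3 isAntisymm_twoForm3 (hw.smooth k hk) (hw.periodic k hk) (fun t ht x => ?_)
      (fun t ht x => ?_)
    · simpa only [sub_eq_add_neg, add_assoc] using hw.equation k hk t ht x
    · rw [stretch_twoForm3 _ (trace_fderiv_eq_zero (hsol k hk).contDiff
          ((hsol k hk).divergence_eq_zero x)),
        rot_eq_twoForm3_curl3 (hf t (Ioo_node_subset hT hk ht)), map_sub, advect]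
  terminal := by rw [hw.terminal, rot_eq_twoForm3_curl3 hφ]
  matching k hk := by rw [hw.matching k hk]

end Spatial

end PeriodicNSE

end

open PeriodicNSE in
theorem mainTheorem3_general {n : ℕ} (hn : n < 6) (L T σ M : ℝ) (hL : 0 < L) (hT : 0 < T) :
    ∃ K : ℝ, ∀ (f : ℝ → E n → E n) (φ : E n → E n) (u : ℝ → E n → E n) (p : ℝ → E n → ℝ),
      (∀ t ∈ Ico 0 T, ContDiff ℝ 2 (f t) ∧ SpacePeriodic L (f t)) →
      IsNSESolution L σ T f φ u p →
      ∀ (N : ℕ) (W : ℕ → ℝ → E n → Tensor2 n),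
        IsVorticityApprox L σ T N f φ W →
        (∀ k < N, ∃ (v : ℝ → E n → E n) (q : ℝ → E n → ℝ),
          IsNSESolution L σ (node T N (k + 1)) f
            (biotSavart L (W k (node T N (k + 1)))) v q ∧
          DerivativesBoundedBy M (node T N (k + 1)) v) →
        ∀ k < N, ∀ t ∈ Icc (node T N k) (node T N (k + 1)),
          eLpNorm (fun x => u t x - biotSavart L (W k t) x) 2 (volume.restrict (cell n L))
            ≤ ENNReal.ofReal (K * (T / N)) :=
  ⟨Real.exp (M * T) * localErrorConst n L T M * T,
    fun _ _ _ _ hf hu _ _ hW h_restart _ hk _ ht =>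
      hW.eLpNorm_sub_le hn hL hT hf hu h_restart hk ht⟩

open PeriodicNSE in
theorem mainTheorem3 (L T σ M : ℝ) (hL : 0 < L) (hT : 0 < T) (hσ : 0 < σ) :
    (∃ K : ℝ, ∀ (f : ℝ → E 2 → E 2) (φ : E 2 → E 2) (u : ℝ → E 2 → E 2) (p : ℝ → E 2 → ℝ),
      (∀ t ∈ Ico 0 T, ContDiff ℝ 2 (f t) ∧ SpacePeriodic L (f t)) →
      IsNSESolution L σ T f φ u p →
      ∀ (N : ℕ), 0 < N → ∀ w : ℕ → ℝ → E 2 → ℝ,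
        IsVorticityApprox2 L σ T N f φ w →
        (∀ k < N, ∃ (v : ℝ → E 2 → E 2) (q : ℝ → E 2 → ℝ),
          IsNSESolution L σ (node T N (k + 1)) f
            (biotSavart2 L (w k (node T N (k + 1)))) v q ∧
          DerivativesBoundedBy M (node T N (k + 1)) v) →
        ∀ k < N, ∀ t ∈ Icc (node T N k) (node T N (k + 1)),
          eLpNorm (fun x => u t x - biotSavart2 L (w k t) x) 2 (volume.restrict (cell 2 L))
            ≤ ENNReal.ofReal (K * (T / N))) ∧
    (∃ K : ℝ, ∀ (f : ℝ → E 3 → E 3) (φ : E 3 → E 3) (u : ℝ → E 3 → E 3) (p : ℝ → E 3 → ℝ),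
      (∀ t ∈ Ico 0 T, ContDiff ℝ 2 (f t) ∧ SpacePeriodic L (f t)) →
      IsNSESolution L σ T f φ u p →
      ∀ (N : ℕ), 0 < N → ∀ w : ℕ → ℝ → E 3 → E 3,
        IsVorticityApprox3 L σ T N f φ w →
        (∀ k < N, ∃ (v : ℝ → E 3 → E 3) (q : ℝ → E 3 → ℝ),
          IsNSESolution L σ (node T N (k + 1)) f
            (biotSavart3 L (w k (node T N (k + 1)))) v q ∧
          DerivativesBoundedBy M (node T N (k + 1)) v) →
        ∀ k < N, ∀ t ∈ Icc (node T N k) (node T N (k + 1)),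
          eLpNorm (fun x => u t x - biotSavart3 L (w k t) x) 2 (volume.restrict (cell 3 L))
            ≤ ENNReal.ofReal (K * (T / N))) := by
  obtain ⟨K₂, hK₂⟩ := mainTheorem3_general (by norm_num : 2 < 6) L T σ M hL hT
  obtain ⟨K₃, hK₃⟩ := mainTheorem3_general (by norm_num : 3 < 6) L T σ M hL hT
  refine ⟨⟨K₂, fun f φ u p hf hu N _ w hw h_restart => ?_⟩,
    ⟨K₃, fun f φ u p hf hu N _ w hw h_restart => ?_⟩⟩
  · have hW := hw.isVorticityApprox hT.le (fun t ht => (hf t ht).1.of_le one_le_two)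
      ((hu.contDiff_terminal hT.le).of_le (by norm_num)) fun k hk =>
        let ⟨_, _, hv, _⟩ := h_restart k hk
        hv.isSolenoidal_terminal (node_nonneg hT.le)
    simpa only [biotSavart_twoForm2] using hK₂ f φ u p hf hu N _ hW
      (by simpa only [biotSavart_twoForm2] using h_restart)
  · have hW := hw.isVorticityApprox hT.le (fun t ht => (hf t ht).1.of_le one_le_two)
      ((hu.contDiff_terminal hT.le).of_le (by norm_num)) fun k hk =>
        let ⟨_, _, hv, _⟩ := h_restart k hk
        hv.isSolenoidal_terminal (node_nonneg hT.le)
    simpa only [biotSavart_twoForm3] using hK₃ f φ u p hf hu N _ hW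
      (by simpa only [biotSavart_twoForm3] using h_restart)
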